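/- Let $D$ be the open unit disk, $dA$ the area measure on $D$ normalized so that $A(D)=1$, and let $L_h^2$ be the harmonic Bergman space, i.e. the closed subspace of $L^2(D,dA)$ of complex-valued harmonic functions. Let $$Qf(z)=\int_D\Big(\frac1{(1-z\bar w)^2}+\frac1{(1-\bar z w)^2}-1\Big)f(w)\,dA(w)$$ be the orthogonal projection onto $L_h^2$, extended by this formula to $f\in L^1(D,dA)$. A function $F\in L^1(D,dA)$ is a *T-function* if $p\mapsto Q(Fp)$, defined on the harmonic polynomials $p$, is bounded in the norm of $L_h^2$; its continuous extension to $L_h^2$ is the Toeplitz operator $T_F$. An operator has *finite rank* if the closure of its range is finite-dimensional; $\operatorname{rank}(A)=\dim \operatorname{Ran}(A)$. For $f,g\in L_h^2$ put $(f\otimes g)h=\langle h,g\rangle f$. For a radial function $\varphi$ put $\widehat\varphi(z)=\int_0^1\varphi(r)r^{z-1}\,dr$. Equalities of radial functions are almost everywhere, and equalities of Mellin transforms are for all complex $z$ with $\operatorname{Re}z\ge2$ (with $1/\Gamma=0$ at the poles of $\Gamma$). In each condition below the same constant $C\in\mathbb C$ occurs in the formulas for $\varphi$ and $\psi$. **Theorem.**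 Let $k_1,k_2\in\mathbb Z$, let $m\in\mathbb R$ with $m\ge-1$, and let $\varphi,\psi$ be nonzero radial T-functions on $D$. Then $e^{ik_1\theta}r^m$, $e^{ik_2\theta}\varphi$ and $e^{i(k_1+k_2)\theta}\psi$ are T-functions, and the generalized semicommutator $$S=T_{e^{ik_1\theta}r^m}T_{e^{ik_2\theta}\varphi}-T_{e^{i(k_1+k_2)\theta}\psi}$$ on $L_h^2$ has finite rank if and only if one of the following conditions holds for some constant $C$ (where $C$ occurs): 1. $k_1=m=0$ and $\psi=\varphi$. 2. $k_2=0$, $\varphi=C$ and $\psi=Cr^m$. 3. $k_1=k_2=0$ and $\psi(r)=\varphi(r)-mr^m\int_r^1\frac{\varphi(t)}{t^{m+1}}\,dt$. 4. $k_1k_2=-1$, $\varphi=C\left(\frac{m+1}2r^{-1}-\frac{m-1}2r\right)$ and $\psi=C$. 5. $k_1k_2<-1$, $|k_2|\ge2$, $m+|k_1|=0$, $\varphi=Cr^{|k_2|}$ and $\psi=Cr^{|k_2|-1}$. 6. $k_1k_2<-1$, $|k_2|=1$, $$\widehat\varphi(z)=C\frac{\Gamma\left(\frac{z-1}{2|k_1|}\right)\Gamma\left(\frac{z+m+|k_1|+1}{2|k_1|}\right)}{\Gamma\left(\frac{z+2|k_1|+1}{2|k_1|}\right)\Gamma\left(\frac{z+m+|k_1|-1}{2|k_1|}\right)},\qquad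 \widehat\psi(z)=C\frac{\Gamma\left(\frac{z+|k_1|-1}{2|k_1|}\right)\Gamma\left(\frac{z+m+1}{2|k_1|}\right)}{\Gamma\left(\frac{z+|k_1|+1}{2|k_1|}\right)\Gamma\left(\frac{z+m+2|k_1|-1}{2|k_1|}\right)}.$$ 7. $k_1k_2>0$, $|k_2|<m+2$, $$\widehat\varphi(z)=C\frac{\Gamma\left(\frac{z+|k_2|}{2|k_1|}\right)\Gamma\left(\frac{z+m+|k_1|-|k_2|}{2|k_1|}\right)}{\Gamma\left(\frac{z+2|k_1|-|k_2|}{2|k_1|}\right)\Gamma\left(\frac{z+m+|k_1|+|k_2|}{2|k_1|}\right)},\qquad \widehat\psi(z)=C\frac{\Gamma\left(\frac{z+|k_1|+|k_2|}{2|k_1|}\right)\Gamma\left(\frac{z+m-|k_2|}{2|k_1|}\right)}{\Gamma\left(\frac{z+|k_1|-|k_2|}{2|k_1|}\right)\Gamma\left(\frac{z+m+2|k_1|+|k_2|}{2|k_1|}\right)}.$$ 8. $k_1k_2>0$, $|k_2|\ge m+2$, $m=(2n+1)|k_1|$ for some $n\in\mathbb N=\{0,1,2,\dots\}$, $$\widehat\varphi(z)=C\frac{\prod_{j=1}^{n}\left(\frac{z-|k_2|}{2|k_1|}+j\right)}{\prod_{j=0}^{n}\left(\frac{z+|k_2|}{2|k_1|}+j\right)},\qquad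 \widehat\psi(z)=C\frac{\prod_{j=0}^{n-1}\left(\frac{z+|k_1|-|k_2|}{2|k_1|}+j\right)}{\prod_{j=0}^{n}\left(\frac{z+|k_1|+|k_2|}{2|k_1|}+j\right)}.$$ Under each of the conditions 1–4, $\operatorname{rank}(S)=0$. Under each of the conditions 5–8, $$\operatorname{Ran}(S)=\operatorname{span}\{r^{|k|}e^{ik\theta}:k\in\Lambda_2\},\qquad S=\sum_{k\in\Lambda_2}C_k\,\big(r^{|k|}e^{ik\theta}\big)\otimes\big(r^{|k-k_1-k_2|}e^{i(k-k_1-k_2)\theta}\big)$$ with nonzero constants $C_k$, where $$\Lambda_2=\{k\in\mathbb Z:-N_3+k_1+k_2+1\le k\le N_2+k_1+k_2-1\},$$ $N_2=\max\{0,-k_2,-k_1-k_2\}$ and $N_3=\max\{0,k_2,k_1+k_2\}$; and $$\operatorname{rank}(S)=\max\{|k_1|-1,|k_2|-1,|k_1+k_2|-1\}.$$ -/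

import Mathlib

open MeasureTheory

noncomputable section

namespace HarmonicToeplitz

/-- Lebesgue area measure on the open unit disk, normalized to total mass `1`. -/
def diskMeasure : Measure ℂ :=
  ENNReal.ofReal (Real.pi⁻¹) • volume.restrict (Metric.ball (0 : ℂ) 1)

instance instIsFiniteMeasureDisk : IsFiniteMeasure diskMeasure := by
  refine ⟨?_⟩
  rw [diskMeasure, Measure.smul_apply, Measure.restrict_apply_univ, smul_eq_mul]
  exact ENNReal.mul_lt_top ENNReal.ofReal_lt_top measure_ball_lt_top

/-- The harmonic Bergman space: the (classes of) complex-valued harmonic functions on the unit disk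
inside `L²` of the disk. -/
def HarmonicBergman : Submodule ℂ (Lp ℂ 2 diskMeasure) where
  carrier := {f | ∃ h : ℂ → ℂ,
    InnerProductSpace.HarmonicOnNhd h (Metric.ball (0 : ℂ) 1) ∧ f =ᵐ[diskMeasure] h}
  zero_mem' := ⟨fun _ => 0, InnerProductSpace.harmonicOnNhd_const 0, Lp.coeFn_zero _ _ _⟩
  add_mem' := by
    rintro f g ⟨u, hu, hfu⟩ ⟨v, hv, hgv⟩
    exact ⟨u + v, hu.add hv, (Lp.coeFn_add f g).trans (hfu.add hgv)⟩
  smul_mem' := by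
    rintro c f ⟨u, hu, hfu⟩
    refine ⟨fun z => c * u z, ?_, ?_⟩
    · exact hu.comp_CLM (ContinuousLinearMap.mul ℝ ℂ c)
    · filter_upwards [Lp.coeFn_smul c f, hfu] with z h1 h2
      rw [h1, Pi.smul_apply, h2, smul_eq_mul]

/-- The quasihomogeneous function `e^{ikθ} φ(r)` of degree `k`, where `z = r e^{iθ}`. -/
def quasi (k : ℤ) (φ : ℝ → ℂ) (z : ℂ) : ℂ :=
  Complex.exp ((k : ℂ) * (Complex.arg z : ℂ) * Complex.I) * φ ‖z‖

/-- The function `r^{|k|} e^{ikθ}`. -/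
def harmMonoFun (k : ℤ) : ℂ → ℂ := quasi k (fun r => (r : ℂ) ^ k.natAbs)

lemma harmMonoFun_natCast (n : ℕ) (z : ℂ) : harmMonoFun (n : ℤ) z = z ^ n := by
  conv_rhs => rw [← Complex.norm_mul_exp_arg_mul_I z, mul_pow, ← Complex.exp_nat_mul]
  simp only [harmMonoFun, quasi, Int.natAbs_natCast, Int.cast_natCast]
  rw [mul_comm, mul_assoc]

lemma harmMonoFun_neg_natCast (n : ℕ) (z : ℂ) :
    harmMonoFun (-(n : ℤ)) z = (starRingEnd ℂ) (z ^ n) := by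
  rw [← harmMonoFun_natCast]
  simp [harmMonoFun, quasi, ← Complex.exp_conj]

lemma harmonicOnNhd_harmMonoFun (k : ℤ) (s : Set ℂ) :
    InnerProductSpace.HarmonicOnNhd (harmMonoFun k) s := by
  intro x _
  obtain ⟨n, rfl | rfl⟩ := k.eq_nat_or_neg
  · rw [show harmMonoFun (n : ℤ) = fun z => z ^ n from funext (harmMonoFun_natCast n)]
    exact AnalyticAt.harmonicAt (by fun_prop)
  · rw [show harmMonoFun (-(n : ℤ)) = fun z => (starRingEnd ℂ) (z ^ n) from
      funext (harmMonoFun_neg_natCast n)]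
    have h : AnalyticAt ℂ (fun z : ℂ => z ^ n) x := by fun_prop
    exact h.harmonicAt.comp_CLM (Complex.conjCLE : ℂ →L[ℝ] ℂ)

lemma memLp_harmMonoFun (k : ℤ) : MemLp (harmMonoFun k) 2 diskMeasure := by
  have hc : Continuous (harmMonoFun k) := by
    obtain ⟨n, rfl | rfl⟩ := k.eq_nat_or_neg
    · rw [show harmMonoFun (n : ℤ) = fun z => z ^ n from funext (harmMonoFun_natCast n)]
      fun_prop
    · rw [show harmMonoFun (-(n : ℤ)) = fun z => (starRingEnd ℂ) (z ^ n) from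
        funext (harmMonoFun_neg_natCast n)]
      exact Complex.continuous_conj.comp (continuous_pow n)
  refine MemLp.of_bound hc.aestronglyMeasurable 1 ?_
  refine Measure.ae_smul_measure ?_ _
  filter_upwards [ae_restrict_mem Metric.isOpen_ball.measurableSet] with z hz
  rw [mem_ball_zero_iff] at hz
  have : ‖harmMonoFun k z‖ = ‖z‖ ^ k.natAbs := by
    obtain ⟨n, rfl | rfl⟩ := k.eq_nat_or_neg
    · simp [harmMonoFun_natCast]
    · simp [harmMonoFun_neg_natCast]
  rw [this]
  exact pow_le_one₀ (norm_nonneg z) hz.le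

/-- `r^{|k|} e^{ikθ}` as an element of the harmonic Bergman space. -/
def harmMono (k : ℤ) : HarmonicBergman :=
  ⟨(memLp_harmMonoFun k).toLp (harmMonoFun k),
    harmMonoFun k, harmonicOnNhd_harmMonoFun k _, (memLp_harmMonoFun k).coeFn_toLp⟩

/-- The harmonic polynomials: the span of `zⁿ` and `z̄ⁿ`, `n ∈ ℕ`. -/
def harmPoly : Submodule ℂ HarmonicBergman := Submodule.span ℂ (Set.range harmMono)

/-- The reproducing kernel `R_z(w)` of the harmonic Bergman space. -/
def harmKernel (z w : ℂ) : ℂ :=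
  1 / (1 - z * (starRingEnd ℂ) w) ^ 2 + 1 / (1 - (starRingEnd ℂ) z * w) ^ 2 - 1

/-- The projection onto the harmonic Bergman space, in its integral form, which makes sense on all
of `L¹` of the disk. -/
def harmProj (f : ℂ → ℂ) (z : ℂ) : ℂ := ∫ w, harmKernel z w * f w ∂diskMeasure

/-- `T` is a bounded operator on the harmonic Bergman space with `T p = Q (F p)` for all harmonic
polynomials `p`. -/
def ExtendsToeplitz (F : ℂ → ℂ) (T : HarmonicBergman →L[ℂ] HarmonicBergman) : Prop :=
  ∀ p ∈ harmPoly, ((T p : Lp ℂ 2 diskMeasure) : ℂ → ℂ) =ᵐ[diskMeasure]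
    harmProj (fun w => F w * ((p : Lp ℂ 2 diskMeasure) : ℂ → ℂ) w)

/-- `F` is a T-function: `F` is in `L¹` of the disk and `p ↦ Q (F p)`, densely defined on the
harmonic polynomials, is bounded for the norm of the harmonic Bergman space. -/
def IsTFunction (F : ℂ → ℂ) : Prop :=
  Integrable F diskMeasure ∧ ∃ T, ExtendsToeplitz F T

open Classical in
/-- The Toeplitz operator `T_F` of a T-function `F`: the (unique) continuous extension of
`p ↦ Q (F p)`. Only meant for T-functions. -/
def toeplitz (F : ℂ → ℂ) : HarmonicBergman →L[ℂ] HarmonicBergman :=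
  if h : IsTFunction F then h.2.choose else 0

/-- An operator has finite rank if the closure of its range is finite-dimensional. -/
def HasFiniteRank (A : HarmonicBergman →L[ℂ] HarmonicBergman) : Prop :=
  FiniteDimensional ℂ (LinearMap.range A.toLinearMap).topologicalClosure

/-- The rank of an operator: the dimension of its range. -/
def opRank (A : HarmonicBergman →L[ℂ] HarmonicBergman) : Cardinal :=
  Module.rank ℂ (LinearMap.range A.toLinearMap)

/-- The rank one operator `f ⊗ g`, that is `h ↦ ⟨h, g⟩ f`, where `⟨·, ·⟩` is linear in its first
argument (and Mathlib's `inner` in its second). -/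
def tensor (f g : HarmonicBergman) : HarmonicBergman →L[ℂ] HarmonicBergman :=
  (innerSL ℂ g).smulRight f

/-- The Mellin transform `∫₀¹ φ(r) r^{z-1} dr` of a radial function. -/
def mellinT (φ : ℝ → ℂ) (z : ℂ) : ℂ := ∫ r in Set.Ioo (0 : ℝ) 1, φ r * (r : ℂ) ^ (z - 1)

/-- Equality of radial functions on the disk (almost everywhere). -/
def RadialEq (φ ψ : ℝ → ℂ) : Prop :=
  ∀ᵐ r ∂(volume.restrict (Set.Ioo (0 : ℝ) 1)), φ r = ψ r

/-- The generalized semicommutator `T_{e^{ik₁θ} r^m} T_{e^{ik₂θ} φ} - T_{e^{i(k₁+k₂)θ} ψ}`. -/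
def semicomm (k₁ k₂ : ℤ) (m : ℝ) (φ ψ : ℝ → ℂ) : HarmonicBergman →L[ℂ] HarmonicBergman :=
  (toeplitz (quasi k₁ fun r => ((r ^ m : ℝ) : ℂ))).comp (toeplitz (quasi k₂ φ)) -
    toeplitz (quasi (k₁ + k₂) ψ)

/-- The index set `Λ₂`, with `N₂ = max {0, -k₂, -k₁-k₂}` and `N₃ = max {0, k₂, k₁+k₂}`. -/
def Lambda2 (k₁ k₂ : ℤ) : Finset ℤ :=
  Finset.Icc (-(max 0 (max k₂ (k₁ + k₂))) + k₁ + k₂ + 1)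
    (max 0 (max (-k₂) (-k₁ - k₂)) + k₁ + k₂ - 1)

/-- `|k|` as a complex number. -/
def cabs (k : ℤ) : ℂ := ((|k| : ℤ) : ℂ)

def Cond1 (k₁ : ℤ) (m : ℝ) (φ ψ : ℝ → ℂ) : Prop :=
  k₁ = 0 ∧ m = 0 ∧ RadialEq ψ φ

def Cond2 (k₂ : ℤ) (m : ℝ) (φ ψ : ℝ → ℂ) : Prop :=
  k₂ = 0 ∧ ∃ C : ℂ, RadialEq φ (fun _ => C) ∧ RadialEq ψ (fun r => C * ((r ^ m : ℝ) : ℂ))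

def Cond3 (k₁ k₂ : ℤ) (m : ℝ) (φ ψ : ℝ → ℂ) : Prop :=
  k₁ = 0 ∧ k₂ = 0 ∧
    RadialEq ψ (fun r => φ r -
      (m : ℂ) * ((r ^ m : ℝ) : ℂ) * ∫ t in r..1, φ t / ((t ^ (m + 1) : ℝ) : ℂ))

def Cond4 (k₁ k₂ : ℤ) (m : ℝ) (φ ψ : ℝ → ℂ) : Prop :=
  k₁ * k₂ = -1 ∧ ∃ C : ℂ,
    RadialEq φ (fun r => C * (((m + 1) / 2 * r⁻¹ - (m - 1) / 2 * r : ℝ) : ℂ)) ∧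
    RadialEq ψ (fun _ => C)

def Cond5 (k₁ k₂ : ℤ) (m : ℝ) (φ ψ : ℝ → ℂ) : Prop :=
  k₁ * k₂ < -1 ∧ 2 ≤ |k₂| ∧ m + ((|k₁| : ℤ) : ℝ) = 0 ∧ ∃ C : ℂ,
    RadialEq φ (fun r => C * (r : ℂ) ^ |k₂|) ∧
    RadialEq ψ (fun r => C * (r : ℂ) ^ (|k₂| - 1))

def Cond6 (k₁ k₂ : ℤ) (m : ℝ) (φ ψ : ℝ → ℂ) : Prop :=
  k₁ * k₂ < -1 ∧ |k₂| = 1 ∧ ∃ C : ℂ, ∀ z : ℂ, 2 ≤ z.re →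
    mellinT φ z = C *
      ((Complex.Gamma ((z - 1) / (2 * cabs k₁)) *
          Complex.Gamma ((z + m + cabs k₁ + 1) / (2 * cabs k₁))) /
        (Complex.Gamma ((z + 2 * cabs k₁ + 1) / (2 * cabs k₁)) *
          Complex.Gamma ((z + m + cabs k₁ - 1) / (2 * cabs k₁)))) ∧
    mellinT ψ z = C *
      ((Complex.Gamma ((z + cabs k₁ - 1) / (2 * cabs k₁)) *
          Complex.Gamma ((z + m + 1) / (2 * cabs k₁))) /
        (Complex.Gamma ((z + cabs k₁ + 1) / (2 * cabs k₁)) *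
          Complex.Gamma ((z + m + 2 * cabs k₁ - 1) / (2 * cabs k₁))))

/-- At the poles of a Gamma function in a denominator the quotient is `0`, as it should be, since
Mathlib's `Complex.Gamma` is `0` at its poles; the arguments of the Gamma functions in the
numerators have positive real part. -/
def Cond7 (k₁ k₂ : ℤ) (m : ℝ) (φ ψ : ℝ → ℂ) : Prop :=
  0 < k₁ * k₂ ∧ ((|k₂| : ℤ) : ℝ) < m + 2 ∧ ∃ C : ℂ, ∀ z : ℂ, 2 ≤ z.re →
    mellinT φ z = C *
      ((Complex.Gamma ((z + cabs k₂) / (2 * cabs k₁)) *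
          Complex.Gamma ((z + m + cabs k₁ - cabs k₂) / (2 * cabs k₁))) /
        (Complex.Gamma ((z + 2 * cabs k₁ - cabs k₂) / (2 * cabs k₁)) *
          Complex.Gamma ((z + m + cabs k₁ + cabs k₂) / (2 * cabs k₁)))) ∧
    mellinT ψ z = C *
      ((Complex.Gamma ((z + cabs k₁ + cabs k₂) / (2 * cabs k₁)) *
          Complex.Gamma ((z + m - cabs k₂) / (2 * cabs k₁))) /
        (Complex.Gamma ((z + cabs k₁ - cabs k₂) / (2 * cabs k₁)) *
          Complex.Gamma ((z + m + 2 * cabs k₁ + cabs k₂) / (2 * cabs k₁))))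

def Cond8 (k₁ k₂ : ℤ) (m : ℝ) (φ ψ : ℝ → ℂ) : Prop :=
  0 < k₁ * k₂ ∧ m + 2 ≤ ((|k₂| : ℤ) : ℝ) ∧ ∃ n : ℕ, m = (2 * (n : ℝ) + 1) * ((|k₁| : ℤ) : ℝ) ∧
    ∃ C : ℂ, ∀ z : ℂ, 2 ≤ z.re →
      mellinT φ z = C *
        ((∏ j ∈ Finset.range n, ((z - cabs k₂) / (2 * cabs k₁) + ((j : ℂ) + 1))) /
          ∏ j ∈ Finset.range (n + 1), ((z + cabs k₂) / (2 * cabs k₁) + (j : ℂ))) ∧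
      mellinT ψ z = C *
        ((∏ j ∈ Finset.range n, ((z + cabs k₁ - cabs k₂) / (2 * cabs k₁) + (j : ℂ))) /
          ∏ j ∈ Finset.range (n + 1), ((z + cabs k₁ + cabs k₂) / (2 * cabs k₁) + (j : ℂ)))

end HarmonicToeplitz

end

namespace HarmonicToeplitz

open Set Filter Topology

/-! ### Integration in polar coordinates -/

/-! In the orthogonal basis of harmonic monomials, a Toeplitz operator with symbol `e^{ikθ} φ(r)` is
a weighted shift of degree `k`, whose weight at index `n` is `2(|n+k|+1)` times the Mellin transform
of `φ` at `|n|+|n+k|+2`. Hence `S` is a weighted shift of degree `k₁ + k₂`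
(`semicomm_apply_harmMono`). It has finite rank exactly when only finitely many of its weights
`scWeight` are nonzero (`hasFiniteRank_iff`), and its range and tensor expansion are read off from
the nonzero weights.

Let `A`, `B` be the Mellin transforms of `φ`, `ψ`, and let `a = k₁`, `b = k₂`; conjugation
(`scWeight_neg`) permits `k₁ ≥ 0`. Vanishing of the weights near `+∞` and near `-∞` gives, on
arithmetic progressions, `(z+b) A(z) = (z+a+b+m) B(z+a)` and `(z+a-b) A(z+a) = (z-b+m) B(z)`. After
`r = e^{-x}` the Mellin transforms become Laplace transforms, and by Weierstrass approximation a
Laplace transform is determined by its values on an arithmetic progression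
(`IsLaplace.eq_of_eq_arith`). So both relations hold for all `Re z ≥ 2` (`mellinRel_of_finite`).

Eliminating `B` leaves a recursion of step `2a` for `A`. By the same uniqueness its solutions among
Laplace transforms form at most a line (`MellinRel.exists_eq_const_mul`), so it suffices to exhibit
one solution for each sign pattern of `k₁`, `k₂`. Generically this is a quotient of four Gamma
functions, which is a Laplace transform by the beta integral (`isLaplace_gammaQuot`). Where its
parameters leave the admissible range, a zero coefficient of the recursion forces a nonzero function
to vanish along a progression. The only escape is a second vanishing coefficient, which makes `m` an
odd multiple of `k₁` (condition 8, rational transforms) or gives `k₁ = 1`, `m = -1` (condition 5).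

Conversely, the two relations kill every weight for which `n`, `n+k₂`, `n+k₁+k₂` are all nonnegative
or all nonpositive; the remaining indices correspond to `Λ₂`. There a weight vanishes only if
`A(k₂+2) = 0`, or if `x ↦ x A(k₂+x)` takes one value at two different points. The second is excluded
because this function is strictly monotone, as Euler's product for Gamma shows
(`gammaRatio_strictAnti`). Condition 5 is checked by direct computation. -/

lemma integral_diskMeasure {E : Type*} [NormedAddCommGroup E] [NormedSpace ℝ E] (f : ℂ → E) :
    ∫ z, f z ∂diskMeasure = Real.pi⁻¹ • ∫ z in Metric.ball (0 : ℂ) 1, f z := by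
  rw [diskMeasure, integral_smul_measure, ENNReal.toReal_ofReal (by positivity)]

lemma integrable_diskMeasure_iff {E : Type*} [NormedAddCommGroup E] {f : ℂ → E} :
    Integrable f diskMeasure ↔ IntegrableOn f (Metric.ball (0 : ℂ) 1) := by
  rw [diskMeasure, integrable_smul_measure (by simp [Real.pi_pos]) ENNReal.ofReal_ne_top,
    IntegrableOn]

lemma ae_diskMeasure_mem_ball : ∀ᵐ z ∂diskMeasure, z ∈ Metric.ball (0 : ℂ) 1 :=
  Measure.ae_smul_measure (ae_restrict_mem Metric.isOpen_ball.measurableSet) _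

lemma integral_exp_int_mul (k : ℤ) :
    ∫ θ in Ioo (-Real.pi) Real.pi, Complex.exp ((k : ℂ) * (θ : ℂ) * Complex.I) =
      if k = 0 then 2 * (Real.pi : ℂ) else 0 := by
  rw [← integral_Ioc_eq_integral_Ioo, ← intervalIntegral.integral_of_le (by linarith [Real.pi_pos])]
  split_ifs with h
  · simp [h]; ring
  · have hk : (k : ℂ) * Complex.I ≠ 0 := by simp [h]
    have : ∀ θ : ℝ, Complex.exp ((k : ℂ) * (θ : ℂ) * Complex.I) =
        Complex.exp (((k : ℂ) * Complex.I) * θ) := fun θ => by ring_nf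
    simp_rw [this]
    rw [integral_exp_mul_complex hk]
    have e : Complex.exp ((k : ℂ) * Complex.I * (Real.pi : ℝ)) =
        Complex.exp ((k : ℂ) * Complex.I * ((-Real.pi : ℝ) : ℂ)) := by
      rw [Complex.exp_eq_exp_iff_exists_int]
      exact ⟨k, by push_cast; ring⟩
    rw [e, sub_self, zero_div]

lemma integral_quasi (k : ℤ) (φ : ℝ → ℂ) :
    ∫ z, quasi k φ z ∂diskMeasure =
      if k = 0 then 2 * ∫ r in Ioo (0 : ℝ) 1, (r : ℂ) * φ r else 0 := by
  rw [integral_diskMeasure, ← integral_indicator Metric.isOpen_ball.measurableSet,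
    ← Complex.integral_comp_polarCoord_symm]
  have h1 : ∀ p ∈ polarCoord.target,
      p.1 • (Metric.ball (0 : ℂ) 1).indicator (fun z => quasi k φ z) (Complex.polarCoord.symm p) =
      ((Iio (1 : ℝ)).indicator (fun r => (r : ℂ) * φ r) p.1) *
        Complex.exp ((k : ℂ) * (p.2 : ℂ) * Complex.I) := by
    rintro ⟨r, θ⟩ ⟨hr, hθ⟩
    simp only [mem_Ioi, mem_Ioo] at hr hθ
    have hn : ‖Complex.polarCoord.symm (r, θ)‖ = r := by
      rw [Complex.norm_polarCoord_symm, abs_of_pos hr]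
    have ha : (Complex.polarCoord.symm (r, θ)).arg = θ := by
      rw [Complex.polarCoord_symm_apply]
      simpa using Complex.arg_mul_cos_add_sin_mul_I hr ⟨hθ.1, hθ.2.le⟩
    by_cases h : r < 1
    · rw [indicator_of_mem (by rw [mem_ball_zero_iff, hn]; exact h), indicator_of_mem (by simpa using h), quasi, hn,
        ha, Complex.real_smul]
      ring
    · rw [indicator_of_notMem (by rw [mem_ball_zero_iff, hn]; exact h),
        indicator_of_notMem (by simpa using h)]
      simp
  rw [setIntegral_congr_fun polarCoord.open_target.measurableSet h1, polarCoord_target,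
    Measure.volume_eq_prod,
    setIntegral_prod_mul (fun r : ℝ => (Iio (1 : ℝ)).indicator (fun r => (r : ℂ) * φ r) r)
      (fun θ : ℝ => Complex.exp ((k : ℂ) * (θ : ℂ) * Complex.I)),
    setIntegral_indicator measurableSet_Iio, Ioi_inter_Iio, integral_exp_int_mul]
  split_ifs with h
  · have : (Real.pi : ℂ) ≠ 0 := by exact_mod_cast Real.pi_ne_zero
    rw [Complex.real_smul]
    push_cast
    field_simp
  · simp

lemma integrable_norm_comp_iff (φ : ℝ → ℂ) :
    Integrable (fun z : ℂ => φ ‖z‖) diskMeasure ↔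
      IntegrableOn (fun r : ℝ => (r : ℂ) * φ r) (Ioo 0 1) := by
  rw [integrable_diskMeasure_iff, ← integrable_indicator_iff Metric.isOpen_ball.measurableSet]
  have h1 : (Metric.ball (0 : ℂ) 1).indicator (fun z : ℂ => φ ‖z‖) =
      fun z : ℂ => (Iio (1 : ℝ)).indicator φ ‖z‖ := by
    ext z
    by_cases h : ‖z‖ < 1
    · rw [indicator_of_mem (by simpa using h), indicator_of_mem (by simpa using h)]
    · rw [indicator_of_notMem (by simpa using h), indicator_of_notMem (by simpa using h)]
  rw [h1, integrable_fun_norm_addHaar]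
  simp only [Complex.finrank_real_complex, Nat.add_one_sub_one, pow_one]
  have h2 : (fun y : ℝ => y • (Iio (1 : ℝ)).indicator φ y) =
      (Iio (1 : ℝ)).indicator (fun r : ℝ => (r : ℂ) * φ r) := by
    ext y
    by_cases h : y < 1
    · rw [indicator_of_mem (by simpa using h), indicator_of_mem (by simpa using h),
        Complex.real_smul]
    · rw [indicator_of_notMem (by simpa using h), indicator_of_notMem (by simpa using h), smul_zero]
  rw [h2, IntegrableOn, integrable_indicator_iff measurableSet_Iio, IntegrableOn,
    Measure.restrict_restrict measurableSet_Iio, inter_comm, Ioi_inter_Iio, IntegrableOn]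

lemma measurable_exp_arg (k : ℤ) :
    Measurable fun z : ℂ => Complex.exp ((k : ℂ) * (Complex.arg z : ℂ) * Complex.I) := by
  have := Complex.measurable_arg
  fun_prop

lemma norm_exp_arg (k : ℤ) (x : ℝ) : ‖Complex.exp ((k : ℂ) * (x : ℂ) * Complex.I)‖ = 1 := by
  have := Complex.norm_exp_ofReal_mul_I (k * x)
  simpa using this

lemma norm_quasi (k : ℤ) (φ : ℝ → ℂ) (z : ℂ) : ‖quasi k φ z‖ = ‖φ ‖z‖‖ := by
  rw [quasi, norm_mul, norm_exp_arg, one_mul]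

lemma quasi_zero (φ : ℝ → ℂ) : quasi 0 φ = fun z => φ ‖z‖ := by
  ext z; simp [quasi]

lemma integrable_quasi_iff (k : ℤ) (φ : ℝ → ℂ) :
    Integrable (quasi k φ) diskMeasure ↔ IntegrableOn (fun r : ℝ => (r : ℂ) * φ r) (Ioo 0 1) := by
  rw [← integrable_norm_comp_iff]
  constructor
  · intro h
    have := h.bdd_mul (c := 1) (f := fun z : ℂ => Complex.exp (((-k : ℤ) : ℂ) * (Complex.arg z : ℂ) * Complex.I))
      (measurable_exp_arg (-k)).aestronglyMeasurable (ae_of_all _ fun z => (norm_exp_arg _ _).le)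
    refine this.congr (ae_of_all _ fun z => ?_)
    simp only [quasi]
    rw [← mul_assoc, ← Complex.exp_add]
    simp
  · intro h
    exact h.bdd_mul (c := 1) (f := fun z : ℂ => Complex.exp ((k : ℂ) * (Complex.arg z : ℂ) * Complex.I))
      (measurable_exp_arg k).aestronglyMeasurable (ae_of_all _ fun z => (norm_exp_arg _ _).le)

lemma quasi_mul_quasi (j k : ℤ) (φ ψ : ℝ → ℂ) (z : ℂ) :
    quasi j φ z * quasi k ψ z = quasi (j + k) (fun r => φ r * ψ r) z := by
  simp only [quasi]
  rw [Int.cast_add, add_mul, add_mul, Complex.exp_add]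
  ring

lemma conj_quasi (k : ℤ) (φ : ℝ → ℂ) (z : ℂ) :
    (starRingEnd ℂ) (quasi k φ z) = quasi (-k) (fun r => (starRingEnd ℂ) (φ r)) z := by
  simp [quasi, ← Complex.exp_conj]

lemma conj_harmMonoFun (k : ℤ) (z : ℂ) :
    (starRingEnd ℂ) (harmMonoFun k z) = harmMonoFun (-k) z := by
  rw [harmMonoFun, conj_quasi, harmMonoFun]
  simp

lemma norm_harmMonoFun (k : ℤ) (z : ℂ) : ‖harmMonoFun k z‖ = ‖z‖ ^ k.natAbs := by
  rw [harmMonoFun, norm_quasi]; simp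

lemma continuous_harmMonoFun (k : ℤ) : Continuous (harmMonoFun k) := by
  obtain ⟨n, rfl | rfl⟩ := k.eq_nat_or_neg
  · rw [funext (harmMonoFun_natCast n)]
    fun_prop
  · rw [funext (harmMonoFun_neg_natCast n)]
    exact Complex.continuous_conj.comp (continuous_pow n)

lemma quasi_mul_harmMonoFun (k n : ℤ) (φ : ℝ → ℂ) (z : ℂ) :
    quasi k φ z * harmMonoFun n z = quasi (k + n) (fun r => φ r * (r : ℂ) ^ n.natAbs) z :=
  quasi_mul_quasi _ _ _ _ _

lemma mellinT_natCast (φ : ℝ → ℂ) (N : ℕ) :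
    mellinT φ ((N : ℂ) + 1) = ∫ r in Ioo (0 : ℝ) 1, φ r * (r : ℂ) ^ N := by
  simp [mellinT]

/-- The pairing of `e^{ikθ} φ` with the harmonic monomials. -/
lemma integral_quasi_mul_harmMonoFun (k n : ℤ) (φ : ℝ → ℂ) :
    ∫ z, quasi k φ z * harmMonoFun n z ∂diskMeasure =
      if k + n = 0 then 2 * mellinT φ ((n.natAbs : ℂ) + 2) else 0 := by
  simp_rw [quasi_mul_harmMonoFun]
  rw [integral_quasi]
  split_ifs
  · rw [show (n.natAbs : ℂ) + 2 = ((n.natAbs + 1 : ℕ) : ℂ) + 1 by push_cast; ring, mellinT_natCast]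
    congr 2
    ext r
    ring
  · rfl

/-! ### The projection onto the harmonic Bergman space -/

lemma norm_mul_lt_one {z u : ℂ} (hz : ‖z‖ < 1) (hu : ‖u‖ ≤ 1) : ‖z * u‖ < 1 := by
  rw [norm_mul]
  nlinarith [norm_nonneg z, norm_nonneg u]

lemma norm_bergman_factor_le {z u : ℂ} (hz : ‖z‖ < 1) (hu : ‖u‖ ≤ 1) :
    ‖1 / (1 - z * u) ^ 2‖ ≤ 1 / (1 - ‖z‖) ^ 2 := by
  rw [norm_div, norm_one, norm_pow]
  have h : 1 - ‖z‖ ≤ ‖1 - z * u‖ := by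
    have := norm_sub_norm_le (1 : ℂ) (z * u)
    rw [norm_one, norm_mul] at this
    nlinarith [norm_nonneg z, norm_nonneg u]
  have h0 : 0 < 1 - ‖z‖ := by linarith
  gcongr

lemma summable_succ_mul_pow {x : ℝ} (h0 : 0 ≤ x) (h1 : x < 1) :
    Summable fun n : ℕ => ((n : ℝ) + 1) * x ^ n := by
  have := (hasSum_choose_mul_geometric_of_norm_lt_one 1 (r := x)
    (by rwa [Real.norm_of_nonneg h0])).summable
  refine this.congr fun n => ?_
  simp

lemma hasSum_bergman_factor {x : ℂ} (hx : ‖x‖ < 1) :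
    HasSum (fun n : ℕ => ((n : ℂ) + 1) * x ^ n) (1 / (1 - x) ^ 2) := by
  have := hasSum_choose_mul_geometric_of_norm_lt_one 1 hx
  simpa using this

lemma integrable_bdd_mul_disk {u f : ℂ → ℂ} {c : ℝ} (hum : Measurable u)
    (hu : ∀ w ∈ Metric.ball (0 : ℂ) 1, ‖u w‖ ≤ c) (hf : Integrable f diskMeasure) :
    Integrable (fun w => u w * f w) diskMeasure :=
  hf.bdd_mul hum.aestronglyMeasurable (ae_diskMeasure_mem_ball.mono hu)

lemma norm_pow_le_one_of_le {u : ℂ} (hu : ‖u‖ ≤ 1) (n : ℕ) : ‖u ^ n‖ ≤ 1 := by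
  rw [norm_pow]; exact pow_le_one₀ (norm_nonneg _) hu

lemma norm_integral_pow_mul_le {u f : ℂ → ℂ} (hu : ∀ w ∈ Metric.ball (0 : ℂ) 1, ‖u w‖ ≤ 1)
    (hf : Integrable f diskMeasure) (n : ℕ) :
    ‖∫ w, u w ^ n * f w ∂diskMeasure‖ ≤ ∫ w, ‖f w‖ ∂diskMeasure := by
  refine norm_integral_le_of_norm_le hf.norm ?_
  filter_upwards [ae_diskMeasure_mem_ball] with w hw
  rw [norm_mul]
  exact mul_le_of_le_one_left (norm_nonneg _) (norm_pow_le_one_of_le (hu w hw) n)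

/-- Expand `1/(1-x)^2 = ∑ (n+1) x^n` and integrate termwise, which the convergence of `∑ (n+1)|z|^n
∫|f|` justifies for `f` merely in `L¹`. The function `u` stands for both `w` and its conjugate, the
two halves of the kernel. -/
lemma hasSum_integral_bergman_factor {u f : ℂ → ℂ} (hum : Measurable u)
    (hu : ∀ w ∈ Metric.ball (0 : ℂ) 1, ‖u w‖ ≤ 1) (hf : Integrable f diskMeasure) {z : ℂ}
    (hz : ‖z‖ < 1) :
    HasSum (fun n : ℕ => ((n : ℂ) + 1) * z ^ n * ∫ w, u w ^ n * f w ∂diskMeasure)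
      (∫ w, 1 / (1 - z * u w) ^ 2 * f w ∂diskMeasure) := by
  have hpow : ∀ n : ℕ, Integrable (fun w => u w ^ n * f w) diskMeasure := fun n =>
    integrable_bdd_mul_disk (hum.pow_const n) (fun w hw => norm_pow_le_one_of_le (hu w hw) n) hf
  have hs : Summable fun n : ℕ =>
      ∫ w, ‖((n : ℂ) + 1) * z ^ n * (u w ^ n * f w)‖ ∂diskMeasure := by
    refine Summable.of_nonneg_of_le (fun n => integral_nonneg fun w => norm_nonneg _) (fun n => ?_)
      ((summable_succ_mul_pow (norm_nonneg z) hz).mul_right (∫ w, ‖f w‖ ∂diskMeasure))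
    rw [← integral_const_mul]
    refine integral_mono_ae ((hpow n).const_mul _).norm (hf.norm.const_mul _) ?_
    filter_upwards [ae_diskMeasure_mem_ball] with w hw
    have h1 : ‖(n : ℂ) + 1‖ = (n : ℝ) + 1 := by
      have := Complex.norm_natCast (n + 1)
      push_cast at this
      exact this
    rw [norm_mul, norm_mul, h1, norm_pow, norm_mul]
    exact mul_le_mul_of_nonneg_left
      (mul_le_of_le_one_left (norm_nonneg _) (norm_pow_le_one_of_le (hu w hw) n)) (by positivity)
  have h := hasSum_integral_of_summable_integral_norm (fun n => (hpow n).const_mul _) hs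
  simp_rw [integral_const_mul] at h
  have e : ∫ w, 1 / (1 - z * u w) ^ 2 * f w ∂diskMeasure =
      ∫ w, ∑' n : ℕ, ((n : ℂ) + 1) * z ^ n * (u w ^ n * f w) ∂diskMeasure := by
    refine integral_congr_ae ?_
    filter_upwards [ae_diskMeasure_mem_ball] with w hw
    rw [← (hasSum_bergman_factor (norm_mul_lt_one hz (hu w hw))).tsum_eq, ← tsum_mul_right]
    congr 1
    ext n
    ring
  rwa [e]

/-- The coefficients of a function on the disk against the harmonic monomials. -/
noncomputable def harmCoeff (f : ℂ → ℂ) (k : ℤ) : ℂ := ∫ w, harmMonoFun (-k) w * f w ∂diskMeasure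

lemma norm_conj_le_one_of_mem_ball {w : ℂ} (hw : w ∈ Metric.ball (0 : ℂ) 1) :
    ‖(starRingEnd ℂ) w‖ ≤ 1 := by
  rw [RCLike.norm_conj]
  exact (mem_ball_zero_iff.1 hw).le

lemma harmCoeff_natCast (f : ℂ → ℂ) (n : ℕ) :
    harmCoeff f n = ∫ w, (starRingEnd ℂ) w ^ n * f w ∂diskMeasure := by
  simp_rw [harmCoeff, harmMonoFun_neg_natCast, map_pow]

lemma harmCoeff_neg_natCast (f : ℂ → ℂ) (n : ℕ) :
    harmCoeff f (-(n : ℤ)) = ∫ w, w ^ n * f w ∂diskMeasure := by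
  simp_rw [harmCoeff, neg_neg, harmMonoFun_natCast]

lemma measurable_conj : Measurable (starRingEnd ℂ : ℂ → ℂ) := Complex.continuous_conj.measurable

lemma integrable_bergman_factor_mul {u f : ℂ → ℂ} (hum : Measurable u)
    (hu : ∀ w ∈ Metric.ball (0 : ℂ) 1, ‖u w‖ ≤ 1) (hf : Integrable f diskMeasure) {z : ℂ}
    (hz : ‖z‖ < 1) : Integrable (fun w => 1 / (1 - z * u w) ^ 2 * f w) diskMeasure :=
  integrable_bdd_mul_disk (by fun_prop) (fun w hw => norm_bergman_factor_le hz (hu w hw)) hf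

lemma measurable_harmKernel (z : ℂ) : Measurable (harmKernel z) := by
  have := measurable_conj
  unfold harmKernel
  fun_prop

lemma norm_harmKernel_le {z w : ℂ} (hz : ‖z‖ < 1) (hw : w ∈ Metric.ball (0 : ℂ) 1) :
    ‖harmKernel z w‖ ≤ 2 * (1 / (1 - ‖z‖) ^ 2) + 1 := by
  have h1 := norm_bergman_factor_le hz (norm_conj_le_one_of_mem_ball hw)
  have h2 := norm_bergman_factor_le (z := (starRingEnd ℂ) z) (u := w) (by rwa [RCLike.norm_conj])
    (mem_ball_zero_iff.1 hw).le
  rw [RCLike.norm_conj] at h2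
  refine (norm_sub_le _ _).trans ?_
  rw [norm_one]
  linarith [norm_add_le (1 / (1 - z * (starRingEnd ℂ) w) ^ 2) (1 / (1 - (starRingEnd ℂ) z * w) ^ 2)]

lemma integrable_harmKernel_mul {f : ℂ → ℂ} (hf : Integrable f diskMeasure) {z : ℂ}
    (hz : ‖z‖ < 1) : Integrable (fun w => harmKernel z w * f w) diskMeasure :=
  integrable_bdd_mul_disk (measurable_harmKernel z) (fun _ hw => norm_harmKernel_le hz hw) hf

lemma harmProj_eq_integral_add {f : ℂ → ℂ} (hf : Integrable f diskMeasure) {z : ℂ}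
    (hz : ‖z‖ < 1) :
    harmProj f z = (∫ w, 1 / (1 - z * (starRingEnd ℂ) w) ^ 2 * f w ∂diskMeasure) +
      (∫ w, 1 / (1 - (starRingEnd ℂ) z * w) ^ 2 * f w ∂diskMeasure) - ∫ w, f w ∂diskMeasure := by
  have h1 := integrable_bergman_factor_mul measurable_conj
    (fun w hw => norm_conj_le_one_of_mem_ball hw) hf hz
  have h2 := integrable_bergman_factor_mul measurable_id
    (fun w hw => (mem_ball_zero_iff.1 hw).le) hf (z := (starRingEnd ℂ) z) (by rwa [RCLike.norm_conj])
  simp only [id] at h2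
  rw [← integral_add h1 h2]
  refine Eq.trans ?_ (integral_sub (h1.add h2) hf)
  refine integral_congr_ae (ae_of_all _ fun w => ?_)
  simp only [harmKernel]
  ring

lemma harmCoeff_zero (f : ℂ → ℂ) : harmCoeff f 0 = ∫ w, f w ∂diskMeasure := by
  have := harmCoeff_natCast f 0
  simpa using this

lemma hasSum_bergman_conj {f : ℂ → ℂ} (hf : Integrable f diskMeasure) {z : ℂ} (hz : ‖z‖ < 1) :
    HasSum (fun n : ℕ => ((n : ℂ) + 1) * z ^ n * harmCoeff f n)
      (∫ w, 1 / (1 - z * (starRingEnd ℂ) w) ^ 2 * f w ∂diskMeasure) := by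
  simp_rw [harmCoeff_natCast]
  exact hasSum_integral_bergman_factor measurable_conj
    (fun w hw => norm_conj_le_one_of_mem_ball hw) hf hz

lemma hasSum_bergman_id {f : ℂ → ℂ} (hf : Integrable f diskMeasure) {z : ℂ} (hz : ‖z‖ < 1) :
    HasSum (fun n : ℕ => ((n : ℂ) + 1) * z ^ n * harmCoeff f (-(n : ℤ)))
      (∫ w, 1 / (1 - z * w) ^ 2 * f w ∂diskMeasure) := by
  simp_rw [harmCoeff_neg_natCast]
  exact hasSum_integral_bergman_factor measurable_id
    (fun w hw => (mem_ball_zero_iff.1 hw).le) hf hz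

/-- If only one coefficient of `f` is nonzero, the projection of `f` is a harmonic monomial. -/
lemma harmProj_of_harmCoeff_eq_zero {f : ℂ → ℂ} (hf : Integrable f diskMeasure) (k : ℤ)
    (hk : ∀ j, j ≠ k → harmCoeff f j = 0) {z : ℂ} (hz : ‖z‖ < 1) :
    harmProj f z = ((k.natAbs : ℂ) + 1) * harmCoeff f k * harmMonoFun k z := by
  have hz' : ‖(starRingEnd ℂ) z‖ < 1 := by rwa [RCLike.norm_conj]
  rw [harmProj_eq_integral_add hf hz, ← (hasSum_bergman_conj hf hz).tsum_eq,
    ← (hasSum_bergman_id hf hz').tsum_eq, ← harmCoeff_zero]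
  obtain ⟨N, rfl | rfl⟩ := k.eq_nat_or_neg
  -- For `k = N ≥ 0` the series in powers of the conjugate of `z` keeps only its constant term,
  -- which cancels the subtracted mean. The case `N = 0` needs no separate treatment.
  · rw [tsum_eq_single N (fun n hn => by rw [hk _ (by exact_mod_cast hn), mul_zero]),
      tsum_eq_single 0 (fun n hn => by rw [hk _ (by omega), mul_zero]), harmMonoFun_natCast]
    simp
    ring
  · rw [tsum_eq_single 0 (fun n hn => by rw [hk _ (by omega), mul_zero]),
      tsum_eq_single N (fun n hn => by rw [hk _ (by omega), mul_zero]), harmMonoFun_neg_natCast]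
    simp
    ring

lemma harmProj_quasi {k : ℤ} {g : ℝ → ℂ} (hg : Integrable (quasi k g) diskMeasure) {z : ℂ}
    (hz : ‖z‖ < 1) :
    harmProj (quasi k g) z =
      2 * ((k.natAbs : ℂ) + 1) * mellinT g ((k.natAbs : ℂ) + 2) * harmMonoFun k z := by
  have h : ∀ j, harmCoeff (quasi k g) j =
      if k + -j = 0 then 2 * mellinT g ((j.natAbs : ℂ) + 2) else 0 := fun j => by
    rw [harmCoeff]
    simp_rw [mul_comm (harmMonoFun (-j) _)]
    rw [integral_quasi_mul_harmMonoFun, Int.natAbs_neg]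
  rw [harmProj_of_harmCoeff_eq_zero hg k (fun j hj => ?_) hz, h, if_pos (by ring)]
  · ring
  · rw [h, if_neg (by omega)]

lemma norm_harmCoeff_le {f : ℂ → ℂ} (hf : Integrable f diskMeasure) (k : ℤ) :
    ‖harmCoeff f k‖ ≤ ∫ w, ‖f w‖ ∂diskMeasure := by
  obtain ⟨n, rfl | rfl⟩ := k.eq_nat_or_neg
  · rw [harmCoeff_natCast]
    exact norm_integral_pow_mul_le (fun w hw => norm_conj_le_one_of_mem_ball hw) hf n
  · rw [harmCoeff_neg_natCast]
    exact norm_integral_pow_mul_le (fun w hw => (mem_ball_zero_iff.1 hw).le) hf n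

lemma analyticOnNhd_tsum_bergman {c : ℕ → ℂ} {C : ℝ} (hc : ∀ n, ‖c n‖ ≤ C) :
    AnalyticOnNhd ℂ (fun z => ∑' n : ℕ, ((n : ℂ) + 1) * z ^ n * c n) (Metric.ball 0 1) := by
  intro z hz
  obtain ⟨r, hr1, hr2⟩ := exists_between (mem_ball_zero_iff.1 hz)
  have hr0 : 0 ≤ r := (norm_nonneg z).trans hr1.le
  have hd : DifferentiableOn ℂ (fun z => ∑' n : ℕ, ((n : ℂ) + 1) * z ^ n * c n)
      (Metric.ball 0 r) := by
    refine Complex.differentiableOn_tsum_of_summable_norm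
      ((summable_succ_mul_pow hr0 hr2).mul_right C) (fun n => ?_)
      Metric.isOpen_ball (fun n w hw => ?_)
    · fun_prop
    · have h1 : ‖(n : ℂ) + 1‖ = (n : ℝ) + 1 := by
        have := Complex.norm_natCast (n + 1)
        push_cast at this
        exact this
      rw [norm_mul, norm_mul, h1, norm_pow]
      have := mem_ball_zero_iff.1 hw
      have hC : 0 ≤ C := (norm_nonneg _).trans (hc 0)
      gcongr
      exact hc n
  exact hd.analyticAt (Metric.isOpen_ball.mem_nhds (mem_ball_zero_iff.2 hr1))

lemma harmonicOnNhd_harmProj {f : ℂ → ℂ} (hf : Integrable f diskMeasure) :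
    InnerProductSpace.HarmonicOnNhd (harmProj f) (Metric.ball 0 1) := by
  intro z hz
  set A : ℂ → ℂ := fun z => ∑' n : ℕ, ((n : ℂ) + 1) * z ^ n * harmCoeff f n with hA
  -- The coefficients are conjugated so that `B` is holomorphic; the projection is then `A`, plus
  -- the conjugate of `B`, minus the doubly counted constant.
  set B : ℂ → ℂ := fun z => ∑' n : ℕ, ((n : ℂ) + 1) * z ^ n *
    (starRingEnd ℂ) (harmCoeff f (-(n : ℤ))) with hB
  have hAz : InnerProductSpace.HarmonicAt A z :=
    (analyticOnNhd_tsum_bergman (fun n => norm_harmCoeff_le hf n) z hz).harmonicAt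
  have hBz : InnerProductSpace.HarmonicAt B z :=
    (analyticOnNhd_tsum_bergman (C := ∫ w, ‖f w‖ ∂diskMeasure)
      (fun n => by rw [RCLike.norm_conj]; exact norm_harmCoeff_le hf _) z hz).harmonicAt
  have hc : InnerProductSpace.HarmonicAt (fun _ : ℂ => -harmCoeff f 0) z :=
    (analyticAt_const).harmonicAt
  refine (InnerProductSpace.harmonicAt_congr_nhds ?_).1
    ((hAz.add (hBz.comp_CLM (Complex.conjCLE : ℂ →L[ℝ] ℂ))).add hc)
  filter_upwards [Metric.isOpen_ball.mem_nhds hz] with w hw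
  have hw' := mem_ball_zero_iff.1 hw
  rw [harmProj_eq_integral_add hf hw', ← (hasSum_bergman_conj hf hw').tsum_eq,
    ← (hasSum_bergman_id hf (z := (starRingEnd ℂ) w) (by rwa [RCLike.norm_conj])).tsum_eq,
    ← harmCoeff_zero]
  have : (starRingEnd ℂ) (B w) = ∑' n : ℕ, ((n : ℂ) + 1) * (starRingEnd ℂ) w ^ n *
      harmCoeff f (-(n : ℤ)) := by
    rw [hB, Complex.conj_tsum]
    simp
  simp only [Pi.add_apply, Function.comp_apply]
  rw [← this]
  simp [hA, sub_eq_add_neg]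

/-! ### The harmonic monomials form an orthogonal basis -/

lemma coeFn_harmMono (k : ℤ) :
    ((harmMono k : Lp ℂ 2 diskMeasure) : ℂ → ℂ) =ᵐ[diskMeasure] harmMonoFun k :=
  (memLp_harmMonoFun k).coeFn_toLp

lemma integrable_coeFn (f : Lp ℂ 2 diskMeasure) : Integrable (f : ℂ → ℂ) diskMeasure :=
  (Lp.memLp f).integrable (by norm_num)

lemma inner_harmMono (k : ℤ) (f : Lp ℂ 2 diskMeasure) :
    inner ℂ (harmMono k : Lp ℂ 2 diskMeasure) f = harmCoeff f k := by
  rw [L2.inner_def, harmCoeff]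
  refine integral_congr_ae ?_
  filter_upwards [coeFn_harmMono k] with w hw
  rw [hw, RCLike.inner_apply, conj_harmMonoFun, mul_comm]

lemma harmCoeff_congr {f g : ℂ → ℂ} (h : f =ᵐ[diskMeasure] g) (k : ℤ) :
    harmCoeff f k = harmCoeff g k := by
  refine integral_congr_ae ?_
  filter_upwards [h] with w hw
  rw [hw]

lemma integral_Ioo_pow {ρ : ℝ} (hρ : 0 ≤ ρ) (n : ℕ) :
    ∫ r in Ioo (0 : ℝ) ρ, (r : ℂ) ^ n = (ρ : ℂ) ^ (n + 1) / ((n : ℂ) + 1) := by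
  rw [← integral_Ioc_eq_integral_Ioo, ← intervalIntegral.integral_of_le hρ]
  have := integral_pow (a := 0) (b := ρ) n
  have h2 : ∫ r in (0 : ℝ)..ρ, (r : ℂ) ^ n = ((∫ r in (0 : ℝ)..ρ, r ^ n : ℝ) : ℂ) := by
    rw [← intervalIntegral.integral_ofReal]
    push_cast
    rfl
  rw [h2, this]
  push_cast
  simp

/-- Truncated orthogonality relations. -/
lemma integral_indicator_harmMonoFun_mul {ρ : ℝ} (hρ : 0 ≤ ρ) (hρ1 : ρ ≤ 1) (k n : ℤ) :
    ∫ w, (Metric.ball (0 : ℂ) ρ).indicator (fun w => harmMonoFun (-k) w * harmMonoFun n w) w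
      ∂diskMeasure = if n = k then (ρ : ℂ) ^ (2 * k.natAbs + 2) / ((k.natAbs : ℂ) + 1) else 0 := by
  have h : ∀ w, (Metric.ball (0 : ℂ) ρ).indicator
      (fun w => harmMonoFun (-k) w * harmMonoFun n w) w =
      quasi (-k + n) ((Iio ρ).indicator fun r => (r : ℂ) ^ k.natAbs * (r : ℂ) ^ n.natAbs) w := by
    intro w
    by_cases h : ‖w‖ < ρ
    · rw [indicator_of_mem (by simpa using h), harmMonoFun, harmMonoFun, quasi_mul_quasi, quasi,
        quasi, indicator_of_mem (by simpa using h), Int.natAbs_neg]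
    · rw [indicator_of_notMem (by simpa using h), quasi, indicator_of_notMem (by simpa using h),
        mul_zero]
  simp_rw [h]
  rw [integral_quasi]
  by_cases hkn : n = k
  · subst hkn
    rw [if_pos (by ring), if_pos rfl]
    have h2 : ∀ r : ℝ, (r : ℂ) * (Iio ρ).indicator
        (fun r : ℝ => (r : ℂ) ^ n.natAbs * (r : ℂ) ^ n.natAbs) r =
        (Iio ρ).indicator (fun r : ℝ => (r : ℂ) ^ (2 * n.natAbs + 1)) r := by
      intro r
      by_cases h : r < ρ
      · rw [indicator_of_mem (by simpa using h), indicator_of_mem (by simpa using h)]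
        ring
      · rw [indicator_of_notMem (by simpa using h), indicator_of_notMem (by simpa using h), mul_zero]
    simp_rw [h2]
    rw [setIntegral_indicator measurableSet_Iio, Ioo_inter_Iio, min_eq_right hρ1,
      integral_Ioo_pow hρ]
    have h1 : ((n.natAbs : ℂ) + 1) ≠ 0 := by exact_mod_cast Nat.succ_ne_zero n.natAbs
    have h3 : (((2 * n.natAbs + 1 : ℕ) : ℂ) + 1) = 2 * ((n.natAbs : ℂ) + 1) := by push_cast; ring
    rw [h3]
    field_simp
  · rw [if_neg (by omega), if_neg hkn]

lemma harmCoeff_harmMonoFun (n k : ℤ) :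
    harmCoeff (harmMonoFun n) k = if n = k then 1 / ((k.natAbs : ℂ) + 1) else 0 := by
  have h : ∫ w, (Metric.ball (0 : ℂ) 1).indicator (fun w => harmMonoFun (-k) w * harmMonoFun n w) w
      ∂diskMeasure = ∫ w, harmMonoFun (-k) w * harmMonoFun n w ∂diskMeasure := by
    refine integral_congr_ae ?_
    filter_upwards [ae_diskMeasure_mem_ball] with w hw
    rw [indicator_of_mem hw]
  rw [harmCoeff, ← h, integral_indicator_harmMonoFun_mul zero_le_one le_rfl k n]
  simp

lemma inner_harmMono_harmMono (k n : ℤ) :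
    inner ℂ (harmMono k) (harmMono n) = if n = k then 1 / ((k.natAbs : ℂ) + 1) else 0 := by
  rw [Submodule.coe_inner, inner_harmMono, harmCoeff_congr (coeFn_harmMono n),
    harmCoeff_harmMonoFun]

/-- A harmonic function on the disk is the sum of a series of harmonic monomials. -/
lemma exists_hasSum_harmMonoFun {h : ℂ → ℂ}
    (hh : InnerProductSpace.HarmonicOnNhd h (Metric.ball (0 : ℂ) 1)) :
    ∃ c : ℤ → ℂ, ∀ z ∈ Metric.ball (0 : ℂ) 1, HasSum (fun n => c n * harmMonoFun n z) (h z) := by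
  obtain ⟨F, hF, hFe⟩ :=
    (hh.comp_CLM Complex.reCLM).exists_analyticOnNhd_ball_re_eq
  obtain ⟨G, hG, hGe⟩ :=
    (hh.comp_CLM Complex.imCLM).exists_analyticOnNhd_ball_re_eq
  -- Since `h = Re F + i Re G`, the holomorphic part of `h` is `(F+iG)/2` and the antiholomorphic
  -- part is the conjugate of `(F-iG)/2`. The constant `b 0` is moved into `a` so that the term of
  -- index `0` is counted once.
  set b : ℂ → ℂ := fun z => (1 / 2 : ℝ) • (F z - Complex.I * G z)
  set a : ℂ → ℂ := fun z => (1 / 2 : ℝ) • (F z + Complex.I * G z) + (starRingEnd ℂ) (b 0)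
  have ha : DifferentiableOn ℂ a (Metric.ball 0 1) :=
    ((hF.differentiableOn.add (hG.differentiableOn.const_mul Complex.I)).const_smul
      (1 / 2 : ℝ)).add_const ((starRingEnd ℂ) (b 0))
  have hb : DifferentiableOn ℂ (fun z => b z - b 0) (Metric.ball 0 1) :=
    ((hF.differentiableOn.sub (hG.differentiableOn.const_mul Complex.I)).const_smul
      (1 / 2 : ℝ)).sub_const (b 0)
  have hsum : ∀ z ∈ Metric.ball (0 : ℂ) 1, h z = a z + (starRingEnd ℂ) (b z - b 0) := by
    intro z hz
    have h1 : (F z).re = (h z).re := hFe hz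
    have h2 : (G z).re = (h z).im := hGe hz
    apply Complex.ext
    · simp [a, b, ← h1]
      ring
    · simp [a, b, ← h2]
      ring
  set α : ℕ → ℂ := fun n => (n.factorial : ℂ)⁻¹ * iteratedDeriv n a 0
  set β : ℕ → ℂ := fun n => (starRingEnd ℂ) ((n.factorial : ℂ)⁻¹ *
    iteratedDeriv n (fun z => b z - b 0) 0)
  refine ⟨fun n => if 0 ≤ n then α n.natAbs else β n.natAbs, fun z hz => ?_⟩
  rw [hsum z hz]
  apply HasSum.of_nat_of_neg_add_one
  · have := Complex.hasSum_taylorSeries_on_ball ha hz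
    refine this.congr_fun fun n => ?_
    simp [harmMonoFun_natCast, α]
    ring
  · have := (Complex.hasSum_taylorSeries_on_ball hb hz).star
    rw [← hasSum_nat_add_iff' 1] at this
    simp only [Finset.range_one, Finset.sum_singleton] at this
    simp at this
    simp only [map_sub]
    refine this.congr_fun fun n => ?_
    have : ¬ (0 ≤ -((n : ℤ) + 1)) := by omega
    rw [if_neg this]
    have e : (-((n : ℤ) + 1)) = -((n + 1 : ℕ) : ℤ) := by push_cast; ring
    rw [e, harmMonoFun_neg_natCast]
    have e2 : (-((n + 1 : ℕ) : ℤ)).natAbs = n + 1 := by omega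
    rw [e2]
    simp [β]
    ring

/-- A harmonic function orthogonal to all harmonic monomials vanishes. -/
lemma eq_zero_of_harmCoeff_eq_zero {h : ℂ → ℂ} (hi : Integrable h diskMeasure)
    (hh : InnerProductSpace.HarmonicOnNhd h (Metric.ball (0 : ℂ) 1))
    (h0 : ∀ k, harmCoeff h k = 0) : ∀ z ∈ Metric.ball (0 : ℂ) 1, h z = 0 := by
  obtain ⟨c, hc⟩ := exists_hasSum_harmMonoFun hh
  suffices hc0 : ∀ k, c k = 0 by
    intro z hz
    have := hc z hz
    simp only [hc0, zero_mul] at this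
    exact this.unique hasSum_zero
  intro k
  -- The expansion need not converge uniformly, nor in `L¹`, on the whole disk. So it is integrated
  -- termwise on the ball of radius `ρ < 1`, where orthogonality isolates `c k`, and then `ρ → 1`.
  have hJ : ∀ ρ : ℝ, 0 ≤ ρ → ρ < 1 →
      ∫ w, (Metric.ball (0 : ℂ) ρ).indicator (fun w => harmMonoFun (-k) w * h w) w ∂diskMeasure =
        c k * ((ρ : ℂ) ^ (2 * k.natAbs + 2) / ((k.natAbs : ℂ) + 1)) := by
    intro ρ h0 h1
    have hint : ∀ n, Integrable (fun w => c n * (Metric.ball (0 : ℂ) ρ).indicator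
        (fun w => harmMonoFun (-k) w * harmMonoFun n w) w) diskMeasure := by
      intro n
      refine Integrable.const_mul (Integrable.indicator ?_ Metric.isOpen_ball.measurableSet) _
      exact integrable_bdd_mul_disk (c := 1) (continuous_harmMonoFun _).measurable
        (fun w hw => by
          rw [norm_harmMonoFun]
          exact pow_le_one₀ (norm_nonneg _) (mem_ball_zero_iff.1 hw).le)
        ((memLp_harmMonoFun n).integrable (by norm_num))
    have hs : Summable fun n : ℤ => ‖c n‖ * ρ ^ n.natAbs := by
      have := (hc (ρ : ℂ) (by simpa [abs_of_nonneg h0] using h1)).summable.norm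
      refine this.congr fun n => ?_
      rw [norm_mul, norm_harmMonoFun, Complex.norm_real, Real.norm_of_nonneg h0]
    have hbd : ∀ n w, ‖c n * (Metric.ball (0 : ℂ) ρ).indicator
        (fun w => harmMonoFun (-k) w * harmMonoFun n w) w‖ ≤ ‖c n‖ * ρ ^ n.natAbs := by
      intro n w
      rw [norm_mul]
      refine mul_le_mul_of_nonneg_left ?_ (norm_nonneg _)
      by_cases hw : w ∈ Metric.ball (0 : ℂ) ρ
      · rw [indicator_of_mem hw, norm_mul, norm_harmMonoFun, norm_harmMonoFun]
        have hw' := mem_ball_zero_iff.1 hw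
        have h3 : ‖w‖ ^ n.natAbs ≤ ρ ^ n.natAbs := by gcongr
        have h4 : ‖w‖ ^ (-k).natAbs ≤ 1 := pow_le_one₀ (norm_nonneg _) (by linarith)
        exact (mul_le_of_le_one_left (by positivity) h4).trans h3
      · rw [indicator_of_notMem hw, norm_zero]
        positivity
    have hss : Summable fun n => ∫ w, ‖c n * (Metric.ball (0 : ℂ) ρ).indicator
        (fun w => harmMonoFun (-k) w * harmMonoFun n w) w‖ ∂diskMeasure := by
      refine Summable.of_nonneg_of_le (fun n => integral_nonneg fun w => norm_nonneg _)
        (fun n => ?_) (hs.mul_left (diskMeasure.real univ))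
      refine (integral_mono (hint n).norm (integrable_const _) (hbd n)).trans ?_
      rw [integral_const, smul_eq_mul]
    have hS := hasSum_integral_of_summable_integral_norm hint hss
    simp_rw [integral_const_mul, integral_indicator_harmMonoFun_mul h0 h1.le] at hS
    have hS' := hS.tsum_eq
    rw [tsum_eq_single k (fun n hn => by rw [if_neg hn, mul_zero]), if_pos rfl] at hS'
    rw [hS']
    refine integral_congr_ae (ae_of_all _ fun w => ?_)
    by_cases hw : w ∈ Metric.ball (0 : ℂ) ρ
    · have hw1 : w ∈ Metric.ball (0 : ℂ) 1 := Metric.ball_subset_ball h1.le hw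
      simp only [indicator_of_mem hw]
      rw [← (hc w hw1).tsum_eq, ← tsum_mul_left]
      congr 1
      ext n
      ring
    · simp [indicator_of_notMem hw]
  have hL : Tendsto (fun ρ : ℝ => ∫ w, (Metric.ball (0 : ℂ) ρ).indicator
      (fun w => harmMonoFun (-k) w * h w) w ∂diskMeasure) (𝓝[<] 1) (𝓝 (harmCoeff h k)) := by
    have hik : Integrable (fun w => harmMonoFun (-k) w * h w) diskMeasure :=
      integrable_bdd_mul_disk (c := 1) (continuous_harmMonoFun _).measurable
        (fun w hw => by
          rw [norm_harmMonoFun]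
          exact pow_le_one₀ (norm_nonneg _) (mem_ball_zero_iff.1 hw).le) hi
    refine tendsto_integral_filter_of_dominated_convergence _ ?_ ?_ hik.norm ?_
    · exact Eventually.of_forall fun ρ =>
        (hik.indicator Metric.isOpen_ball.measurableSet).aestronglyMeasurable
    · exact Eventually.of_forall fun ρ => ae_of_all _ fun w => norm_indicator_le_norm_self _ _
    · filter_upwards [ae_diskMeasure_mem_ball] with w hw
      refine tendsto_const_nhds.congr' ?_
      filter_upwards [Ioo_mem_nhdsLT (mem_ball_zero_iff.1 hw)] with ρ hρ
      rw [indicator_of_mem (mem_ball_zero_iff.2 hρ.1)]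
  have hR : Tendsto (fun ρ : ℝ => c k * ((ρ : ℂ) ^ (2 * k.natAbs + 2) / ((k.natAbs : ℂ) + 1)))
      (𝓝[<] 1) (𝓝 (c k * (((1 : ℝ) : ℂ) ^ (2 * k.natAbs + 2) / ((k.natAbs : ℂ) + 1)))) := by
    refine Tendsto.mono_left (Continuous.tendsto ?_ _) nhdsWithin_le_nhds
    fun_prop
  have hE : (fun ρ : ℝ => ∫ w, (Metric.ball (0 : ℂ) ρ).indicator
      (fun w => harmMonoFun (-k) w * h w) w ∂diskMeasure) =ᶠ[𝓝[<] 1]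
      fun ρ : ℝ => c k * ((ρ : ℂ) ^ (2 * k.natAbs + 2) / ((k.natAbs : ℂ) + 1)) := by
    filter_upwards [Ioo_mem_nhdsLT zero_lt_one] with ρ hρ using hJ ρ hρ.1.le hρ.2
  have h1 : ((k.natAbs : ℂ) + 1) ≠ 0 := by exact_mod_cast Nat.succ_ne_zero k.natAbs
  have := tendsto_nhds_unique (hL.congr' hE) hR
  rw [h0] at this
  have h2 := this.symm
  rw [Complex.ofReal_one, one_pow] at h2
  exact (mul_eq_zero.1 h2).resolve_right (one_div_ne_zero h1)

/-! ### The harmonic Bergman space is closed -/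

lemma harmProj_congr {f g : ℂ → ℂ} (h : f =ᵐ[diskMeasure] g) : harmProj f = harmProj g := by
  ext z
  refine integral_congr_ae ?_
  filter_upwards [h] with w hw
  rw [hw]

lemma harmProj_add {f g : ℂ → ℂ} (hf : Integrable f diskMeasure) (hg : Integrable g diskMeasure)
    {z : ℂ} (hz : ‖z‖ < 1) :
    harmProj (fun w => f w + g w) z = harmProj f z + harmProj g z := by
  simp only [harmProj]
  rw [← integral_add (integrable_harmKernel_mul hf hz) (integrable_harmKernel_mul hg hz)]
  simp_rw [mul_add]

lemma harmProj_const_mul (c : ℂ) (f : ℂ → ℂ) (z : ℂ) :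
    harmProj (fun w => c * f w) z = c * harmProj f z := by
  simp only [harmProj]
  rw [← integral_const_mul]
  congr 1
  ext w
  ring

lemma quasi_pow_eq_harmMonoFun (k : ℤ) : quasi k (fun r => (r : ℂ) ^ k.natAbs) = harmMonoFun k := rfl

lemma mellinT_pow (n : ℕ) :
    mellinT (fun r => (r : ℂ) ^ n) ((n : ℂ) + 2) = 1 / (2 * ((n : ℂ) + 1)) := by
  rw [show (n : ℂ) + 2 = ((n + 1 : ℕ) : ℂ) + 1 by push_cast; ring, mellinT_natCast]
  simp_rw [← pow_add]
  rw [integral_Ioo_pow zero_le_one]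
  have : (((n + (n + 1) : ℕ) : ℂ) + 1) = 2 * ((n : ℂ) + 1) := by push_cast; ring
  rw [this]
  simp

lemma harmProj_harmMonoFun (k : ℤ) {z : ℂ} (hz : ‖z‖ < 1) :
    harmProj (harmMonoFun k) z = harmMonoFun k z := by
  have h := harmProj_quasi (k := k) (g := fun r => (r : ℂ) ^ k.natAbs)
    (by rw [quasi_pow_eq_harmMonoFun]; exact (memLp_harmMonoFun k).integrable (by norm_num)) hz
  rw [quasi_pow_eq_harmMonoFun, mellinT_pow] at h
  have h1 : ((k.natAbs : ℂ) + 1) ≠ 0 := by exact_mod_cast Nat.succ_ne_zero k.natAbs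
  rw [h]
  field_simp

/-- The functions in `L²` that are fixed by the projection. -/
noncomputable def projFixed : Submodule ℂ (Lp ℂ 2 diskMeasure) where
  carrier := {f | (f : ℂ → ℂ) =ᵐ[diskMeasure] harmProj f}
  zero_mem' := by
    change ((0 : Lp ℂ 2 diskMeasure) : ℂ → ℂ) =ᵐ[diskMeasure] _
    rw [harmProj_congr (Lp.coeFn_zero ℂ 2 diskMeasure)]
    filter_upwards [Lp.coeFn_zero ℂ 2 diskMeasure] with w hw
    rw [hw]
    simp [harmProj]
  add_mem' := by
    intro f g hf hg
    change ((f + g : Lp ℂ 2 diskMeasure) : ℂ → ℂ) =ᵐ[diskMeasure] _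
    rw [harmProj_congr (Lp.coeFn_add f g)]
    filter_upwards [Lp.coeFn_add f g, ae_diskMeasure_mem_ball, hf, hg] with w hw hb h1 h2
    rw [hw, Pi.add_apply, h1, h2]
    exact (harmProj_add (integrable_coeFn f) (integrable_coeFn g) (mem_ball_zero_iff.1 hb)).symm
  smul_mem' := by
    intro c f hf
    change ((c • f : Lp ℂ 2 diskMeasure) : ℂ → ℂ) =ᵐ[diskMeasure] _
    rw [harmProj_congr (Lp.coeFn_smul c f)]
    filter_upwards [Lp.coeFn_smul c f, hf] with w hw h1
    rw [hw, Pi.smul_apply, h1]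
    exact (harmProj_const_mul c f w).symm

lemma mem_projFixed {f : Lp ℂ 2 diskMeasure} :
    f ∈ projFixed ↔ (f : ℂ → ℂ) =ᵐ[diskMeasure] harmProj f := Iff.rfl

/-- For fixed `z` in the disk the kernel is bounded in `w`, hence in `L²`, and the value at `z` is
an inner product with it. -/
lemma continuous_harmProj_apply {z : ℂ} (hz : ‖z‖ < 1) :
    Continuous fun f : Lp ℂ 2 diskMeasure => harmProj f z := by
  have hm : MemLp (fun w => (starRingEnd ℂ) (harmKernel z w)) 2 diskMeasure := by
    refine MemLp.of_bound (measurable_conj.comp (measurable_harmKernel z)).aestronglyMeasurable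
      (2 * (1 / (1 - ‖z‖) ^ 2) + 1) ?_
    filter_upwards [ae_diskMeasure_mem_ball] with w hw
    rw [RCLike.norm_conj]
    exact norm_harmKernel_le hz hw
  have : (fun f : Lp ℂ 2 diskMeasure => harmProj f z) = fun f => inner ℂ (hm.toLp _) f := by
    ext f
    rw [L2.inner_def]
    refine integral_congr_ae ?_
    filter_upwards [hm.coeFn_toLp] with w hw
    rw [hw, RCLike.inner_apply, Complex.conj_conj, mul_comm]
  rw [this]
  fun_prop

/-- An `L²` limit is an a.e. limit along a subsequence, and along it the projections converge at
every point of the disk. -/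
lemma isClosed_projFixed : IsClosed (projFixed : Set (Lp ℂ 2 diskMeasure)) := by
  rw [← isSeqClosed_iff_isClosed]
  intro f g hf hfg
  obtain ⟨ns, hns, hae⟩ := (tendstoInMeasure_of_tendsto_Lp hfg).exists_seq_tendsto_ae
  have hall : ∀ᵐ w ∂diskMeasure, ∀ n, (f n : ℂ → ℂ) w = harmProj (f n) w :=
    ae_all_iff.2 fun n => hf n
  change (g : ℂ → ℂ) =ᵐ[diskMeasure] _
  filter_upwards [hae, hall, ae_diskMeasure_mem_ball] with w h1 h2 h3
  have h4 := ((continuous_harmProj_apply (mem_ball_zero_iff.1 h3)).tendsto g).comp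
    (hfg.comp hns.tendsto_atTop)
  refine tendsto_nhds_unique h1 (h4.congr fun n => ?_)
  exact (h2 _).symm

/-- The span of the harmonic monomials in `L²`. -/
noncomputable def monoSpan : Submodule ℂ (Lp ℂ 2 diskMeasure) :=
  Submodule.span ℂ (range fun k => (harmMono k : Lp ℂ 2 diskMeasure))

lemma monoSpan_le_projFixed : monoSpan.topologicalClosure ≤ projFixed := by
  refine Submodule.topologicalClosure_minimal _ (Submodule.span_le.2 ?_) isClosed_projFixed
  rintro _ ⟨k, rfl⟩
  rw [SetLike.mem_coe, mem_projFixed, harmProj_congr (coeFn_harmMono k)]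
  filter_upwards [coeFn_harmMono k, ae_diskMeasure_mem_ball] with w h1 h2
  rw [h1, harmProj_harmMonoFun k (mem_ball_zero_iff.1 h2)]

lemma projFixed_le_harmonicBergman : projFixed ≤ HarmonicBergman := fun f hf =>
  ⟨harmProj f, harmonicOnNhd_harmProj (integrable_coeFn f), hf⟩

lemma eq_zero_of_mem_harmonicBergman {f : Lp ℂ 2 diskMeasure} (hf : f ∈ HarmonicBergman)
    (h0 : ∀ k, inner ℂ (harmMono k : Lp ℂ 2 diskMeasure) f = 0) : f = 0 := by
  obtain ⟨h, hh, hfh⟩ := hf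
  have := eq_zero_of_harmCoeff_eq_zero ((integrable_coeFn f).congr hfh) hh
    (fun k => by rw [← harmCoeff_congr hfh, ← inner_harmMono, h0])
  refine (Lp.eq_zero_iff_ae_eq_zero).2 ?_
  filter_upwards [hfh, ae_diskMeasure_mem_ball] with w h1 h2
  rw [h1, this w h2, Pi.zero_apply]

/-- Split `f` along the closed span of the monomials. The component in the span is fixed by the
projection, hence harmonic, so the orthogonal component is harmonic too; being orthogonal to every
monomial, it vanishes. -/
lemma harmonicBergman_le_closure : HarmonicBergman ≤ monoSpan.topologicalClosure := by
  intro f hf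
  set V := monoSpan.topologicalClosure
  have : CompleteSpace V := monoSpan.isClosed_topologicalClosure.completeSpace_coe
  obtain ⟨v, hv, w, hw, rfl⟩ := V.exists_add_mem_mem_orthogonal f
  have hvB : v ∈ HarmonicBergman := projFixed_le_harmonicBergman (monoSpan_le_projFixed hv)
  have hwB : w ∈ HarmonicBergman := by
    have := HarmonicBergman.sub_mem hf hvB
    rwa [add_sub_cancel_left] at this
  have : w = 0 := eq_zero_of_mem_harmonicBergman hwB fun k =>
    (Submodule.mem_orthogonal _ _).1 hw _
      (monoSpan.le_topologicalClosure (Submodule.subset_span ⟨k, rfl⟩))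
  rw [this, add_zero]
  exact hv

lemma isClosed_harmonicBergman : IsClosed (HarmonicBergman : Set (Lp ℂ 2 diskMeasure)) := by
  rw [le_antisymm harmonicBergman_le_closure
    (monoSpan_le_projFixed.trans projFixed_le_harmonicBergman)]
  exact monoSpan.isClosed_topologicalClosure

instance : CompleteSpace HarmonicBergman := isClosed_harmonicBergman.completeSpace_coe

/-- The normalized harmonic monomials. -/
noncomputable def normMono (k : ℤ) : HarmonicBergman :=
  ((Real.sqrt ((k.natAbs : ℝ) + 1) : ℝ) : ℂ) • harmMono k

lemma sqrt_natAbs_ne_zero (k : ℤ) : ((Real.sqrt ((k.natAbs : ℝ) + 1) : ℝ) : ℂ) ≠ 0 := by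
  have : 0 < Real.sqrt ((k.natAbs : ℝ) + 1) := Real.sqrt_pos.2 (by positivity)
  exact_mod_cast this.ne'

lemma orthonormal_normMono : Orthonormal ℂ normMono := by
  rw [orthonormal_iff_ite]
  intro i j
  rw [normMono, normMono, inner_smul_left (E := HarmonicBergman),
    inner_smul_right (E := HarmonicBergman), inner_harmMono_harmMono]
  by_cases h : i = j
  · subst h
    have h1 : ((Real.sqrt ((i.natAbs : ℝ) + 1) : ℝ) : ℂ) * ((Real.sqrt ((i.natAbs : ℝ) + 1) : ℝ) : ℂ)
        = (i.natAbs : ℂ) + 1 := by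
      rw [← Complex.ofReal_mul, Real.mul_self_sqrt (by positivity)]
      push_cast
      rfl
    have h2 : ((i.natAbs : ℂ) + 1) ≠ 0 := by exact_mod_cast Nat.succ_ne_zero i.natAbs
    rw [if_pos rfl, if_pos rfl, Complex.conj_ofReal, ← mul_assoc, h1]
    field_simp
  · rw [if_neg h, if_neg (fun h' => h h'.symm)]
    simp

lemma eq_zero_of_inner_harmMono {f : HarmonicBergman} (h : ∀ k, inner ℂ (harmMono k) f = 0) :
    f = 0 :=
  Subtype.ext (eq_zero_of_mem_harmonicBergman f.2 h)

/-- The Hilbert basis of normalized harmonic monomials. -/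
noncomputable def monoBasis : HilbertBasis ℤ ℂ HarmonicBergman :=
  HilbertBasis.mkOfOrthogonalEqBot orthonormal_normMono (by
    rw [Submodule.eq_bot_iff]
    intro f hf
    refine eq_zero_of_inner_harmMono fun k => ?_
    have := (Submodule.mem_orthogonal _ _).1 hf (normMono k) (Submodule.subset_span ⟨k, rfl⟩)
    rw [normMono, inner_smul_left (E := HarmonicBergman), Complex.conj_ofReal] at this
    exact (mul_eq_zero.1 this).resolve_left (sqrt_natAbs_ne_zero k))

lemma monoBasis_apply (k : ℤ) : monoBasis k = normMono k := by
  simp [monoBasis]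

/-! ### Weighted shifts -/

/-- Bounded weighted shifts on `ℓ²(ℤ)`. -/
lemma exists_weighted_shift_lp (v : ℤ → ℂ) (k : ℤ) {C : ℝ} (hC : ∀ n, ‖v n‖ ≤ C) :
    ∃ T : lp (fun _ : ℤ => ℂ) 2 →L[ℂ] lp (fun _ : ℤ => ℂ) 2,
      ∀ f j, T f j = v (j - k) * f (j - k) := by
  have hC0 : 0 ≤ C := (norm_nonneg _).trans (hC 0)
  have h2 : (2 : ENNReal).toReal = 2 := by norm_num
  have hsum : ∀ f : lp (fun _ : ℤ => ℂ) 2, Summable fun j => ‖f j‖ ^ (2 : ℝ) := fun f => by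
    have := lp.memℓp f
    rw [memℓp_gen_iff (by norm_num), h2] at this
    exact this
  have hsum' : ∀ f : lp (fun _ : ℤ => ℂ) 2, Summable fun j => ‖f (j - k)‖ ^ (2 : ℝ) := fun f =>
    (Equiv.subRight k).summable_iff.2 (hsum f)
  have hle : ∀ (f : lp (fun _ : ℤ => ℂ) 2) j,
      ‖v (j - k) * f (j - k)‖ ^ (2 : ℝ) ≤ C ^ (2 : ℝ) * ‖f (j - k)‖ ^ (2 : ℝ) := fun f j => by
    rw [norm_mul, Real.mul_rpow (norm_nonneg _) (norm_nonneg _)]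
    gcongr
    exact hC _
  have hmem : ∀ f : lp (fun _ : ℤ => ℂ) 2,
      Memℓp (E := fun _ : ℤ => ℂ) (fun j => v (j - k) * f (j - k)) 2 := fun f => by
    rw [memℓp_gen_iff (by norm_num), h2]
    exact Summable.of_nonneg_of_le (fun j => by positivity) (hle f) ((hsum' f).mul_left _)
  let L : lp (fun _ : ℤ => ℂ) 2 →ₗ[ℂ] lp (fun _ : ℤ => ℂ) 2 :=
    { toFun := fun f => ⟨fun j => v (j - k) * f (j - k), hmem f⟩
      map_add' := fun f g => by
        ext j
        exact mul_add _ _ _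
      map_smul' := fun c f => by
        ext j
        simp
        ring }
  refine ⟨L.mkContinuous C fun f => ?_, fun f j => rfl⟩
  refine lp.norm_le_of_tsum_le (by norm_num) (by positivity) ?_
  rw [h2, Real.mul_rpow hC0 (norm_nonneg _)]
  have hn := lp.norm_rpow_eq_tsum (p := 2) (by norm_num) f
  rw [h2] at hn
  rw [hn, ← tsum_mul_left, ← (Equiv.subRight k).tsum_eq (fun j => C ^ (2 : ℝ) * ‖f j‖ ^ (2 : ℝ))]
  refine Summable.tsum_le_tsum (hle f) ?_ ?_
  · exact Summable.of_nonneg_of_le (fun j => by positivity) (hle f) ((hsum' f).mul_left _)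
  · exact (hsum' f).mul_left _

lemma harmMono_eq_smul_normMono (k : ℤ) :
    harmMono k = ((Real.sqrt ((k.natAbs : ℝ) + 1) : ℝ) : ℂ)⁻¹ • normMono k := by
  rw [normMono, smul_smul, inv_mul_cancel₀ (sqrt_natAbs_ne_zero k), one_smul]

/-- Weighted shifts on the harmonic Bergman space. -/
lemma exists_weighted_shift (w : ℤ → ℂ) (k : ℤ) {C : ℝ}
    (hC : ∀ n, ‖w n‖ * Real.sqrt ((n.natAbs : ℝ) + 1) ≤ C * Real.sqrt (((n + k).natAbs : ℝ) + 1)) :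
    ∃ T : HarmonicBergman →L[ℂ] HarmonicBergman, ∀ n, T (harmMono n) = w n • harmMono (n + k) := by
  -- The weights of the same shift relative to the orthonormal basis: the `n`-th monomial has norm
  -- `(|n|+1)^{-1/2}`.
  obtain ⟨T, hT⟩ := exists_weighted_shift_lp
    (fun n => w n * (Real.sqrt ((n.natAbs : ℝ) + 1) : ℝ) /
      (Real.sqrt (((n + k).natAbs : ℝ) + 1) : ℝ)) k (C := C) (fun n => by
        rw [norm_div, norm_mul, Complex.norm_real, Complex.norm_real, Real.norm_of_nonneg
          (Real.sqrt_nonneg _), Real.norm_of_nonneg (Real.sqrt_nonneg _),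
          div_le_iff₀ (Real.sqrt_pos.2 (by positivity))]
        exact hC n)
  refine ⟨(monoBasis.repr.symm.toContinuousLinearEquiv.toContinuousLinearMap.comp T).comp
    monoBasis.repr.toContinuousLinearEquiv.toContinuousLinearMap, fun n => ?_⟩
  have h1 : T (monoBasis.repr (normMono n)) =
      (w n * (Real.sqrt ((n.natAbs : ℝ) + 1) : ℝ) / (Real.sqrt (((n + k).natAbs : ℝ) + 1) : ℝ)) •
        monoBasis.repr (normMono (n + k)) := by
    rw [← monoBasis_apply, ← monoBasis_apply, HilbertBasis.repr_self, HilbertBasis.repr_self]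
    ext j
    rw [hT]
    simp only [lp.coeFn_smul, Pi.smul_apply, smul_eq_mul, lp.single_apply, Pi.single_apply]
    by_cases h : j = n + k
    · subst h
      simp
    · rw [if_neg h, if_neg (by omega)]
      simp
  have h2 : ((Real.sqrt ((n.natAbs : ℝ) + 1) : ℝ) : ℂ) ≠ 0 := sqrt_natAbs_ne_zero n
  simp only [ContinuousLinearMap.comp_apply]
  change monoBasis.repr.symm (T (monoBasis.repr (harmMono n))) = _
  rw [harmMono_eq_smul_normMono n, harmMono_eq_smul_normMono (n + k), map_smul, map_smul, h1,
    map_smul, map_smul, LinearIsometryEquiv.symm_apply_apply, smul_smul, smul_smul]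
  congr 1
  field_simp

lemma dense_span_harmMono : Dense (Submodule.span ℂ (range harmMono) : Set HarmonicBergman) := by
  have h := monoBasis.dense_span
  rw [← Submodule.dense_iff_topologicalClosure_eq_top] at h
  refine h.mono (Submodule.span_le.2 ?_)
  rintro _ ⟨k, rfl⟩
  rw [monoBasis_apply, normMono]
  exact Submodule.smul_mem _ _ (Submodule.subset_span ⟨k, rfl⟩)

lemma clm_ext_harmMono {S T : HarmonicBergman →L[ℂ] HarmonicBergman}
    (h : ∀ n, S (harmMono n) = T (harmMono n)) : S = T := by
  refine ContinuousLinearMap.ext_on dense_span_harmMono ?_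
  rintro _ ⟨n, rfl⟩
  exact h n

lemma linearIndependent_harmMono : LinearIndependent ℂ harmMono := by
  have h := orthonormal_normMono.linearIndependent
  have := h.units_smul (fun k => (Units.mk0 _ (sqrt_natAbs_ne_zero k))⁻¹)
  have e : ((fun k => (Units.mk0 _ (sqrt_natAbs_ne_zero k))⁻¹) • normMono) = harmMono := by
    ext1 k
    rw [Pi.smul_apply', harmMono_eq_smul_normMono]
    rfl
  rwa [e] at this

lemma harmMono_ne_zero (k : ℤ) : harmMono k ≠ 0 := linearIndependent_harmMono.ne_zero k

/-! ### Ranges of weighted shifts -/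

lemma tensor_harmMono_apply (j k n : ℤ) :
    tensor (harmMono j) (harmMono k) (harmMono n) =
      (if n = k then 1 / ((k.natAbs : ℂ) + 1) else 0) • harmMono j := by
  rw [tensor, ContinuousLinearMap.smulRight_apply, innerSL_apply_apply, inner_harmMono_harmMono]

section

variable {S : HarmonicBergman →L[ℂ] HarmonicBergman} {w : ℤ → ℂ} {K : ℤ}

/-- The factor `|k-K|+1` is the inverse square norm of the monomial on which the tensor is tested.
The set `Λ` may exceed the support of the weights. -/
lemma eq_sum_tensor (hS : ∀ n, S (harmMono n) = w n • harmMono (n + K)) (Λ : Finset ℤ)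
    (hw : ∀ n, n + K ∉ Λ → w n = 0) :
    S = ∑ k ∈ Λ, (w (k - K) * (((k - K).natAbs : ℂ) + 1)) •
      tensor (harmMono k) (harmMono (k - K)) := by
  refine clm_ext_harmMono fun n => ?_
  rw [hS, sum_apply]
  simp only [smul_apply, tensor_harmMono_apply]
  by_cases hn : n + K ∈ Λ
  · rw [Finset.sum_eq_single_of_mem _ hn fun k _ hk => by
      rw [if_neg (by omega), zero_smul, smul_zero]]
    have h1 : (n.natAbs : ℂ) + 1 ≠ 0 := by exact_mod_cast Nat.succ_ne_zero n.natAbs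
    rw [add_sub_cancel_right, if_pos rfl, smul_smul]
    congr 1
    field_simp
  · rw [hw n hn, zero_smul, Finset.sum_eq_zero]
    intro k hk
    rw [if_neg, zero_smul, smul_zero]
    rintro rfl
    exact hn (by simpa using hk)

lemma range_eq_span (hS : ∀ n, S (harmMono n) = w n • harmMono (n + K)) (Λ : Finset ℤ)
    (hw : ∀ n, w n ≠ 0 ↔ n + K ∈ Λ) :
    LinearMap.range S.toLinearMap = Submodule.span ℂ (harmMono '' {k | k ∈ Λ}) := by
  apply le_antisymm
  · rintro _ ⟨f, rfl⟩
    rw [ContinuousLinearMap.coe_coe,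
      eq_sum_tensor hS Λ (fun n hn => by_contra fun h => hn ((hw n).1 h)),
      sum_apply]
    refine Submodule.sum_mem _ fun k hk => ?_
    rw [smul_apply, tensor, ContinuousLinearMap.smulRight_apply]
    exact Submodule.smul_mem _ _ (Submodule.smul_mem _ _ (Submodule.subset_span ⟨k, hk, rfl⟩))
  · rw [Submodule.span_le]
    rintro _ ⟨k, hk, rfl⟩
    have hk' : w (k - K) ≠ 0 := (hw _).2 (by simpa using hk)
    refine ⟨(w (k - K))⁻¹ • harmMono (k - K), ?_⟩
    rw [ContinuousLinearMap.coe_coe, map_smul, hS, smul_smul, inv_mul_cancel₀ hk', one_smul,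
      sub_add_cancel]

lemma opRank_eq_card (hS : ∀ n, S (harmMono n) = w n • harmMono (n + K)) (Λ : Finset ℤ)
    (hw : ∀ n, w n ≠ 0 ↔ n + K ∈ Λ) : opRank S = Λ.card := by
  rw [opRank, range_eq_span hS Λ hw,
    show harmMono '' {k | k ∈ Λ} = range fun k : Λ => harmMono k by
      ext; simp]
  refine (rank_span (linearIndependent_harmMono.comp (Subtype.val : Λ → ℤ)
    Subtype.val_injective)).trans ?_
  rw [Cardinal.mk_range_eq _ (linearIndependent_harmMono.injective.comp Subtype.val_injective)]
  simp

/-- Each nonzero weight puts a monomial into the range, and monomials are linearly independent.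
Conversely a finite support makes the range finite-dimensional, hence closed. -/
lemma hasFiniteRank_iff (hS : ∀ n, S (harmMono n) = w n • harmMono (n + K)) :
    HasFiniteRank S ↔ {n | w n ≠ 0}.Finite := by
  constructor
  · intro h
    by_contra hinf
    have hfd : FiniteDimensional ℂ (LinearMap.range S.toLinearMap) := by
      have : FiniteDimensional ℂ (LinearMap.range S.toLinearMap).topologicalClosure := h
      exact Submodule.finiteDimensional_of_le (Submodule.le_topologicalClosure _)
    have hmem : ∀ n : {n | w n ≠ 0}, harmMono (n + K) ∈ LinearMap.range S.toLinearMap := by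
      rintro ⟨n, hn⟩
      refine ⟨(w n)⁻¹ • harmMono n, ?_⟩
      rw [ContinuousLinearMap.coe_coe, map_smul, hS, smul_smul, inv_mul_cancel₀ hn, one_smul]
    have hli : LinearIndependent ℂ fun n : {n | w n ≠ 0} =>
        (⟨harmMono (n + K), hmem n⟩ : LinearMap.range S.toLinearMap) := by
      refine LinearIndependent.of_comp (LinearMap.range S.toLinearMap).subtype ?_
      exact linearIndependent_harmMono.comp (fun n : {n | w n ≠ 0} => (n : ℤ) + K)
        (fun a b hab => Subtype.ext (by simpa using hab))
    have := hli.finite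
    exact hinf (Set.toFinite _)
  · intro h
    have hr := range_eq_span hS (h.toFinset.image (· + K)) (fun n => by simp)
    rw [HasFiniteRank, hr]
    have hfd : FiniteDimensional ℂ (Submodule.span ℂ
        (harmMono '' {k | k ∈ h.toFinset.image (· + K)})) :=
      FiniteDimensional.span_of_finite ℂ ((Finset.finite_toSet _).image _)
    rw [IsClosed.submodule_topologicalClosure_eq (Submodule.closed_of_finiteDimensional _)]
    exact hfd

end

/-! ### Toeplitz operators with quasihomogeneous symbols -/

/-- The weight of the Toeplitz operator with symbol `e^{ikθ} φ` at the `n`-th monomial. -/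
noncomputable def toepWeight (k : ℤ) (φ : ℝ → ℂ) (n : ℤ) : ℂ :=
  2 * (((n + k).natAbs : ℂ) + 1) * mellinT φ ((n.natAbs + (n + k).natAbs : ℕ) + 2)

lemma integrable_mul_harmMonoFun {F : ℂ → ℂ} (hF : Integrable F diskMeasure) (n : ℤ) :
    Integrable (fun w => F w * harmMonoFun n w) diskMeasure := by
  simp_rw [mul_comm (F _)]
  refine integrable_bdd_mul_disk (c := 1) (continuous_harmMonoFun n).measurable (fun w hw => ?_) hF
  rw [norm_harmMonoFun]
  exact pow_le_one₀ (norm_nonneg _) (mem_ball_zero_iff.1 hw).le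

lemma mellinT_mul_pow (φ : ℝ → ℂ) (j N : ℕ) :
    mellinT (fun r => φ r * (r : ℂ) ^ j) ((N : ℂ) + 2) = mellinT φ ((j + N : ℕ) + 2) := by
  rw [show (N : ℂ) + 2 = ((N + 1 : ℕ) : ℂ) + 1 by push_cast; ring,
    show ((j + N : ℕ) : ℂ) + 2 = ((j + N + 1 : ℕ) : ℂ) + 1 by push_cast; ring, mellinT_natCast,
    mellinT_natCast]
  congr 1
  ext r
  ring

lemma harmProj_quasi_mul_harmMonoFun {k : ℤ} {φ : ℝ → ℂ}
    (hφ : Integrable (quasi k φ) diskMeasure) (n : ℤ) {z : ℂ} (hz : ‖z‖ < 1) :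
    harmProj (fun w => quasi k φ w * harmMonoFun n w) z =
      toepWeight k φ n * harmMonoFun (n + k) z := by
  have hi := integrable_mul_harmMonoFun hφ n
  simp_rw [quasi_mul_harmMonoFun, add_comm k n] at hi ⊢
  rw [harmProj_quasi hi hz, mellinT_mul_pow, toepWeight]

lemma ExtendsToeplitz.apply_harmMono {k : ℤ} {φ : ℝ → ℂ}
    (hφ : Integrable (quasi k φ) diskMeasure) {T : HarmonicBergman →L[ℂ] HarmonicBergman}
    (hT : ExtendsToeplitz (quasi k φ) T) (n : ℤ) :
    T (harmMono n) = toepWeight k φ n • harmMono (n + k) := by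
  have h := hT (harmMono n) (Submodule.subset_span ⟨n, rfl⟩)
  apply Subtype.ext
  apply Lp.ext
  refine h.trans ?_
  have e : (fun w => quasi k φ w * ((harmMono n : Lp ℂ 2 diskMeasure) : ℂ → ℂ) w) =ᵐ[diskMeasure]
      fun w => quasi k φ w * harmMonoFun n w := by
    filter_upwards [coeFn_harmMono n] with w hw
    rw [hw]
  rw [harmProj_congr e]
  filter_upwards [coeFn_harmMono (n + k), ae_diskMeasure_mem_ball,
    Lp.coeFn_smul (toepWeight k φ n) (harmMono (n + k) : Lp ℂ 2 diskMeasure)] with w h1 h2 h3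
  rw [harmProj_quasi_mul_harmMonoFun hφ n (mem_ball_zero_iff.1 h2)]
  change _ = ((toepWeight k φ n • (harmMono (n + k) : Lp ℂ 2 diskMeasure) :
    Lp ℂ 2 diskMeasure) : ℂ → ℂ) w
  rw [h3, Pi.smul_apply, h1, smul_eq_mul]

lemma extendsToeplitz_of_apply_harmMono {k : ℤ} {φ : ℝ → ℂ}
    (hφ : Integrable (quasi k φ) diskMeasure) {T : HarmonicBergman →L[ℂ] HarmonicBergman}
    (hT : ∀ n, T (harmMono n) = toepWeight k φ n • harmMono (n + k)) :
    ExtendsToeplitz (quasi k φ) T := by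
  intro p hp
  -- Integrability is carried through the induction because the integral projection is additive only
  -- on integrable functions.
  suffices h : Integrable (fun w => quasi k φ w * ((p : Lp ℂ 2 diskMeasure) : ℂ → ℂ) w) diskMeasure ∧
      ((T p : Lp ℂ 2 diskMeasure) : ℂ → ℂ) =ᵐ[diskMeasure]
        harmProj (fun w => quasi k φ w * ((p : Lp ℂ 2 diskMeasure) : ℂ → ℂ) w) from h.2
  induction hp using Submodule.span_induction with
  | mem x hx =>
    obtain ⟨n, rfl⟩ := hx
    have e : (fun w => quasi k φ w * ((harmMono n : Lp ℂ 2 diskMeasure) : ℂ → ℂ) w)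
        =ᵐ[diskMeasure] fun w => quasi k φ w * harmMonoFun n w := by
      filter_upwards [coeFn_harmMono n] with w hw
      rw [hw]
    refine ⟨(integrable_mul_harmMonoFun hφ n).congr e.symm, ?_⟩
    rw [harmProj_congr e, hT]
    filter_upwards [coeFn_harmMono (n + k), ae_diskMeasure_mem_ball,
      Lp.coeFn_smul (toepWeight k φ n) (harmMono (n + k) : Lp ℂ 2 diskMeasure)] with w h1 h2 h3
    rw [harmProj_quasi_mul_harmMonoFun hφ n (mem_ball_zero_iff.1 h2)]
    refine Eq.trans h3 ?_
    rw [Pi.smul_apply, h1, smul_eq_mul]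
  | zero =>
    have e : (fun w => quasi k φ w * (((0 : HarmonicBergman) : Lp ℂ 2 diskMeasure) : ℂ → ℂ) w)
        =ᵐ[diskMeasure] fun _ => 0 := by
      filter_upwards [Lp.coeFn_zero ℂ 2 diskMeasure] with w hw
      refine Eq.trans (congrArg _ hw) ?_
      simp
    refine ⟨(integrable_zero _ _ _).congr e.symm, ?_⟩
    rw [harmProj_congr e, map_zero]
    filter_upwards [Lp.coeFn_zero ℂ 2 diskMeasure] with w hw
    refine Eq.trans hw ?_
    simp [harmProj]
  | add x y _ _ hx hy =>
    have e : (fun w => quasi k φ w * (((x + y : HarmonicBergman) : Lp ℂ 2 diskMeasure) : ℂ → ℂ) w)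
        =ᵐ[diskMeasure] fun w => quasi k φ w * ((x : Lp ℂ 2 diskMeasure) : ℂ → ℂ) w +
          quasi k φ w * ((y : Lp ℂ 2 diskMeasure) : ℂ → ℂ) w := by
      filter_upwards [Lp.coeFn_add (x : Lp ℂ 2 diskMeasure) y] with w hw
      refine Eq.trans (congrArg _ hw) ?_
      rw [Pi.add_apply, mul_add]
    refine ⟨(hx.1.add hy.1).congr e.symm, ?_⟩
    rw [harmProj_congr e, map_add]
    filter_upwards [Lp.coeFn_add (T x : Lp ℂ 2 diskMeasure) (T y), hx.2, hy.2,
      ae_diskMeasure_mem_ball] with w h1 h2 h3 h4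
    rw [harmProj_add hx.1 hy.1 (mem_ball_zero_iff.1 h4), ← h2, ← h3]
    exact h1
  | smul c x _ hx =>
    have e : (fun w => quasi k φ w * (((c • x : HarmonicBergman) : Lp ℂ 2 diskMeasure) : ℂ → ℂ) w)
        =ᵐ[diskMeasure] fun w => c * (quasi k φ w * ((x : Lp ℂ 2 diskMeasure) : ℂ → ℂ) w) := by
      filter_upwards [Lp.coeFn_smul c (x : Lp ℂ 2 diskMeasure)] with w hw
      refine Eq.trans (congrArg _ hw) ?_
      rw [Pi.smul_apply, smul_eq_mul]
      ring
    refine ⟨(hx.1.const_mul c).congr e.symm, ?_⟩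
    rw [harmProj_congr e, map_smul]
    filter_upwards [Lp.coeFn_smul c (T x : Lp ℂ 2 diskMeasure), hx.2] with w h1 h2
    rw [harmProj_const_mul, ← h2]
    exact h1

lemma toeplitz_apply_harmMono {k : ℤ} {φ : ℝ → ℂ} (h : IsTFunction (quasi k φ)) (n : ℤ) :
    toeplitz (quasi k φ) (harmMono n) = toepWeight k φ n • harmMono (n + k) := by
  rw [toeplitz, dif_pos h]
  exact ExtendsToeplitz.apply_harmMono h.1 h.2.choose_spec n

/-- With `a = |n|+1` and `b = |n+k|+1`, the weight relative to the orthonormal basis has modulus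
`2√(ab)` times that of the Mellin transform at `a+b`. Since `2√(ab) ≤ a+b`, decay of order `1/N` of
the transform bounds the shift. The bound does not involve `k`, so it serves all degrees at once. -/
lemma isTFunction_of_bound {φ : ℝ → ℂ}
    (hφ : IntegrableOn (fun r : ℝ => (r : ℂ) * φ r) (Ioo 0 1)) {C : ℝ}
    (hC : ∀ N : ℕ, ‖mellinT φ ((N : ℂ) + 2)‖ * (N + 1) ≤ C) (k : ℤ) : IsTFunction (quasi k φ) := by
  have hi := (integrable_quasi_iff k φ).2 hφ
  refine ⟨hi, ?_⟩
  obtain ⟨T, hT⟩ := exists_weighted_shift (toepWeight k φ) k (C := 2 * C) (fun n => by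
    set a : ℝ := (n.natAbs : ℝ) + 1
    set b : ℝ := ((n + k).natAbs : ℝ) + 1
    set A : ℝ := ‖mellinT φ ((n.natAbs + (n + k).natAbs : ℕ) + 2)‖
    have ha : 0 < a := by positivity
    have hb : 0 < b := by positivity
    have hA : A * (a + b) ≤ 2 * C := by
      have h1 := hC (n.natAbs + (n + k).natAbs)
      have h2 : (0 : ℝ) ≤ ((n.natAbs + (n + k).natAbs : ℕ) : ℝ) := by positivity
      have h3 : a + b = ((n.natAbs + (n + k).natAbs : ℕ) : ℝ) + 2 := by
        simp only [a, b]; push_cast; ring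
      have h4 : 0 ≤ A := norm_nonneg _
      rw [h3]
      change A * _ ≤ C at h1
      nlinarith
    have hw : ‖toepWeight k φ n‖ = 2 * b * A := by
      rw [toepWeight, norm_mul, norm_mul]
      congr 2
      · simp
      · have := Complex.norm_natCast ((n + k).natAbs + 1)
        push_cast at this
        exact this
    rw [hw]
    have hsa := Real.mul_self_sqrt ha.le
    have hsb := Real.mul_self_sqrt hb.le
    have hab : 2 * (Real.sqrt a * Real.sqrt b) ≤ a + b := by
      nlinarith [sq_nonneg (Real.sqrt a - Real.sqrt b)]
    have hsb0 : 0 ≤ Real.sqrt b := Real.sqrt_nonneg _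
    have h4 : 0 ≤ A := norm_nonneg _
    calc 2 * b * A * Real.sqrt a = A * (2 * (Real.sqrt a * Real.sqrt b)) * Real.sqrt b := by
          linear_combination (-2 * A * Real.sqrt a) * hsb
      _ ≤ A * (a + b) * Real.sqrt b := by gcongr
      _ ≤ 2 * C * Real.sqrt b := by gcongr)
  exact ⟨T, extendsToeplitz_of_apply_harmMono hi hT⟩

/-- A radial symbol gives a diagonal operator whose entries involve only the Mellin transform at
even integers, so boundedness controls even `N`. Odd `N` follow from their neighbours: consecutive
values differ by `O(1/(N+1))` because `φ(r) r` is integrable on `(0,1)`. -/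
lemma exists_bound_of_isTFunction {φ : ℝ → ℂ} (h : IsTFunction fun z => φ ‖z‖) :
    ∃ C, ∀ N : ℕ, ‖mellinT φ ((N : ℂ) + 2)‖ * (N + 1) ≤ C := by
  obtain ⟨hi, T, hT⟩ := h
  have hr := (integrable_norm_comp_iff φ).1 hi
  rw [← quasi_zero] at hT hi
  have hT' := fun n => ExtendsToeplitz.apply_harmMono hi hT n
  have heven : ∀ n : ℕ, ‖mellinT φ ((2 * n : ℕ) + 2)‖ * (2 * (n + 1)) ≤ ‖T‖ := by
    intro n
    have h1 := T.le_opNorm (harmMono n)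
    rw [hT', add_zero, norm_smul] at h1
    have h2 := le_of_mul_le_mul_right h1 (norm_pos_iff.2 (harmMono_ne_zero n))
    rw [toepWeight, add_zero, norm_mul, norm_mul, Int.natAbs_natCast] at h2
    have h3 := Complex.norm_natCast (n + 1)
    push_cast at h3
    rw [h3, ← two_mul] at h2
    simp only [Complex.norm_ofNat] at h2
    linarith
  set I : ℝ := ∫ r in Ioo (0 : ℝ) 1, ‖(r : ℂ) * φ r‖
  have hI : 0 ≤ I := integral_nonneg fun r => norm_nonneg _
  have hpow : ∀ N : ℕ, IntegrableOn (fun r : ℝ => φ r * (r : ℂ) ^ (N + 1)) (Ioo 0 1) := by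
    intro N
    have := hr.bdd_mul (c := 1) (f := fun r : ℝ => (r : ℂ) ^ N)
      (by fun_prop) ((ae_restrict_mem measurableSet_Ioo).mono fun r hr => by
        rw [norm_pow, Complex.norm_real, Real.norm_of_nonneg hr.1.le]
        exact pow_le_one₀ hr.1.le hr.2.le)
    refine this.congr (ae_of_all _ fun r => ?_)
    ring
  have hmel : ∀ N : ℕ, mellinT φ ((N : ℂ) + 2) = ∫ r in Ioo (0 : ℝ) 1, φ r * (r : ℂ) ^ (N + 1) := by
    intro N
    rw [← mellinT_natCast]
    congr 1
    push_cast
    ring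
  have hdiff : ∀ N : ℕ, ‖mellinT φ ((N : ℂ) + 2) - mellinT φ (((N + 1 : ℕ) : ℂ) + 2)‖ * (N + 1) ≤ I := by
    intro N
    rw [hmel, hmel, ← integral_sub (hpow _) (hpow _)]
    rw [← le_div_iff₀ (by positivity), div_eq_mul_inv, ← integral_mul_const]
    refine norm_integral_le_of_norm_le (hr.norm.mul_const _) ?_
    filter_upwards [ae_restrict_mem measurableSet_Ioo] with r hr
    have e : φ r * (r : ℂ) ^ (N + 1) - φ r * (r : ℂ) ^ (N + 1 + 1) =
        (r : ℂ) * φ r * ((r ^ N * (1 - r) : ℝ) : ℂ) := by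
      push_cast
      ring
    rw [e, norm_mul, Complex.norm_real]
    gcongr
    have h1 : 0 ≤ 1 - r := by linarith [hr.2]
    have h2 := hr.1.le
    rw [Real.norm_of_nonneg (by positivity), ← one_div, le_div_iff₀ (by positivity)]
    -- Together with the geometric sum this yields `(N+1) r^N (1-r) ≤ 1 - r^{N+1} ≤ 1`.
    have h3 : ((N : ℝ) + 1) * r ^ N ≤ ∑ i ∈ Finset.range (N + 1), r ^ i := by
      have := Finset.card_nsmul_le_sum (Finset.range (N + 1)) (fun i => r ^ i) (r ^ N)
        (fun i hi => pow_le_pow_of_le_one h2 hr.2.le (by simp at hi; omega))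
      simpa using this
    have h4 := mul_neg_geom_sum r (N + 1)
    have h5 : 0 ≤ r ^ (N + 1) := by positivity
    nlinarith
  refine ⟨‖T‖ + I * 2, fun N => ?_⟩
  obtain ⟨n, rfl | rfl⟩ := Nat.even_or_odd' N
  · have h1 := heven n
    have h2 := norm_nonneg (mellinT φ ((2 * n : ℕ) + 2))
    push_cast at h1 h2 ⊢
    nlinarith
  · have h1 := heven n
    have h2 := hdiff (2 * n)
    have h3 := norm_sub_norm_le (mellinT φ (((2 * n + 1 : ℕ) : ℂ) + 2)) (mellinT φ (((2 * n : ℕ) : ℂ) + 2))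
    rw [norm_sub_rev] at h3
    have h4 := norm_nonneg (mellinT φ (((2 * n : ℕ) : ℂ) + 2) - mellinT φ (((2 * n + 1 : ℕ) : ℂ) + 2))
    set x := ‖mellinT φ (((2 * n + 1 : ℕ) : ℂ) + 2)‖
    set y := ‖mellinT φ (((2 * n : ℕ) : ℂ) + 2)‖
    set d := ‖mellinT φ (((2 * n : ℕ) : ℂ) + 2) - mellinT φ (((2 * n + 1 : ℕ) : ℂ) + 2)‖
    have h5 : x ≤ y + d := by linarith
    have h6 : (0 : ℝ) ≤ n := Nat.cast_nonneg n
    push_cast at h2 ⊢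
    have h7 : x * (2 * n + 1 + 1) ≤ (y + d) * (2 * n + 1 + 1) := by gcongr
    nlinarith

lemma isTFunction_quasi {φ : ℝ → ℂ} (h : IsTFunction fun z => φ ‖z‖) (k : ℤ) :
    IsTFunction (quasi k φ) := by
  obtain ⟨C, hC⟩ := exists_bound_of_isTFunction h
  exact isTFunction_of_bound ((integrable_norm_comp_iff φ).1 h.1) hC k

lemma mellinT_rpow {m : ℝ} {z : ℂ} (hz : 0 < z.re + m) :
    mellinT (fun r => ((r ^ m : ℝ) : ℂ)) z = 1 / (z + m) := by
  have h1 : ∀ r ∈ Ioo (0 : ℝ) 1, ((r ^ m : ℝ) : ℂ) * (r : ℂ) ^ (z - 1) = (r : ℂ) ^ (z + m - 1) := by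
    intro r hr
    have h0 : (r : ℂ) ≠ 0 := by exact_mod_cast hr.1.ne'
    rw [Complex.ofReal_cpow hr.1.le, ← Complex.cpow_add _ _ h0]
    congr 1
    ring
  have hre : -1 < (z + m - 1).re := by simp; linarith
  have hz0 : z + m ≠ 0 := by
    intro h
    have := congrArg Complex.re h
    simp at this
    linarith
  rw [mellinT, setIntegral_congr_fun measurableSet_Ioo h1, ← integral_Ioc_eq_integral_Ioo,
    ← intervalIntegral.integral_of_le zero_le_one, integral_cpow (Or.inl hre)]
  simp [hz0]

lemma integrableOn_mul_rpow {m : ℝ} (hm : -1 ≤ m) :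
    IntegrableOn (fun r : ℝ => (r : ℂ) * ((r ^ m : ℝ) : ℂ)) (Ioo 0 1) := by
  have h : IntegrableOn (fun r : ℝ => r ^ (m + 1)) (Ioo 0 1) := by
    rw [intervalIntegral.integrableOn_Ioo_rpow_iff zero_lt_one]
    linarith
  refine (h.ofReal (𝕜 := ℂ)).congr ?_
  filter_upwards [ae_restrict_mem measurableSet_Ioo] with r hr
  rw [Real.rpow_add_one hr.1.ne']
  push_cast
  exact mul_comm _ _

lemma isTFunction_quasi_rpow {m : ℝ} (hm : -1 ≤ m) (k : ℤ) :
    IsTFunction (quasi k fun r => ((r ^ m : ℝ) : ℂ)) := by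
  refine isTFunction_of_bound (integrableOn_mul_rpow hm) (C := 1) (fun N => ?_) k
  have hN : (0 : ℝ) ≤ N := Nat.cast_nonneg N
  have h1 : 0 < (N : ℝ) + 2 + m := by linarith
  rw [mellinT_rpow (by simpa using h1),
    show (N : ℂ) + 2 + m = ((N + 2 + m : ℝ) : ℂ) by push_cast; ring, norm_div, norm_one,
    Complex.norm_real, Real.norm_of_nonneg h1.le, one_div, inv_mul_le_iff₀ h1]
  linarith

/-- The weights of the generalized semicommutator. -/
noncomputable def scWeight (k₁ k₂ : ℤ) (m : ℝ) (φ ψ : ℝ → ℂ) (n : ℤ) : ℂ :=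
  2 * (((n + (k₁ + k₂)).natAbs : ℂ) + 1) *
    (2 * (((n + k₂).natAbs : ℂ) + 1) /
        (((n + k₂).natAbs : ℂ) + ((n + (k₁ + k₂)).natAbs : ℂ) + 2 + m) *
      mellinT φ ((n.natAbs + (n + k₂).natAbs : ℕ) + 2) -
    mellinT ψ ((n.natAbs + (n + (k₁ + k₂)).natAbs : ℕ) + 2))

lemma semicomm_apply_harmMono {k₁ k₂ : ℤ} {m : ℝ} (hm : -1 ≤ m) {φ ψ : ℝ → ℂ}
    (hφ : IsTFunction fun z => φ ‖z‖) (hψ : IsTFunction fun z => ψ ‖z‖) (n : ℤ) :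
    semicomm k₁ k₂ m φ ψ (harmMono n) =
      scWeight k₁ k₂ m φ ψ n • harmMono (n + (k₁ + k₂)) := by
  rw [semicomm, sub_apply, ContinuousLinearMap.comp_apply,
    toeplitz_apply_harmMono (isTFunction_quasi hφ _),
    toeplitz_apply_harmMono (isTFunction_quasi hψ _), map_smul,
    toeplitz_apply_harmMono (isTFunction_quasi_rpow hm _), smul_smul,
    show n + k₂ + k₁ = n + (k₁ + k₂) by ring, ← sub_smul]
  congr 1
  have h1 : (0 : ℝ) ≤ (((n + k₂).natAbs + (n + (k₁ + k₂)).natAbs : ℕ) : ℝ) := Nat.cast_nonneg _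
  have h2 : (0 : ℝ) < ((((n + k₂).natAbs + (n + (k₁ + k₂)).natAbs : ℕ) : ℂ) + 2).re + m := by
    simp only [Complex.add_re, Complex.natCast_re, Complex.re_ofNat]
    linarith
  rw [toepWeight, toepWeight, toepWeight, scWeight, show n + k₂ + k₁ = n + (k₁ + k₂) by ring,
    mellinT_rpow h2]
  push_cast
  ring

/-! ### Laplace transforms -/

lemma image_exp_neg_mul {c : ℝ} (hc : 0 < c) :
    (fun x : ℝ => Real.exp (-(c * x))) '' Ioi 0 = Ioo 0 1 := by
  ext r
  constructor
  · rintro ⟨x, hx, rfl⟩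
    exact ⟨Real.exp_pos _, by simpa using mul_pos hc hx⟩
  · rintro ⟨h0, h1⟩
    refine ⟨-Real.log r / c, div_pos (neg_pos.2 (Real.log_neg h0 h1)) hc, ?_⟩
    have : -(c * (-Real.log r / c)) = Real.log r := by field_simp
    simp only [this, Real.exp_log h0]

lemma hasDerivAt_exp_neg_mul (c x : ℝ) :
    HasDerivAt (fun x : ℝ => Real.exp (-(c * x))) (-c * Real.exp (-(c * x))) x := by
  have h : HasDerivAt (fun x : ℝ => -(c * x)) (-c) x := by
    have := ((hasDerivAt_id x).const_mul c).neg
    rw [mul_one] at this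
    exact this
  simpa [mul_comm] using h.exp

lemma injOn_exp_neg_mul {c : ℝ} (hc : 0 < c) (s : Set ℝ) :
    InjOn (fun x : ℝ => Real.exp (-(c * x))) s := by
  intro x _ y _ h
  have := Real.exp_injective h
  have h2 : c * x = c * y := by linarith
  exact mul_left_cancel₀ hc.ne' h2

lemma abs_deriv_exp_neg_mul {c : ℝ} (hc : 0 < c) (x : ℝ) :
    |-c * Real.exp (-(c * x))| = c * Real.exp (-(c * x)) := by
  rw [abs_mul, abs_neg, abs_of_pos hc, abs_of_pos (Real.exp_pos _)]

lemma integral_Ioo_eq_integral_exp {c : ℝ} (hc : 0 < c) (g : ℝ → ℂ) :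
    ∫ r in Ioo (0 : ℝ) 1, g r =
      ∫ x in Ioi (0 : ℝ), (c * Real.exp (-(c * x))) • g (Real.exp (-(c * x))) := by
  rw [← image_exp_neg_mul hc, integral_image_eq_integral_abs_deriv_smul measurableSet_Ioi
    (fun x _ => (hasDerivAt_exp_neg_mul c x).hasDerivWithinAt) (injOn_exp_neg_mul hc _)]
  simp_rw [abs_deriv_exp_neg_mul hc]

lemma integrableOn_Ioo_iff_exp {c : ℝ} (hc : 0 < c) (g : ℝ → ℂ) :
    IntegrableOn g (Ioo 0 1) ↔
      IntegrableOn (fun x => (c * Real.exp (-(c * x))) • g (Real.exp (-(c * x)))) (Ioi 0) := by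
  rw [← image_exp_neg_mul hc, integrableOn_image_iff_integrableOn_abs_deriv_smul measurableSet_Ioi
    (fun x _ => (hasDerivAt_exp_neg_mul c x).hasDerivWithinAt) (injOn_exp_neg_mul hc _)]
  simp_rw [abs_deriv_exp_neg_mul hc]

/-- A differentiable map of the line sends null sets to null sets. -/
lemma ae_Ioo_of_ae_exp {p : ℝ → Prop}
    (h : ∀ᵐ x ∂volume.restrict (Ioi (0 : ℝ)), p (Real.exp (-x))) :
    ∀ᵐ r ∂volume.restrict (Ioo (0 : ℝ) 1), p r := by
  rw [ae_restrict_iff' measurableSet_Ioi, ae_iff] at h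
  rw [ae_restrict_iff' measurableSet_Ioo, ae_iff]
  refine measure_mono_null ?_ (addHaar_image_eq_zero_of_differentiableOn_of_addHaar_eq_zero volume
    (f := fun x : ℝ => Real.exp (-x)) (by fun_prop) h)
  intro r hr
  simp only [mem_ofPred_eq, Classical.not_imp] at hr
  obtain ⟨hr1, hr2⟩ := hr
  have e : Real.exp (-(-Real.log r)) = r := by rw [neg_neg, Real.exp_log hr1.1]
  refine ⟨-Real.log r, ?_, e⟩
  simp only [mem_ofPred_eq, Classical.not_imp, mem_Ioi, e]
  exact ⟨neg_pos.2 (Real.log_neg hr1.1 hr1.2), hr2⟩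

/-- The Laplace transform. -/
noncomputable def laplaceT (f : ℝ → ℂ) (z : ℂ) : ℂ :=
  ∫ x in Ioi (0 : ℝ), f x * Complex.exp (-(z * x))

/-- The functions whose Laplace transform converges absolutely for `Re z ≥ 2`. -/
def LaplaceIntegrable (f : ℝ → ℂ) : Prop :=
  IntegrableOn (fun x : ℝ => f x * Complex.exp (-(2 * x))) (Ioi 0)

/-- `G` agrees with an absolutely convergent Laplace transform for `Re z ≥ 2`. -/
def IsLaplace (G : ℂ → ℂ) : Prop :=
  ∃ f, LaplaceIntegrable f ∧ ∀ z : ℂ, 2 ≤ z.re → G z = laplaceT f z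

lemma norm_exp_neg_mul_le {z : ℂ} (hz : 0 ≤ z.re) {x : ℝ} (hx : 0 < x) :
    ‖Complex.exp (-(z * x))‖ ≤ 1 := by
  rw [Complex.norm_exp]
  simp
  positivity

lemma LaplaceIntegrable.integrableOn {f : ℝ → ℂ} (hf : LaplaceIntegrable f) {z : ℂ}
    (hz : 2 ≤ z.re) : IntegrableOn (fun x : ℝ => f x * Complex.exp (-(z * x))) (Ioi 0) := by
  have h := Integrable.bdd_mul (c := 1) hf (f := fun x : ℝ => Complex.exp (-((z - 2) * x)))
    (by fun_prop) ((ae_restrict_mem measurableSet_Ioi).mono fun x hx =>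
      norm_exp_neg_mul_le (by simpa using hz) hx)
  refine h.congr (ae_of_all _ fun x => ?_)
  simp only
  rw [mul_left_comm, ← Complex.exp_add]
  congr 2
  ring

lemma exp_smul_cpow (φ : ℝ → ℂ) (z : ℂ) (x : ℝ) :
    (1 * Real.exp (-(1 * x))) • (φ (Real.exp (-(1 * x))) *
      (Real.exp (-(1 * x)) : ℂ) ^ (z - 1)) = φ (Real.exp (-x)) * Complex.exp (-(z * x)) := by
  have h0 : (Real.exp (-x) : ℂ) ≠ 0 := by exact_mod_cast (Real.exp_pos _).ne'
  have h1 : (Real.exp (-x) : ℂ) ^ z = Complex.exp (-(z * x)) := by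
    rw [Complex.cpow_def_of_ne_zero h0, ← Complex.ofReal_log (Real.exp_pos _).le, Real.log_exp]
    congr 1
    push_cast
    ring
  rw [one_mul, one_mul, Complex.real_smul, Complex.cpow_sub _ _ h0, Complex.cpow_one, h1]
  field_simp

lemma mellinT_eq_laplaceT (φ : ℝ → ℂ) (z : ℂ) :
    mellinT φ z = laplaceT (fun x => φ (Real.exp (-x))) z := by
  rw [mellinT, integral_Ioo_eq_integral_exp one_pos, laplaceT]
  simp_rw [exp_smul_cpow]

lemma laplaceIntegrable_comp_exp {φ : ℝ → ℂ}
    (hφ : IntegrableOn (fun r : ℝ => (r : ℂ) * φ r) (Ioo 0 1)) :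
    LaplaceIntegrable fun x => φ (Real.exp (-x)) := by
  have h := (integrableOn_Ioo_iff_exp one_pos (fun r : ℝ => φ r * (r : ℂ) ^ ((2 : ℂ) - 1))).1 (by
    refine hφ.congr (ae_of_all _ fun r => ?_)
    norm_num
    ring)
  simp_rw [exp_smul_cpow] at h
  exact h

lemma isLaplace_mellinT {φ : ℝ → ℂ}
    (hφ : IntegrableOn (fun r : ℝ => (r : ℂ) * φ r) (Ioo 0 1)) : IsLaplace (mellinT φ) :=
  ⟨_, laplaceIntegrable_comp_exp hφ, fun z _ => mellinT_eq_laplaceT φ z⟩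

/-! ### Closure of the class of Laplace transforms under algebraic operations -/

section closure

variable {G H : ℂ → ℂ}

lemma IsLaplace.congr (hG : IsLaplace G) (h : ∀ z : ℂ, 2 ≤ z.re → H z = G z) : IsLaplace H := by
  obtain ⟨f, hf, hfG⟩ := hG
  exact ⟨f, hf, fun z hz => (h z hz).trans (hfG z hz)⟩

lemma LaplaceIntegrable.sub {f g : ℝ → ℂ} (hf : LaplaceIntegrable f) (hg : LaplaceIntegrable g) :
    LaplaceIntegrable fun x => f x - g x :=
  (Integrable.sub hf hg).congr (ae_of_all _ fun x => by simp [sub_mul])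

lemma laplaceT_sub {f g : ℝ → ℂ} (hf : LaplaceIntegrable f) (hg : LaplaceIntegrable g) {z : ℂ}
    (hz : 2 ≤ z.re) : laplaceT (fun x => f x - g x) z = laplaceT f z - laplaceT g z := by
  simp only [laplaceT, sub_mul]
  exact integral_sub (hf.integrableOn hz) (hg.integrableOn hz)

lemma LaplaceIntegrable.const_mul {f : ℝ → ℂ} (hf : LaplaceIntegrable f) (c : ℂ) :
    LaplaceIntegrable fun x => c * f x :=
  (Integrable.const_mul hf c).congr (ae_of_all _ fun x => by simp [mul_assoc])

lemma laplaceT_const_mul (f : ℝ → ℂ) (c z : ℂ) :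
    laplaceT (fun x => c * f x) z = c * laplaceT f z := by
  simp only [laplaceT, mul_assoc]
  exact integral_const_mul _ _

lemma IsLaplace.const_mul (hG : IsLaplace G) (c : ℂ) : IsLaplace fun z => c * G z := by
  obtain ⟨f, hf, hfG⟩ := hG
  exact ⟨_, hf.const_mul c, fun z hz => by simp only [laplaceT_const_mul, hfG z hz]⟩

lemma IsLaplace.sub (hG : IsLaplace G) (hH : IsLaplace H) : IsLaplace fun z => G z - H z := by
  obtain ⟨f, hf, hfG⟩ := hG
  obtain ⟨g, hg, hgH⟩ := hH
  exact ⟨_, hf.sub hg, fun z hz => by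
    simp only [laplaceT_sub hf hg hz, hfG z hz, hgH z hz]⟩

lemma IsLaplace.add (hG : IsLaplace G) (hH : IsLaplace H) : IsLaplace fun z => G z + H z :=
  (hG.sub (hH.const_mul (-1))).congr fun z _ => by ring

/-- Convolution on the half-line. -/
noncomputable def halfConv (f g : ℝ → ℂ) (x : ℝ) : ℂ := ∫ t in (0 : ℝ)..x, f t * g (x - t)

/-- As `e^{-zx} = e^{-zt} e^{-z(x-t)}`, a weighted convolution is the convolution of the weighted
functions. This gives both the integrability of convolutions and the product rule for transforms. -/
lemma halfConv_mul_exp (f g : ℝ → ℂ) (z : ℂ) (x : ℝ) :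
    halfConv f g x * Complex.exp (-(z * x)) = ∫ t in (0 : ℝ)..x,
      ContinuousLinearMap.mul ℝ ℂ (f t * Complex.exp (-(z * t)))
        (g (x - t) * Complex.exp (-(z * ((x - t : ℝ) : ℂ)))) := by
  rw [halfConv, ← intervalIntegral.integral_mul_const]
  congr 1
  ext t
  have : Complex.exp (-(z * x)) =
      Complex.exp (-(z * t)) * Complex.exp (-(z * ((x - t : ℝ) : ℂ))) := by
    rw [← Complex.exp_add]
    congr 1
    push_cast
    ring
  rw [this, ContinuousLinearMap.mul_apply']
  ring

lemma LaplaceIntegrable.halfConv {f g : ℝ → ℂ} (hf : LaplaceIntegrable f)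
    (hg : LaplaceIntegrable g) : LaplaceIntegrable (halfConv f g) := by
  have h := (integrable_posConvolution hf hg (ContinuousLinearMap.mul ℝ ℂ)).integrableOn
    (s := Ioi 0)
  refine h.congr ?_
  filter_upwards [ae_restrict_mem measurableSet_Ioi] with x hx
  rw [posConvolution, indicator_of_mem hx, halfConv_mul_exp]

lemma laplaceT_halfConv {f g : ℝ → ℂ} (hf : LaplaceIntegrable f) (hg : LaplaceIntegrable g) {z : ℂ}
    (hz : 2 ≤ z.re) : laplaceT (halfConv f g) z = laplaceT f z * laplaceT g z := by
  have h := integral_posConvolution (hf.integrableOn hz) (hg.integrableOn hz)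
    (ContinuousLinearMap.mul ℝ ℂ)
  rw [laplaceT]
  simp_rw [halfConv_mul_exp]
  exact h

lemma IsLaplace.mul (hG : IsLaplace G) (hH : IsLaplace H) : IsLaplace fun z => G z * H z := by
  obtain ⟨f, hf, hfG⟩ := hG
  obtain ⟨g, hg, hgH⟩ := hH
  exact ⟨_, hf.halfConv hg, fun z hz => by
    simp only [laplaceT_halfConv hf hg hz, hfG z hz, hgH z hz]⟩

lemma IsLaplace.comp_add (hG : IsLaplace G) {c : ℝ} (hc : 0 ≤ c) :
    IsLaplace fun z => G (z + c) := by
  obtain ⟨f, hf, hfG⟩ := hG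
  have e : ∀ (z : ℂ) (x : ℝ), f x * Complex.exp (-((c : ℂ) * x)) * Complex.exp (-(z * x)) =
      f x * Complex.exp (-((z + c) * x)) := by
    intro z x
    rw [mul_assoc, ← Complex.exp_add]
    congr 2
    ring
  refine ⟨fun x => f x * Complex.exp (-((c : ℂ) * x)), ?_, fun z hz => ?_⟩
  · rw [LaplaceIntegrable]
    simp_rw [e]
    exact hf.integrableOn (by simpa using hc)
  · have h2 : 2 ≤ (z + c).re := by simp; linarith
    simp only [hfG _ h2, laplaceT, e]

lemma ne_zero_of_two_le_re {z : ℂ} (hz : 2 ≤ z.re) {d : ℝ} (hd : -2 < d) : z + d ≠ 0 := by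
  intro h
  have := congrArg Complex.re h
  simp at this
  linarith

lemma laplaceIntegrable_exp {d : ℝ} (hd : -2 < d) :
    LaplaceIntegrable fun x : ℝ => Complex.exp (-((d : ℂ) * x)) := by
  have h : IntegrableOn (fun x : ℝ => Complex.exp (((-(2 + d) : ℝ) : ℂ) * x)) (Ioi 0) :=
    integrableOn_exp_mul_complex_Ioi (by simp; linarith) 0
  refine h.congr (ae_of_all _ fun x => ?_)
  simp only
  rw [← Complex.exp_add]
  congr 1
  push_cast
  ring

lemma laplaceT_exp {d : ℝ} (hd : -2 < d) {z : ℂ} (hz : 2 ≤ z.re) :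
    laplaceT (fun x : ℝ => Complex.exp (-((d : ℂ) * x))) z = 1 / (z + d) := by
  have h := integral_exp_mul_complex_Ioi (a := -(z + d)) (by simp; linarith) 0
  have hne := ne_zero_of_two_le_re hz hd
  rw [laplaceT, show (1 : ℂ) / (z + d) = -Complex.exp (-(z + d) * (0 : ℝ)) / -(z + d) by
    rw [Complex.ofReal_zero, mul_zero, Complex.exp_zero, neg_div_neg_eq], ← h]
  congr 1
  ext x
  rw [← Complex.exp_add]
  congr 1
  ring

lemma isLaplace_one_div {d : ℝ} (hd : -2 < d) : IsLaplace fun z => 1 / (z + d) :=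
  ⟨_, laplaceIntegrable_exp hd, fun _ hz => (laplaceT_exp hd hz).symm⟩

/-- Fractional linear factors preserve Laplace transforms. -/
lemma IsLaplace.linear_div (hG : IsLaplace G) (p : ℂ) {d : ℝ} (hd : -2 < d) :
    IsLaplace fun z => (z + p) / (z + d) * G z :=
  -- The factor is `1 + (p-d)/(z+d)`, and `1/(z+d)` is itself a Laplace transform.
  (hG.add (((isLaplace_one_div hd).mul hG).const_mul (p - d))).congr fun z hz => by
    have := ne_zero_of_two_le_re hz hd
    field_simp
    ring

end closure

/-! ### Uniqueness -/

/-- Test against a smooth compactly supported `g`. In the variable `t = e^{-αx}` it is a continuous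
function on `[0,1]`, a uniform limit of polynomials by Weierstrass; the hypothesis says that `h`
annihilates polynomials in `e^{-αx}`. -/
lemma ae_eq_zero_of_integral_mul_exp {h : ℝ → ℂ} (hh : IntegrableOn h (Ioi 0)) {α : ℝ}
    (hα : 0 < α)
    (h0 : ∀ j : ℕ, ∫ x in Ioi (0 : ℝ), (Real.exp (-(α * x)) ^ j : ℝ) • h x = 0) :
    ∀ᵐ x ∂volume.restrict (Ioi (0 : ℝ)), h x = 0 := by
  rw [ae_restrict_iff' measurableSet_Ioi]
  refine isOpen_Ioi.ae_eq_zero_of_integral_contDiff_smul_eq_zero hh.locallyIntegrableOn ?_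
  intro g hg hgc hgs
  obtain ⟨R, hR⟩ := hgc.isCompact.isBounded.subset_closedBall 0
  set R' : ℝ := max R 0 + 1
  have hzero : ∀ x, R' ≤ x → g x = 0 := by
    intro x hx
    by_contra hne
    have := hR (subset_tsupport _ hne)
    rw [Metric.mem_closedBall, dist_zero_right, Real.norm_eq_abs] at this
    have h1 := le_abs_self x
    have h2 := le_max_left R 0
    linarith
  set δ : ℝ := Real.exp (-(α * R'))
  have hδ : 0 < δ := Real.exp_pos _
  -- Cutting `t` off at `δ` keeps the logarithm continuous at `t = 0`; below `δ` the value is `g R'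
  -- = 0`, in agreement with `g` beyond `R'`.
  set G : ℝ → ℝ := fun t => g (-Real.log (max t δ) / α)
  have hG : Continuous G := by
    have : Continuous fun t : ℝ => Real.log (max t δ) :=
      Continuous.log (by fun_prop) fun t => (lt_max_of_lt_right hδ).ne'
    exact hg.continuous.comp (this.neg.div_const α)
  have hGg : ∀ x, G (Real.exp (-(α * x))) = g x := by
    intro x
    by_cases hx : x ≤ R'
    · have : δ ≤ Real.exp (-(α * x)) := Real.exp_le_exp.2 (by nlinarith)
      simp only [G, max_eq_left this, Real.log_exp]
      congr 1
      field_simp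
    · push Not at hx
      have : Real.exp (-(α * x)) ≤ δ := Real.exp_le_exp.2 (by nlinarith)
      simp only [G, max_eq_right this]
      rw [hzero x hx.le]
      simp only [δ, Real.log_exp]
      apply hzero
      rw [le_div_iff₀ hα]
      linarith
  have hint : ∀ j : ℕ, IntegrableOn (fun x => (Real.exp (-(α * x)) ^ j : ℝ) • h x) (Ioi 0) := by
    intro j
    refine Integrable.bdd_smul (φ := fun x => Real.exp (-(α * x)) ^ j) hh 1
      (by fun_prop) ?_
    filter_upwards [ae_restrict_mem measurableSet_Ioi] with x hx
    rw [Real.norm_of_nonneg (by positivity)]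
    refine pow_le_one₀ (Real.exp_pos _).le ?_
    rw [Real.exp_le_one_iff]
    have : 0 < α * x := mul_pos hα hx
    linarith
  have hpoly : ∀ p : Polynomial ℝ,
      IntegrableOn (fun x => p.eval (Real.exp (-(α * x))) • h x) (Ioi 0) ∧
      ∫ x in Ioi (0 : ℝ), p.eval (Real.exp (-(α * x))) • h x = 0 := by
    intro p
    have e : ∀ x, p.eval (Real.exp (-(α * x))) • h x = ∑ j ∈ Finset.range (p.natDegree + 1),
        p.coeff j • ((Real.exp (-(α * x)) ^ j : ℝ) • h x) := by
      intro x
      rw [Polynomial.eval_eq_sum_range, Finset.sum_smul]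
      simp_rw [mul_smul]
    simp_rw [e]
    have hj : ∀ j ∈ Finset.range (p.natDegree + 1), IntegrableOn
        (fun x => p.coeff j • ((Real.exp (-(α * x)) ^ j : ℝ) • h x)) (Ioi 0) :=
      fun j _ => Integrable.smul (p.coeff j) (hint j)
    constructor
    · exact integrable_finsetSum _ hj
    · rw [integral_finsetSum _ hj]
      refine Finset.sum_eq_zero fun j _ => ?_
      rw [integral_smul, h0, smul_zero]
  have hset : ∫ x, g x • h x = ∫ x in Ioi (0 : ℝ), g x • h x := by
    rw [setIntegral_eq_integral_of_forall_compl_eq_zero]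
    intro x hx
    rw [image_eq_zero_of_notMem_tsupport (fun h => hx (hgs h)), zero_smul]
  rw [hset, ← norm_le_zero_iff]
  set I : ℝ := ∫ x in Ioi (0 : ℝ), ‖h x‖
  have hI : 0 ≤ I := integral_nonneg fun x => norm_nonneg _
  refine le_of_forall_pos_le_add fun ε hε => ?_
  obtain ⟨p, hp⟩ := exists_polynomial_near_of_continuousOn 0 1 G hG.continuousOn (ε / (I + 1))
    (by positivity)
  have hgi : IntegrableOn (fun x => g x • h x) (Ioi 0) := by
    obtain ⟨B, hB⟩ := hgc.exists_bound_of_continuous hg.continuous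
    exact Integrable.bdd_smul hh B hg.continuous.aestronglyMeasurable (ae_of_all _ hB)
  have hsub : ∫ x in Ioi (0 : ℝ), g x • h x =
      ∫ x in Ioi (0 : ℝ), (g x • h x - p.eval (Real.exp (-(α * x))) • h x) := by
    rw [integral_sub hgi (hpoly p).1, (hpoly p).2, sub_zero]
  rw [hsub, zero_add]
  have hle : ‖∫ x in Ioi (0 : ℝ), (g x • h x - p.eval (Real.exp (-(α * x))) • h x)‖ ≤
      ∫ x in Ioi (0 : ℝ), ε / (I + 1) * ‖h x‖ := by
    refine norm_integral_le_of_norm_le (hh.norm.const_mul _) ?_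
    filter_upwards [ae_restrict_mem measurableSet_Ioi] with x hx
    rw [← sub_smul, norm_smul]
    have h1 := hp (Real.exp (-(α * x))) ⟨(Real.exp_pos _).le, by
      rw [Real.exp_le_one_iff]
      have : 0 < α * x := mul_pos hα hx
      linarith⟩
    rw [hGg, abs_sub_comm] at h1
    exact mul_le_mul_of_nonneg_right h1.le (norm_nonneg _)
  refine hle.trans ?_
  rw [integral_const_mul, div_mul_eq_mul_div, div_le_iff₀ (by positivity)]
  change ε * I ≤ _
  nlinarith

lemma ae_eq_zero_of_laplaceT_eq_zero {f : ℝ → ℂ} (hf : LaplaceIntegrable f) {z₀ : ℂ}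
    (hz₀ : 2 ≤ z₀.re) {α : ℝ} (hα : 0 < α) (h : ∀ j : ℕ, laplaceT f (z₀ + α * j) = 0) :
    ∀ᵐ x ∂volume.restrict (Ioi (0 : ℝ)), f x = 0 := by
  have := ae_eq_zero_of_integral_mul_exp (hf.integrableOn hz₀) hα (fun j => by
    rw [← h j, laplaceT]
    congr 1
    ext x
    have e : ((Real.exp (-(α * x)) ^ j : ℝ) : ℂ) = Complex.exp (-(α * j * x)) := by
      rw [← Real.exp_nat_mul]
      push_cast
      congr 1
      ring
    rw [Complex.real_smul, e, mul_left_comm, ← Complex.exp_add]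
    congr 2
    ring)
  filter_upwards [this] with x hx
  exact (mul_eq_zero.1 hx).resolve_right (Complex.exp_ne_zero _)

lemma laplaceT_eq_zero {f : ℝ → ℂ} (h : ∀ᵐ x ∂volume.restrict (Ioi (0 : ℝ)), f x = 0) (z : ℂ) :
    laplaceT f z = 0 := by
  rw [laplaceT, integral_eq_zero_of_ae]
  filter_upwards [h] with x hx
  simp [hx]

/-- The identity principle behind every uniqueness argument below: the values on one arithmetic
progression determine the originating function a.e., hence the transform on the whole half-plane. -/
lemma IsLaplace.eq_of_eq_arith {G H : ℂ → ℂ} (hG : IsLaplace G) (hH : IsLaplace H) {z₀ : ℂ}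
    (hz₀ : 2 ≤ z₀.re) {α : ℝ} (hα : 0 < α) (h : ∀ j : ℕ, G (z₀ + α * j) = H (z₀ + α * j)) :
    ∀ z : ℂ, 2 ≤ z.re → G z = H z := by
  obtain ⟨f, hf, hfG⟩ := hG.sub hH
  have hre : ∀ j : ℕ, 2 ≤ (z₀ + α * j).re := fun j => by
    have : 0 ≤ α * j := by positivity
    simpa using by linarith
  have := laplaceT_eq_zero (ae_eq_zero_of_laplaceT_eq_zero hf hz₀ hα fun j => by
    rw [← hfG _ (hre j)]
    exact sub_eq_zero.2 (h j))
  intro z hz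
  exact sub_eq_zero.1 ((hfG z hz).trans (this z))

/-- A radial function is determined by its Mellin transform on an arithmetic progression. -/
lemma radialEq_of_laplaceT {φ : ℝ → ℂ} (hφ : IntegrableOn (fun r : ℝ => (r : ℂ) * φ r) (Ioo 0 1))
    {g : ℝ → ℂ} (hg : LaplaceIntegrable g) (h : ∀ z : ℂ, 2 ≤ z.re → mellinT φ z = laplaceT g z) :
    ∀ᵐ x ∂volume.restrict (Ioi (0 : ℝ)), φ (Real.exp (-x)) = g x := by
  have hf := laplaceIntegrable_comp_exp hφ
  have := ae_eq_zero_of_laplaceT_eq_zero (hf.sub hg) (z₀ := 2) (by simp) one_pos (fun j => by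
    have hre : 2 ≤ ((2 : ℂ) + ((1 : ℝ) : ℂ) * j).re := by simp
    rw [laplaceT_sub hf hg hre, ← mellinT_eq_laplaceT, h _ hre, sub_self])
  filter_upwards [this] with x hx
  exact sub_eq_zero.1 hx

lemma radialEq_of_mellinT_eq {φ ψ : ℝ → ℂ}
    (hφ : IntegrableOn (fun r : ℝ => (r : ℂ) * φ r) (Ioo 0 1))
    (hψ : IntegrableOn (fun r : ℝ => (r : ℂ) * ψ r) (Ioo 0 1))
    (h : ∀ z : ℂ, 2 ≤ z.re → mellinT φ z = mellinT ψ z) : RadialEq φ ψ :=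
  ae_Ioo_of_ae_exp (p := fun r => φ r = ψ r)
    (radialEq_of_laplaceT hφ (laplaceIntegrable_comp_exp hψ) fun z hz => by
      rw [h z hz, mellinT_eq_laplaceT])

lemma mellinT_congr {φ ψ : ℝ → ℂ} (h : RadialEq φ ψ) : mellinT φ = mellinT ψ := by
  ext z
  refine integral_congr_ae ?_
  filter_upwards [h] with r hr
  rw [hr]

/-! ### Quotients of Gamma functions -/

/-- The beta integrand under `r = e^{-cx}`; `w` stands for its factor `(1-r)^{δ-1}`. -/
lemma exp_smul_beta {c : ℝ} (hc : 0 < c) (u : ℝ) (w z : ℂ) (x : ℝ) :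
    (c * Real.exp (-(c * x))) • ((Real.exp (-(c * x)) : ℂ) ^ ((z + u) / c - 1) * w) =
      (c * (Complex.exp (-(u * x)) * w)) * Complex.exp (-(z * x)) := by
  have h0 : (Real.exp (-(c * x)) : ℂ) ≠ 0 := by exact_mod_cast (Real.exp_pos _).ne'
  have hc0 : (c : ℂ) ≠ 0 := by exact_mod_cast hc.ne'
  have h1 : (Real.exp (-(c * x)) : ℂ) ^ ((z + u) / c) =
      Complex.exp (-(u * x)) * Complex.exp (-(z * x)) := by
    rw [Complex.cpow_def_of_ne_zero h0, ← Complex.ofReal_log (Real.exp_pos _).le, Real.log_exp,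
      ← Complex.exp_add]
    congr 1
    push_cast
    field_simp
    ring
  rw [Complex.real_smul, Complex.cpow_sub _ _ h0, Complex.cpow_one, h1, Complex.ofReal_mul]
  field_simp

/-- Up to the constant `Γ(δ)` with `δ = (v-u)/c`, the quotient is the beta integral at `((z+u)/c,
δ)`, which the substitution `r = e^{-cx}` turns into a Laplace transform. -/
lemma isLaplace_gamma_div {c u v : ℝ} (hc : 0 < c) (hu : -2 < u) (huv : u < v) :
    IsLaplace fun z => Complex.Gamma ((z + u) / c) / Complex.Gamma ((z + v) / c) := by
  have hc0 : (c : ℂ) ≠ 0 := by exact_mod_cast hc.ne'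
  set δ : ℝ := (v - u) / c
  have hδ : 0 < δ := div_pos (by linarith) hc
  have hre : ∀ z : ℂ, 2 ≤ z.re → 0 < ((z + u) / c).re := fun z hz => by
    rw [Complex.div_ofReal_re]
    apply div_pos _ hc
    simp
    linarith
  set f : ℝ → ℂ := fun x => c * (Complex.exp (-(u * x)) *
    (1 - (Real.exp (-(c * x)) : ℂ)) ^ ((δ : ℂ) - 1)) with hf
  have hbeta : ∀ z : ℂ, 2 ≤ z.re → Complex.betaIntegral ((z + u) / c) δ = laplaceT f z := by
    intro z hz
    rw [Complex.betaIntegral, intervalIntegral.integral_of_le zero_le_one,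
      integral_Ioc_eq_integral_Ioo, integral_Ioo_eq_integral_exp hc, laplaceT]
    simp_rw [exp_smul_beta hc]
    rfl
  have hfi : LaplaceIntegrable f := by
    have h := Complex.betaIntegral_convergent (hre 2 (by simp)) (v := (δ : ℂ)) (by simpa using hδ)
    rw [intervalIntegrable_iff_integrableOn_Ioo_of_le zero_le_one,
      integrableOn_Ioo_iff_exp hc] at h
    simp_rw [exp_smul_beta hc] at h
    exact h
  have hΓ : Complex.Gamma δ ≠ 0 := Complex.Gamma_ne_zero_of_re_pos (by simpa using hδ)
  have hL : IsLaplace fun z => Complex.betaIntegral ((z + u) / c) δ := ⟨f, hfi, hbeta⟩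
  refine (hL.const_mul (Complex.Gamma δ)⁻¹).congr fun z hz => ?_
  rw [Complex.betaIntegral_eq_Gamma_mul_div _ _ (hre z hz) (by simpa using hδ)]
  have e : (z + u) / c + δ = (z + v) / c := by
    simp only [δ]
    push_cast
    field_simp
    ring
  rw [e]
  field_simp

/-- A quotient of four Gamma functions. -/
noncomputable def gammaQuot (c u₁ u₂ v₁ v₂ : ℝ) (z : ℂ) : ℂ :=
  Complex.Gamma ((z + u₁) / c) * Complex.Gamma ((z + u₂) / c) /
    (Complex.Gamma ((z + v₁) / c) * Complex.Gamma ((z + v₂) / c))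

lemma gammaQuot_eq_mul_inv (c u₁ u₂ v₁ v₂ : ℝ) (z : ℂ) : gammaQuot c u₁ u₂ v₁ v₂ z =
    Complex.Gamma ((z + u₁) / c) * Complex.Gamma ((z + u₂) / c) *
      ((Complex.Gamma ((z + v₁) / c))⁻¹ * (Complex.Gamma ((z + v₂) / c))⁻¹) := by
  rw [gammaQuot, div_eq_mul_inv, mul_inv]

lemma gammaQuot_swap (c u₁ u₂ v₁ v₂ : ℝ) : gammaQuot c u₁ u₂ v₁ v₂ = gammaQuot c u₂ u₁ v₂ v₁ := by
  ext z
  simp only [gammaQuot]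
  ring

lemma Gamma_div_ne_zero {c u : ℝ} (hc : 0 < c) (hu : -2 < u) {z : ℂ} (hz : 2 ≤ z.re) :
    Complex.Gamma ((z + u) / c) ≠ 0 := by
  refine Complex.Gamma_ne_zero_of_re_pos ?_
  rw [Complex.div_ofReal_re]
  apply div_pos _ hc
  simp
  linarith

lemma Gamma_div_shift {c u : ℝ} (hc : 0 < c) {z : ℂ} (hz : z + u ≠ 0) :
    Complex.Gamma ((z + (u + c : ℝ)) / c) = (z + u) / c * Complex.Gamma ((z + u) / c) := by
  have hc0 : (c : ℂ) ≠ 0 := by exact_mod_cast hc.ne'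
  rw [← Complex.Gamma_add_one _ (div_ne_zero hz hc0)]
  congr 1
  push_cast
  field_simp
  ring

/-- The reciprocal of Gamma is entire, so this form of the functional equation needs no condition at
the poles. That matters for the denominators, whose arguments may have nonpositive real part. -/
lemma inv_Gamma_div_shift {c : ℝ} (hc : 0 < c) (u : ℝ) (z : ℂ) :
    (Complex.Gamma ((z + u) / c))⁻¹ = (z + u) / c * (Complex.Gamma ((z + (u + c : ℝ)) / c))⁻¹ := by
  have hc0 : (c : ℂ) ≠ 0 := by exact_mod_cast hc.ne'
  have := Complex.one_div_Gamma_eq_self_mul_one_div_Gamma_add_one ((z + u) / c)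
  rw [this]
  congr 3
  push_cast
  field_simp
  ring

/-- If each `vᵢ` exceeds `uᵢ`, the quotient is a product of two beta quotients; when `v₁ = u₁` one
pair cancels. Otherwise raising `v₂` by `c` and lowering `v₁` by `c` changes the quotient by the
factor `(z+v₂)/(z+v₁-c)`, which preserves Laplace transforms. The number `N` bounds how often this
is needed. -/
lemma isLaplace_gammaQuot_aux {c u₁ u₂ : ℝ} (hc : 0 < c) (h₁ : -2 < u₁) (h₂ : -2 < u₂) (N : ℕ) :
    ∀ v₁ v₂ : ℝ, v₁ + v₂ = u₁ + u₂ + c → v₂ ≤ u₂ + c → u₂ - N * c < v₂ →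
      IsLaplace (gammaQuot c u₁ u₂ v₁ v₂) := by
  induction N with
  | zero =>
    intro v₁ v₂ hs hle hlt
    simp only [Nat.cast_zero, zero_mul, sub_zero] at hlt
    rcases eq_or_lt_of_le hle with h | h
    · have hv : v₁ = u₁ := by linarith
      refine (isLaplace_gamma_div hc h₂ hlt).congr fun z hz => ?_
      have := Gamma_div_ne_zero hc h₁ hz
      rw [gammaQuot, hv, mul_div_mul_left _ _ this]
    · refine ((isLaplace_gamma_div hc h₁ (v := v₁) (by linarith)).mul
        (isLaplace_gamma_div hc h₂ hlt)).congr fun z hz => ?_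
      rw [gammaQuot, mul_div_mul_comm]
  | succ N ih =>
    intro v₁ v₂ hs hle hlt
    by_cases hv : u₂ < v₂
    · exact ih v₁ v₂ hs hle (by have : 0 ≤ (N : ℝ) * c := by positivity
                                linarith)
    · push Not at hv
      push_cast at hlt
      have hd : -2 < v₁ - c := by linarith
      refine ((ih (v₁ - c) (v₂ + c) (by linarith) (by linarith) (by linarith)).linear_div v₂
        hd).congr fun z hz => ?_
      have hc0 : (c : ℂ) ≠ 0 := by exact_mod_cast hc.ne'
      have hne := ne_zero_of_two_le_re hz hd
      have e1 := Gamma_div_shift hc hne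
      rw [sub_add_cancel] at e1
      have e2 := inv_Gamma_div_shift hc v₂ z
      have e3 := Gamma_div_ne_zero hc hd hz
      rw [gammaQuot, gammaQuot, div_eq_mul_inv, mul_inv, e2, e1]
      field_simp

/-- Quotients of Gamma functions of total degree `-1` are Laplace transforms. -/
lemma isLaplace_gammaQuot {c u₁ u₂ v₁ v₂ : ℝ} (hc : 0 < c) (h₁ : -2 < u₁) (h₂ : -2 < u₂)
    (hs : v₁ + v₂ = u₁ + u₂ + c) : IsLaplace (gammaQuot c u₁ u₂ v₁ v₂) := by
  by_cases h : v₂ ≤ u₂ + c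
  · obtain ⟨N, hN⟩ := exists_nat_gt ((u₂ - v₂) / c)
    refine isLaplace_gammaQuot_aux hc h₁ h₂ N v₁ v₂ hs h ?_
    rw [div_lt_iff₀ hc] at hN
    linarith
  -- Here `v₂ > u₂ + c` forces `v₁ < u₁`, so the two pairs exchange roles.
  · rw [gammaQuot_swap]
    obtain ⟨N, hN⟩ := exists_nat_gt ((u₁ - v₁) / c)
    refine isLaplace_gammaQuot_aux hc h₂ h₁ N v₂ v₁ (by linarith) (by linarith) ?_
    rw [div_lt_iff₀ hc] at hN
    linarith

/-- The Gamma quotient for `φ`. -/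
noncomputable def gammaPhi (a b m : ℝ) : ℂ → ℂ := gammaQuot (2 * a) b (m + a - b) (2 * a - b) (m + a + b)

/-- The Gamma quotient for `ψ`. -/
noncomputable def gammaPsi (a b m : ℝ) : ℂ → ℂ :=
  gammaQuot (2 * a) (a + b) (m - b) (a - b) (m + 2 * a + b)

lemma isLaplace_gammaPhi {a b m : ℝ} (ha : 0 < a) (hb : -2 < b) (hm : -2 < m + a - b) :
    IsLaplace (gammaPhi a b m) :=
  isLaplace_gammaQuot (by linarith) hb hm (by ring)

lemma isLaplace_gammaPsi {a b m : ℝ} (ha : 0 < a) (hb : -2 < a + b) (hm : -2 < m - b) :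
    IsLaplace (gammaPsi a b m) :=
  isLaplace_gammaQuot (by linarith) hb hm (by ring)

lemma gammaPhi_eq_gammaPsi_add {a b m : ℝ} (ha : 0 < a) (hb : -2 < b) (hm : -2 < m + a + b) {z : ℂ}
    (hz : 2 ≤ z.re) :
    (z + b) * gammaPhi a b m z = (z + a + b + m) * gammaPsi a b m (z + a) := by
  have h2 : 0 < 2 * a := by linarith
  have ha0 : (a : ℂ) ≠ 0 := by exact_mod_cast ha.ne'
  have hb0 := ne_zero_of_two_le_re hz hb
  have hm0 := ne_zero_of_two_le_re hz hm
  have e1 := Gamma_div_shift h2 hb0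
  have e2 := Gamma_div_shift h2 hm0
  rw [gammaPhi, gammaPsi, gammaQuot, gammaQuot,
    show z + a + ((a + b : ℝ) : ℂ) = z + ((b + 2 * a : ℝ) : ℂ) by push_cast; ring,
    show z + a + ((m - b : ℝ) : ℂ) = z + ((m + a - b : ℝ) : ℂ) by push_cast; ring,
    show z + a + ((a - b : ℝ) : ℂ) = z + ((2 * a - b : ℝ) : ℂ) by push_cast; ring,
    show z + a + ((m + 2 * a + b : ℝ) : ℂ) = z + ((m + a + b + 2 * a : ℝ) : ℂ) by push_cast; ring,
    e1, e2, show z + a + b + m = z + ((m + a + b : ℝ) : ℂ) by push_cast; ring]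
  push_cast
  push_cast at hm0
  field_simp

lemma gammaPhi_add_eq_gammaPsi {a b m : ℝ} (ha : 0 < a) (hm : -2 < m - b) {z : ℂ}
    (hz : 2 ≤ z.re) :
    (z + a - b) * gammaPhi a b m (z + a) = (z - b + m) * gammaPsi a b m z := by
  have h2 : 0 < 2 * a := by linarith
  have ha0 : (a : ℂ) ≠ 0 := by exact_mod_cast ha.ne'
  have hm0 := ne_zero_of_two_le_re hz hm
  have e1 := Gamma_div_shift h2 hm0
  have e2 := inv_Gamma_div_shift h2 (a - b) z
  rw [gammaPhi, gammaPsi, gammaQuot_eq_mul_inv, gammaQuot_eq_mul_inv,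
    show z + a + ((b : ℝ) : ℂ) = z + ((a + b : ℝ) : ℂ) by push_cast; ring,
    show z + a + ((m + a - b : ℝ) : ℂ) = z + ((m - b + 2 * a : ℝ) : ℂ) by push_cast; ring,
    show z + a + ((2 * a - b : ℝ) : ℂ) = z + ((a - b + 2 * a : ℝ) : ℂ) by push_cast; ring,
    show z + a + ((m + a + b : ℝ) : ℂ) = z + ((m + 2 * a + b : ℝ) : ℂ) by push_cast; ring,
    e1, e2]
  push_cast
  ring

/-! ### Monotonicity of Gamma quotients -/

/-- In Euler's limit formula the powers of `n` and the factorials cancel, because both sides of the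
quotient have the same sum of arguments. -/
lemma gammaSeq_ratio {s δ c : ℝ} (hs : 0 < s) (hδ : 0 < δ) (hc : 0 < c) {n : ℕ} (hn : n ≠ 0) :
    Real.GammaSeq s n * Real.GammaSeq (s + δ + c) n /
        (Real.GammaSeq (s + δ) n * Real.GammaSeq (s + c) n) =
      ∏ j ∈ Finset.range (n + 1), ((s + δ + j) * (s + c + j)) / ((s + j) * (s + δ + c + j)) := by
  have hn0 : (0 : ℝ) < n := by exact_mod_cast Nat.pos_of_ne_zero hn
  have hp : ∀ t : ℝ, 0 < t → 0 < ∏ j ∈ Finset.range (n + 1), (t + j) := fun t ht =>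
    Finset.prod_pos fun j _ => by positivity
  have h1 := hp s hs
  have h2 := hp (s + δ) (by positivity)
  have h3 := hp (s + c) (by positivity)
  have h4 := hp (s + δ + c) (by positivity)
  rw [Finset.prod_div_distrib, Finset.prod_mul_distrib, Finset.prod_mul_distrib]
  simp only [Real.GammaSeq]
  rw [Real.rpow_add hn0, Real.rpow_add hn0, Real.rpow_add hn0]
  have r1 := Real.rpow_pos_of_pos hn0 s
  have r2 := Real.rpow_pos_of_pos hn0 δ
  have r3 := Real.rpow_pos_of_pos hn0 c
  have hf : (0 : ℝ) < n.factorial := by exact_mod_cast n.factorial_pos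
  field_simp

/-- Each factor is `1 + δc/(x(x+δ+c))`, visibly decreasing in `x > 0`. -/
lemma ratio_factor_lt {s t δ c : ℝ} (hs : 0 < s) (hst : s < t) (hδ : 0 < δ) (hc : 0 < c) :
    ((t + δ) * (t + c)) / (t * (t + δ + c)) < ((s + δ) * (s + c)) / (s * (s + δ + c)) := by
  have ht : 0 < t := hs.trans hst
  have e : ∀ x : ℝ, 0 < x → ((x + δ) * (x + c)) / (x * (x + δ + c)) =
      1 + δ * c / (x * (x + δ + c)) := fun x hx => by
    field_simp
    ring
  rw [e t ht, e s hs]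
  gcongr

/-- The Gamma quotient `Γ(s) Γ(s+δ+c) / (Γ(s+δ) Γ(s+c))`. -/
noncomputable def gammaRatio (δ c s : ℝ) : ℝ :=
  Real.Gamma s * Real.Gamma (s + δ + c) / (Real.Gamma (s + δ) * Real.Gamma (s + c))

lemma gammaRatio_pos {s δ c : ℝ} (hs : 0 < s) (hδ : 0 < δ) (hc : 0 < c) : 0 < gammaRatio δ c s := by
  have h1 := Real.Gamma_pos_of_pos hs
  have h2 := Real.Gamma_pos_of_pos (show 0 < s + δ by positivity)
  have h3 := Real.Gamma_pos_of_pos (show 0 < s + c by positivity)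
  have h4 := Real.Gamma_pos_of_pos (show 0 < s + δ + c by positivity)
  unfold gammaRatio
  positivity

lemma gammaRatio_anti {s t δ c : ℝ} (hs : 0 < s) (hst : s < t) (hδ : 0 < δ) (hc : 0 < c) :
    gammaRatio δ c t ≤ gammaRatio δ c s := by
  have hlim : ∀ x : ℝ, 0 < x → Tendsto (fun n => Real.GammaSeq x n * Real.GammaSeq (x + δ + c) n /
      (Real.GammaSeq (x + δ) n * Real.GammaSeq (x + c) n)) atTop (𝓝 (gammaRatio δ c x)) := by
    intro x hx
    refine ((Real.GammaSeq_tendsto_Gamma _).mul (Real.GammaSeq_tendsto_Gamma _)).div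
      ((Real.GammaSeq_tendsto_Gamma _).mul (Real.GammaSeq_tendsto_Gamma _)) ?_
    exact mul_ne_zero (Real.Gamma_pos_of_pos (by positivity)).ne'
      (Real.Gamma_pos_of_pos (by positivity)).ne'
  refine le_of_tendsto_of_tendsto (hlim t (hs.trans hst)) (hlim s hs) ?_
  filter_upwards [eventually_ne_atTop 0] with n hn
  have ht : 0 < t := hs.trans hst
  rw [gammaSeq_ratio hs hδ hc hn, gammaSeq_ratio ht hδ hc hn]
  refine Finset.prod_le_prod (fun j _ => by positivity) fun j _ => ?_
  have hj : (0 : ℝ) ≤ j := Nat.cast_nonneg j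
  have := (ratio_factor_lt (s := s + j) (t := t + j) (by positivity) (by linarith) hδ hc).le
  rw [show t + δ + j = t + j + δ by ring, show t + c + j = t + j + c by ring,
    show t + δ + c + j = t + j + δ + c by ring, show s + δ + j = s + j + δ by ring,
    show s + c + j = s + j + c by ring, show s + δ + c + j = s + j + δ + c by ring]
  exact this

lemma gammaRatio_eq {s δ c : ℝ} (hs : 0 < s) (hδ : 0 < δ) (hc : 0 < c) :
    gammaRatio δ c s = ((s + δ) * (s + c)) / (s * (s + δ + c)) * gammaRatio δ c (s + 1) := by
  have h1 := Real.Gamma_pos_of_pos hs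
  have h2 := Real.Gamma_pos_of_pos (show 0 < s + δ by positivity)
  have h3 := Real.Gamma_pos_of_pos (show 0 < s + c by positivity)
  have h4 := Real.Gamma_pos_of_pos (show 0 < s + δ + c by positivity)
  simp only [gammaRatio]
  rw [show s + 1 + δ + c = s + δ + c + 1 by ring, show s + 1 + δ = s + δ + 1 by ring,
    show s + 1 + c = s + c + 1 by ring, Real.Gamma_add_one hs.ne',
    Real.Gamma_add_one (show s + δ ≠ 0 by positivity),
    Real.Gamma_add_one (show s + c ≠ 0 by positivity),
    Real.Gamma_add_one (show s + δ + c ≠ 0 by positivity)]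
  field_simp

/-- Passing to the limit in Euler's product loses strictness. Splitting off the first factor by the
functional equation restores it. -/
lemma gammaRatio_strictAnti {s t δ c : ℝ} (hs : 0 < s) (hst : s < t) (hδ : 0 < δ) (hc : 0 < c) :
    gammaRatio δ c t < gammaRatio δ c s := by
  have ht : 0 < t := hs.trans hst
  rw [gammaRatio_eq hs hδ hc, gammaRatio_eq ht hδ hc]
  have h1 := ratio_factor_lt hs hst hδ hc
  have h2 := gammaRatio_anti (s := s + 1) (t := t + 1) (by positivity) (by linarith) hδ hc
  have h3 := gammaRatio_pos (s := t + 1) (by positivity) hδ hc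
  have h4 : 0 < ((s + δ) * (s + c)) / (s * (s + δ + c)) := by positivity
  calc _ < ((s + δ) * (s + c)) / (s * (s + δ + c)) * gammaRatio δ c (t + 1) :=
        mul_lt_mul_of_pos_right h1 h3
    _ ≤ _ := mul_le_mul_of_nonneg_left h2 h4.le

/-! ### The weights and the Mellin transforms -/

/-- Conjugation exchanges the monomials of index `n` and `-n`, which reduces everything to `k₁ ≥ 0`.
-/
lemma scWeight_neg (k₁ k₂ : ℤ) (m : ℝ) (φ ψ : ℝ → ℂ) (n : ℤ) :
    scWeight (-k₁) (-k₂) m φ ψ (-n) = scWeight k₁ k₂ m φ ψ n := by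
  have h1 : (-n + (-k₁ + -k₂)).natAbs = (n + (k₁ + k₂)).natAbs := by
    rw [← Int.natAbs_neg]; congr 1; ring
  have h2 : (-n + -k₂).natAbs = (n + k₂).natAbs := by
    rw [← Int.natAbs_neg]; congr 1; ring
  simp only [scWeight, h1, h2, Int.natAbs_neg]

lemma scWeight_eq_zero_iff {k₁ k₂ : ℤ} {m : ℝ} (hm : -1 ≤ m) (φ ψ : ℝ → ℂ) (n : ℤ) :
    scWeight k₁ k₂ m φ ψ n = 0 ↔
      2 * (((n + k₂).natAbs : ℂ) + 1) * mellinT φ ((n.natAbs + (n + k₂).natAbs : ℕ) + 2) =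
        (((n + k₂).natAbs : ℂ) + ((n + (k₁ + k₂)).natAbs : ℂ) + 2 + m) *
          mellinT ψ ((n.natAbs + (n + (k₁ + k₂)).natAbs : ℕ) + 2) := by
  have h1 : (2 : ℂ) * (((n + (k₁ + k₂)).natAbs : ℂ) + 1) ≠ 0 :=
    mul_ne_zero two_ne_zero (by exact_mod_cast Nat.succ_ne_zero (n + (k₁ + k₂)).natAbs)
  have h2 : (((n + k₂).natAbs : ℂ) + ((n + (k₁ + k₂)).natAbs : ℂ) + 2 + m) ≠ 0 := by
    have h : (0 : ℝ) < ((n + k₂).natAbs : ℝ) + ((n + (k₁ + k₂)).natAbs : ℝ) + 2 + m := by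
      have a1 : (0 : ℝ) ≤ ((n + k₂).natAbs : ℝ) := Nat.cast_nonneg _
      have a2 : (0 : ℝ) ≤ ((n + (k₁ + k₂)).natAbs : ℝ) := Nat.cast_nonneg _
      linarith
    exact_mod_cast h.ne'
  rw [scWeight, mul_eq_zero, or_iff_right h1, sub_eq_zero, div_mul_eq_mul_div, div_eq_iff h2,
    mul_comm (mellinT ψ _)]

/-- The two functional equations satisfied by the Mellin transforms of `φ` and `ψ`. -/
def MellinRel (a b m : ℝ) (A B : ℂ → ℂ) (z : ℂ) : Prop :=
  (z + b) * A z = (z + a + b + m) * B (z + a) ∧ (z + a - b) * A (z + a) = (z - b + m) * B z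

lemma natAbs_cast_of_nonneg {n : ℤ} (h : 0 ≤ n) : (n.natAbs : ℂ) = n := by
  obtain ⟨k, rfl⟩ := Int.eq_ofNat_of_zero_le h
  simp

lemma natAbs_cast_of_nonpos {n : ℤ} (h : n ≤ 0) : (n.natAbs : ℂ) = -n := by
  rw [← Int.natAbs_neg, natAbs_cast_of_nonneg (by omega)]
  simp

/-- Without the absolute values, the vanishing of the weight is the first relation of `MellinRel` at
`z = 2n + k₂ + 2`. -/
lemma scWeight_eq_zero_iff_of_nonneg {k₁ k₂ : ℤ} {m : ℝ} (hm : -1 ≤ m) (φ ψ : ℝ → ℂ) {n : ℤ}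
    (h0 : 0 ≤ n) (h2 : 0 ≤ n + k₂) (h3 : 0 ≤ n + (k₁ + k₂)) :
    scWeight k₁ k₂ m φ ψ n = 0 ↔
      ((2 * n + k₂ + 2 : ℂ) + k₂) * mellinT φ (2 * n + k₂ + 2) =
        ((2 * n + k₂ + 2 : ℂ) + k₁ + k₂ + m) * mellinT ψ (2 * n + k₂ + 2 + k₁) := by
  rw [scWeight_eq_zero_iff hm]
  push_cast [-Int.natCast_natAbs]
  rw [natAbs_cast_of_nonneg h0, natAbs_cast_of_nonneg h2, natAbs_cast_of_nonneg h3]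
  push_cast
  rw [show (n : ℂ) + (n + k₂) + 2 = 2 * n + k₂ + 2 by ring,
    show (n : ℂ) + (n + (k₁ + k₂)) + 2 = 2 * n + k₂ + 2 + k₁ by ring,
    show 2 * ((n : ℂ) + k₂ + 1) = 2 * n + k₂ + 2 + k₂ by ring,
    show (n : ℂ) + k₂ + (n + (k₁ + k₂)) + 2 + m = 2 * n + k₂ + 2 + k₁ + k₂ + m by ring]

/-- By conjugation symmetry the case of nonpositive indices reduces to the previous one, and gives
the second relation of `MellinRel` at `z = 2l - k₁ - k₂ + 2`. -/
lemma scWeight_eq_zero_iff_of_nonpos {k₁ k₂ : ℤ} {m : ℝ} (hm : -1 ≤ m) (φ ψ : ℝ → ℂ) {l : ℤ}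
    (h0 : 0 ≤ l) (h2 : 0 ≤ l - k₂) (h3 : 0 ≤ l - (k₁ + k₂)) :
    scWeight k₁ k₂ m φ ψ (-l) = 0 ↔
      ((2 * l - k₁ - k₂ + 2 : ℂ) + k₁ - k₂) * mellinT φ (2 * l - k₁ - k₂ + 2 + k₁) =
        ((2 * l - k₁ - k₂ + 2 : ℂ) - k₂ + m) * mellinT ψ (2 * l - k₁ - k₂ + 2) := by
  have e := scWeight_neg k₁ k₂ m φ ψ (-l)
  rw [neg_neg] at e
  rw [← e, scWeight_eq_zero_iff_of_nonneg hm φ ψ h0 (by omega) (by omega)]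
  push_cast
  rw [show (2 * l + -k₂ + 2 : ℂ) + -k₂ = 2 * l - k₁ - k₂ + 2 + k₁ - k₂ by ring,
    show (2 * l + -k₂ + 2 : ℂ) + -k₁ + -k₂ + m = 2 * l - k₁ - k₂ + 2 - k₂ + m by ring,
    show (2 * l + -k₂ + 2 : ℂ) + -k₁ = 2 * l - k₁ - k₂ + 2 by ring,
    show (2 * l + -k₂ + 2 : ℂ) = 2 * l - k₁ - k₂ + 2 + k₁ by ring]

/-- Linear relations between Laplace transforms propagate. -/
lemma IsLaplace.linear_rel {G H : ℂ → ℂ} (hG : IsLaplace G) (hH : IsLaplace H) (p q : ℂ) {z₀ : ℂ}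
    (hz₀ : 2 ≤ z₀.re) {α : ℝ} (hα : 0 < α)
    (h : ∀ j : ℕ, (z₀ + α * j + p) * G (z₀ + α * j) = (z₀ + α * j + q) * H (z₀ + α * j)) :
    ∀ z : ℂ, 2 ≤ z.re → (z + p) * G z = (z + q) * H z := by
  have h0 : (-2 : ℝ) < 0 := by norm_num
  -- Dividing the relation by `z` makes both sides Laplace transforms, so the identity principle
  -- applies.
  have := (hG.linear_div p h0).eq_of_eq_arith (hH.linear_div q h0) hz₀ hα (fun j => by
    rw [div_mul_eq_mul_div, div_mul_eq_mul_div, h])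
  intro z hz
  have h1 := this z hz
  have h2 := ne_zero_of_two_le_re hz h0
  rw [div_mul_eq_mul_div, div_mul_eq_mul_div, div_left_inj' h2] at h1
  exact h1

/-- The weights vanishing near `+∞` give the first relation on a progression of step `2`, those near
`-∞` the second; both then extend to the half-plane. -/
lemma mellinRel_of_finite {k₁ k₂ : ℤ} (hk : 0 ≤ k₁) {m : ℝ} (hm : -1 ≤ m) {φ ψ : ℝ → ℂ}
    (hφ : IsLaplace (mellinT φ)) (hψ : IsLaplace (mellinT ψ))
    (hf : {n | scWeight k₁ k₂ m φ ψ n ≠ 0}.Finite) :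
    ∀ z : ℂ, 2 ≤ z.re → MellinRel k₁ k₂ m (mellinT φ) (mellinT ψ) z := by
  obtain ⟨U, hU⟩ := hf.bddAbove
  obtain ⟨L, hL⟩ := hf.bddBelow
  have hzero : ∀ n, (U < n ∨ n < L) → scWeight k₁ k₂ m φ ψ n = 0 := by
    intro n hn
    by_contra h
    have h1 : n ≤ U := hU h
    have h2 : L ≤ n := hL h
    omega
  -- Large enough to lie beyond the support, to make all three indices nonnegative, and to start
  -- both progressions in `Re z ≥ 2`.
  set n₀ : ℤ := |U| + |L| + |k₁| + |k₂| + 1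
  have hU' := le_abs_self U
  have hL' := neg_abs_le L
  have h1 := neg_abs_le k₁
  have h1' := le_abs_self k₁
  have h2 := neg_abs_le k₂
  have h2' := le_abs_self k₂
  have hUn := abs_nonneg U
  have hLn := abs_nonneg L
  have hk0 : (0 : ℝ) ≤ k₁ := by exact_mod_cast hk
  have E1 := hφ.linear_rel (hψ.comp_add hk0) k₂ (k₁ + k₂ + m) (z₀ := 2 * n₀ + k₂ + 2) (by
      have : (2 : ℝ) ≤ ((2 * n₀ + k₂ + 2 : ℤ) : ℝ) := by
        have : (2 : ℤ) ≤ 2 * n₀ + k₂ + 2 := by omega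
        exact_mod_cast this
      simpa using this) two_pos (fun j => by
    have := (scWeight_eq_zero_iff_of_nonneg hm φ ψ (n := n₀ + j) (k₁ := k₁) (k₂ := k₂)
      (by omega) (by omega) (by omega)).1 (hzero _ (Or.inl (by omega)))
    push_cast at this ⊢
    rw [show (2 * ((n₀ : ℂ) + j) + k₂ + 2) = 2 * n₀ + k₂ + 2 + 2 * j by ring] at this
    linear_combination this)
  have E2 := (hφ.comp_add hk0).linear_rel hψ (k₁ - k₂) (-k₂ + m) (z₀ := 2 * n₀ - k₁ - k₂ + 2) (by
      have : (2 : ℝ) ≤ ((2 * n₀ - k₁ - k₂ + 2 : ℤ) : ℝ) := by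
        have : (2 : ℤ) ≤ 2 * n₀ - k₁ - k₂ + 2 := by omega
        exact_mod_cast this
      simpa using this) two_pos (fun j => by
    have := (scWeight_eq_zero_iff_of_nonpos hm φ ψ (l := n₀ + j) (k₁ := k₁) (k₂ := k₂)
      (by omega) (by omega) (by omega)).1 (hzero _ (Or.inr (by omega)))
    push_cast at this ⊢
    rw [show (2 * ((n₀ : ℂ) + j) - k₁ - k₂ + 2) = 2 * n₀ - k₁ - k₂ + 2 + 2 * j by ring] at this
    linear_combination this)
  intro z hz
  have e1 := E1 z hz
  have e2 := E2 z hz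
  constructor
  · push_cast at e1 ⊢
    linear_combination e1
  · push_cast at e2 ⊢
    linear_combination e2

/-- Eliminate `B (z + a)` between the first relation at `z` and the second at `z + a`. -/
lemma MellinRel.recursion {a b m : ℝ} {A B : ℂ → ℂ} (ha : 0 ≤ a)
    (h : ∀ z : ℂ, 2 ≤ z.re → MellinRel a b m A B z) {z : ℂ} (hz : 2 ≤ z.re) :
    (z + 2 * a - b) * (z + a + b + m) * A (z + 2 * a) = (z + b) * (z + a - b + m) * A z := by
  have h1 := (h z hz).1
  have h2 := (h (z + a) (by simp; linarith)).2
  rw [show z + a + a = z + 2 * a by ring] at h2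
  linear_combination (z + a + b + m) * h2 - (z + a - b + m) * h1

/-- Solutions of the functional equations are unique up to a constant. -/
lemma MellinRel.exists_eq_const_mul {a b m : ℝ} (ha : 0 < a) {A B F G : ℂ → ℂ} (hA : IsLaplace A)
    (hB : IsLaplace B) (hF : IsLaplace F) (hG : IsLaplace G)
    (hAB : ∀ z : ℂ, 2 ≤ z.re → MellinRel a b m A B z)
    (hFG : ∀ z : ℂ, 2 ≤ z.re → MellinRel a b m F G z) {x : ℝ} (hx : 2 ≤ x) (hxb : b < x)
    (hxm : 0 < x + a + b + m) (hFx : F x ≠ 0) :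
    ∃ C : ℂ, ∀ z : ℂ, 2 ≤ z.re → A z = C * F z ∧ B z = C * G z := by
  have h2a : 0 < 2 * a := by linarith
  refine ⟨A x / F x, ?_⟩
  -- The conditions on `x` keep the leading coefficient of the recursion nonzero along `x, x+2a, …`,
  -- so the value at `x` determines all later ones.
  have hj : ∀ j : ℕ, A (x + (2 * a : ℝ) * j) = A x / F x * F (x + (2 * a : ℝ) * j) := by
    intro j
    induction j with
    | zero => simp [hFx]
    | succ j ih =>
      set z : ℂ := x + (2 * a : ℝ) * j with hz
      have hzr : z = ((x + 2 * a * j : ℝ) : ℂ) := by rw [hz]; push_cast; ring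
      have hj0 : 0 ≤ 2 * a * j := by positivity
      have hz2 : 2 ≤ z.re := by rw [hzr, Complex.ofReal_re]; linarith
      have e : (x : ℂ) + (2 * a : ℝ) * ((j + 1 : ℕ) : ℂ) = z + 2 * a := by
        rw [hz]; push_cast; ring
      have r1 := MellinRel.recursion ha.le hAB hz2
      have r2 := MellinRel.recursion ha.le hFG hz2
      have n1 : (z + 2 * a - b) ≠ 0 := by
        rw [hzr]
        have : x + 2 * a * j + 2 * a - b ≠ 0 := by linarith
        exact_mod_cast this
      have n2 : (z + a + b + m) ≠ 0 := by
        rw [hzr]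
        have : x + 2 * a * j + a + b + m ≠ 0 := by linarith
        exact_mod_cast this
      rw [e]
      apply mul_left_cancel₀ (mul_ne_zero n1 n2)
      rw [r1, ih]
      linear_combination (-(A x / F x)) * r2
  have hAF := hA.eq_of_eq_arith (hF.const_mul (A x / F x)) (z₀ := x) (by simpa using hx) h2a hj
  -- Once `A` is known, the first relation recovers `B` at the points `x + a + j`.
  have hBG := hB.eq_of_eq_arith (hG.const_mul (A x / F x)) (z₀ := (x + a : ℝ))
    (by rw [Complex.ofReal_re]; linarith) one_pos (fun j => by
      set z : ℂ := ((x + j : ℝ) : ℂ) with hz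
      have hj0 : (0 : ℝ) ≤ j := Nat.cast_nonneg j
      have hz2 : 2 ≤ z.re := by rw [hz, Complex.ofReal_re]; linarith
      have e : ((x + a : ℝ) : ℂ) + ((1 : ℝ) : ℂ) * (j : ℂ) = z + a := by
        rw [hz]; push_cast; ring
      have n2 : (z + a + b + m) ≠ 0 := by
        rw [hz]
        have : x + j + a + b + m ≠ 0 := by linarith
        exact_mod_cast this
      have r1 := (hAB z hz2).1
      have r2 := (hFG z hz2).1
      have r3 := hAF z hz2
      rw [e]
      apply mul_left_cancel₀ n2
      rw [← r1, r3]
      linear_combination (A x / F x) * r2)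
  exact fun z hz => ⟨hAF z hz, hBG z hz⟩

lemma isLaplace_zero : IsLaplace fun _ => 0 :=
  ((isLaplace_one_div (d := 0) (by norm_num)).const_mul 0).congr fun z _ => by simp

lemma radialEq_zero_of_arith {φ : ℝ → ℂ}
    (hφ : IntegrableOn (fun r : ℝ => (r : ℂ) * φ r) (Ioo 0 1)) {x : ℝ} (hx : 2 ≤ x) {α : ℝ}
    (hα : 0 < α) (h : ∀ j : ℕ, mellinT φ (x + α * j) = 0) : RadialEq φ fun _ => 0 := by
  have h0 := (isLaplace_mellinT hφ).eq_of_eq_arith isLaplace_zero (z₀ := x) (by simpa using hx) hα h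
  refine radialEq_of_mellinT_eq hφ (by simp) fun z hz => ?_
  rw [h0 z hz]
  simp [mellinT]

/-! ### Mellin transforms of elementary functions -/

lemma mellinT_const_mul_rpow (C : ℂ) {m : ℝ} {z : ℂ} (hz : 0 < z.re + m) :
    mellinT (fun r => C * ((r ^ m : ℝ) : ℂ)) z = C * (1 / (z + m)) := by
  rw [← mellinT_rpow hz, mellinT, mellinT, ← integral_const_mul]
  simp_rw [mul_assoc]

lemma integrableOn_mul_const_mul_rpow (C : ℂ) {m : ℝ} (hm : -1 ≤ m) :
    IntegrableOn (fun r : ℝ => (r : ℂ) * (C * ((r ^ m : ℝ) : ℂ))) (Ioo 0 1) := by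
  refine ((integrableOn_mul_rpow hm).const_mul C).congr (ae_of_all _ fun r => ?_)
  ring

lemma radialEq_const_mul_rpow {φ : ℝ → ℂ}
    (hφ : IntegrableOn (fun r : ℝ => (r : ℂ) * φ r) (Ioo 0 1)) (C : ℂ) {m : ℝ} (hm : -1 ≤ m)
    (h : ∀ z : ℂ, 2 ≤ z.re → mellinT φ z = C * (1 / (z + m))) :
    RadialEq φ fun r => C * ((r ^ m : ℝ) : ℂ) :=
  radialEq_of_mellinT_eq hφ (integrableOn_mul_const_mul_rpow C hm) fun z hz => by
    rw [h z hz, mellinT_const_mul_rpow C (by linarith)]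

lemma radialEq_iff_mellinT_rpow {φ : ℝ → ℂ}
    (hφ : IntegrableOn (fun r : ℝ => (r : ℂ) * φ r) (Ioo 0 1)) (C : ℂ) {m : ℝ} (hm : -1 ≤ m)
    {f : ℝ → ℂ} (hf : ∀ r ∈ Ioo (0 : ℝ) 1, f r = C * ((r ^ m : ℝ) : ℂ)) :
    RadialEq φ f ↔ ∀ z : ℂ, 2 ≤ z.re → mellinT φ z = C * (1 / (z + m)) := by
  have hfe : RadialEq f fun r => C * ((r ^ m : ℝ) : ℂ) := by
    filter_upwards [ae_restrict_mem measurableSet_Ioo] with r hr using hf r hr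
  constructor
  · intro h z hz
    rw [mellinT_congr h, mellinT_congr hfe, mellinT_const_mul_rpow C (by linarith)]
  · intro h
    filter_upwards [radialEq_const_mul_rpow hφ C hm h, hfe] with r h1 h2
    rw [h1, h2]

lemma mellinT_cond4 (C : ℂ) (m : ℝ) {z : ℂ} (hz : 2 ≤ z.re) :
    mellinT (fun r => C * (((m + 1) / 2 * r⁻¹ - (m - 1) / 2 * r : ℝ) : ℂ)) z =
      C * ((z + m) / ((z - 1) * (z + 1))) := by
  set f : ℝ → ℂ := fun r => C * ((m : ℂ) + 1) / 2 * ((r ^ (-1 : ℝ) : ℝ) : ℂ)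
  set g : ℝ → ℂ := fun r => C * ((m : ℂ) - 1) / 2 * ((r ^ (1 : ℝ) : ℝ) : ℂ)
  have hf : LaplaceIntegrable fun x => f (Real.exp (-x)) :=
    laplaceIntegrable_comp_exp (integrableOn_mul_const_mul_rpow _ le_rfl)
  have hg : LaplaceIntegrable fun x => g (Real.exp (-x)) :=
    laplaceIntegrable_comp_exp (integrableOn_mul_const_mul_rpow _ (by norm_num))
  have hfg : (fun r : ℝ => C * (((m + 1) / 2 * r⁻¹ - (m - 1) / 2 * r : ℝ) : ℂ)) =
      fun r => f r - g r := by
    ext r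
    simp only [f, g, Real.rpow_neg_one, Real.rpow_one]
    push_cast
    ring
  have n1 := ne_zero_of_two_le_re hz (show (-2 : ℝ) < -1 by norm_num)
  have n2 := ne_zero_of_two_le_re hz (show (-2 : ℝ) < 1 by norm_num)
  rw [hfg, mellinT_eq_laplaceT, laplaceT_sub hf hg hz, ← mellinT_eq_laplaceT f,
    ← mellinT_eq_laplaceT g, mellinT_const_mul_rpow _ (by linarith),
    mellinT_const_mul_rpow _ (by linarith)]
  push_cast at n1 n2 ⊢
  rw [← sub_eq_add_neg] at n1 ⊢
  field_simp
  ring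

lemma integrableOn_cond4 (C : ℂ) (m : ℝ) :
    IntegrableOn (fun r : ℝ => (r : ℂ) *
      (C * (((m + 1) / 2 * r⁻¹ - (m - 1) / 2 * r : ℝ) : ℂ))) (Ioo 0 1) := by
  refine ((integrableOn_mul_const_mul_rpow (C * ((m : ℂ) + 1) / 2) (le_refl (-1 : ℝ))).sub
    (integrableOn_mul_const_mul_rpow (C * ((m : ℂ) - 1) / 2) (show (-1 : ℝ) ≤ 1 by norm_num))).congr
    (ae_of_all _ fun r => ?_)
  simp only [Pi.sub_apply, Real.rpow_neg_one, Real.rpow_one]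
  push_cast
  ring

/-- With `r = e^{-x}` and `t = e^{-y}`, the integral in condition 3 is a half-line convolution with
`e^{-mx}`. -/
lemma integral_div_rpow_eq (φ : ℝ → ℂ) (m : ℝ) {x : ℝ} (hx : 0 < x) :
    ((Real.exp (-x) ^ m : ℝ) : ℂ) * ∫ t in Real.exp (-x)..1, φ t / ((t ^ (m + 1) : ℝ) : ℂ) =
      halfConv (fun x => φ (Real.exp (-x))) (fun x : ℝ => Complex.exp (-((m : ℂ) * x))) x := by
  have himg : (fun y : ℝ => Real.exp (-(1 * y))) '' Ioo 0 x = Ioo (Real.exp (-x)) 1 := by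
    ext r
    constructor
    · rintro ⟨y, ⟨hy0, hyx⟩, rfl⟩
      exact ⟨Real.exp_lt_exp.2 (by linarith), by simpa using hy0⟩
    · rintro ⟨h0, h1⟩
      have hr := (Real.exp_pos _).trans h0
      refine ⟨-Real.log r, ⟨neg_pos.2 (Real.log_neg hr h1), ?_⟩, by simp [Real.exp_log hr]⟩
      have := Real.log_lt_log (Real.exp_pos _) h0
      rw [Real.log_exp] at this
      linarith
  have hle : Real.exp (-x) ≤ 1 := by simpa using hx.le
  rw [intervalIntegral.integral_of_le hle, integral_Ioc_eq_integral_Ioo, ← himg,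
    integral_image_eq_integral_abs_deriv_smul measurableSet_Ioo
    (fun x _ => (hasDerivAt_exp_neg_mul 1 x).hasDerivWithinAt) (injOn_exp_neg_mul one_pos _),
    halfConv, intervalIntegral.integral_of_le hx.le, integral_Ioc_eq_integral_Ioo,
    ← integral_const_mul]
  refine setIntegral_congr_fun measurableSet_Ioo fun y _ => ?_
  rw [abs_deriv_exp_neg_mul one_pos, Complex.real_smul]
  simp only [one_mul, ← Real.exp_mul]
  push_cast
  have : Complex.exp (-((m : ℂ) * (x - y))) =
      Complex.exp (-x * m) * (Complex.exp (-y) / Complex.exp (-y * (m + 1))) := by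
    rw [← Complex.exp_sub, ← Complex.exp_add]
    congr 1
    ring
  rw [this]
  ring

/-- The transform of `e^{-mx}` is `1/(z+m)`, so the right-hand side of condition 3 has transform `(1
- m/(z+m))` times that of `φ`, that is `z/(z+m)` times it. Uniqueness gives the converse. -/
lemma radialEq_cond3_iff {φ ψ : ℝ → ℂ} {m : ℝ} (hm : -1 ≤ m)
    (hφ : IntegrableOn (fun r : ℝ => (r : ℂ) * φ r) (Ioo 0 1))
    (hψ : IntegrableOn (fun r : ℝ => (r : ℂ) * ψ r) (Ioo 0 1)) :
    RadialEq ψ (fun r => φ r -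
      (m : ℂ) * ((r ^ m : ℝ) : ℂ) * ∫ t in r..1, φ t / ((t ^ (m + 1) : ℝ) : ℂ)) ↔
    ∀ z : ℂ, 2 ≤ z.re → z * mellinT φ z = (z + m) * mellinT ψ z := by
  have hm2 : -2 < m := by linarith
  set Φ : ℝ → ℂ := fun x => φ (Real.exp (-x))
  have hΦ : LaplaceIntegrable Φ := laplaceIntegrable_comp_exp hφ
  set E : ℝ → ℂ := fun x : ℝ => Complex.exp (-((m : ℂ) * x))
  have hE : LaplaceIntegrable E := laplaceIntegrable_exp hm2
  have hc := hΦ.halfConv hE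
  set g : ℝ → ℂ := fun x => Φ x - m * halfConv Φ E x
  have hg : LaplaceIntegrable g := hΦ.sub (hc.const_mul m)
  have hgz : ∀ z : ℂ, 2 ≤ z.re → (z + m) * laplaceT g z = z * mellinT φ z := by
    intro z hz
    have hne := ne_zero_of_two_le_re hz hm2
    rw [laplaceT_sub hΦ (hc.const_mul m) hz, laplaceT_const_mul, laplaceT_halfConv hΦ hE hz,
      laplaceT_exp hm2 hz, mellinT_eq_laplaceT]
    field_simp
    ring
  have hpt : ∀ x : ℝ, 0 < x → φ (Real.exp (-x)) - (m : ℂ) * ((Real.exp (-x) ^ m : ℝ) : ℂ) *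
      ∫ t in Real.exp (-x)..1, φ t / ((t ^ (m + 1) : ℝ) : ℂ) = g x := by
    intro x hx
    rw [mul_assoc, integral_div_rpow_eq φ m hx]
  constructor
  · intro h z hz
    rw [mellinT_congr h, ← hgz z hz, mellinT_eq_laplaceT]
    congr 1
    refine setIntegral_congr_fun measurableSet_Ioi fun x hx => ?_
    simp only
    rw [hpt x hx]
  · intro h
    refine ae_Ioo_of_ae_exp (p := fun r => ψ r = φ r -
      (m : ℂ) * ((r ^ m : ℝ) : ℂ) * ∫ t in r..1, φ t / ((t ^ (m + 1) : ℝ) : ℂ)) ?_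
    filter_upwards [radialEq_of_laplaceT hψ hg (fun z hz => by
      apply mul_left_cancel₀ (ne_zero_of_two_le_re hz hm2)
      rw [hgz z hz, h z hz]), ae_restrict_mem measurableSet_Ioi] with x h1 h2
    rw [h1, hpt x h2]

/-! ### The explicit solutions of the functional equations -/

lemma gammaPhi_apply (a b m : ℝ) (z : ℂ) : gammaPhi a b m z =
    (Complex.Gamma ((z + b) / (2 * a)) * Complex.Gamma ((z + m + a - b) / (2 * a))) /
      (Complex.Gamma ((z + 2 * a - b) / (2 * a)) * Complex.Gamma ((z + m + a + b) / (2 * a))) := by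
  rw [gammaPhi, gammaQuot]
  push_cast
  simp only [add_assoc, add_sub_assoc]

lemma gammaPsi_apply (a b m : ℝ) (z : ℂ) : gammaPsi a b m z =
    (Complex.Gamma ((z + a + b) / (2 * a)) * Complex.Gamma ((z + m - b) / (2 * a))) /
      (Complex.Gamma ((z + a - b) / (2 * a)) * Complex.Gamma ((z + m + 2 * a + b) / (2 * a))) := by
  rw [gammaPsi, gammaQuot]
  push_cast
  simp only [add_assoc, add_sub_assoc]

lemma mellinRel_gamma {a b m : ℝ} (ha : 0 < a) (hb : -2 < b) (hm : -2 < m + a + b)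
    (hm' : -2 < m - b) (z : ℂ) (hz : 2 ≤ z.re) :
    MellinRel a b m (gammaPhi a b m) (gammaPsi a b m) z :=
  ⟨gammaPhi_eq_gammaPsi_add ha hb hm hz, gammaPhi_add_eq_gammaPsi ha hm' hz⟩

lemma Gamma_real_div {c u x : ℝ} :
    Complex.Gamma (((x : ℂ) + u) / c) = (Real.Gamma ((x + u) / c) : ℂ) := by
  rw [← Complex.Gamma_ofReal]
  push_cast
  rfl

lemma gammaQuot_ofReal (c u₁ u₂ v₁ v₂ x : ℝ) : gammaQuot c u₁ u₂ v₁ v₂ x =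
    ((Real.Gamma ((x + u₁) / c) * Real.Gamma ((x + u₂) / c) /
      (Real.Gamma ((x + v₁) / c) * Real.Gamma ((x + v₂) / c)) : ℝ) : ℂ) := by
  simp only [gammaQuot, Gamma_real_div]
  push_cast
  rfl

lemma gammaQuot_ne_zero {c u₁ u₂ v₁ v₂ x : ℝ} (hc : 0 < c) (h1 : 0 < x + u₁) (h2 : 0 < x + u₂)
    (h3 : 0 < x + v₁) (h4 : 0 < x + v₂) : gammaQuot c u₁ u₂ v₁ v₂ x ≠ 0 := by
  rw [gammaQuot_ofReal]
  have g1 := Real.Gamma_pos_of_pos (div_pos h1 hc)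
  have g2 := Real.Gamma_pos_of_pos (div_pos h2 hc)
  have g3 := Real.Gamma_pos_of_pos (div_pos h3 hc)
  have g4 := Real.Gamma_pos_of_pos (div_pos h4 hc)
  have : 0 < Real.Gamma ((x + u₁) / c) * Real.Gamma ((x + u₂) / c) /
    (Real.Gamma ((x + v₁) / c) * Real.Gamma ((x + v₂) / c)) := by positivity
  exact_mod_cast this.ne'

/-- The rational solution for `φ`. -/
noncomputable def ratPhi (a b : ℝ) (n : ℕ) (z : ℂ) : ℂ :=
  (∏ j ∈ Finset.range n, ((z - b) / (2 * a) + ((j : ℂ) + 1))) /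
    ∏ j ∈ Finset.range (n + 1), ((z + b) / (2 * a) + (j : ℂ))

/-- The rational solution for `ψ`. -/
noncomputable def ratPsi (a b : ℝ) (n : ℕ) (z : ℂ) : ℂ :=
  (∏ j ∈ Finset.range n, ((z + a - b) / (2 * a) + (j : ℂ))) /
    ∏ j ∈ Finset.range (n + 1), ((z + a + b) / (2 * a) + (j : ℂ))

lemma isLaplace_ratPhi {a b : ℝ} (ha : 0 < a) (hb : 0 < b) (n : ℕ) : IsLaplace (ratPhi a b n) := by
  have ha0 : (a : ℂ) ≠ 0 := by exact_mod_cast ha.ne'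
  induction n with
  | zero =>
    refine ((isLaplace_one_div (d := b) (by linarith)).const_mul (2 * a)).congr fun z hz => ?_
    have := ne_zero_of_two_le_re hz (show -2 < b by linarith)
    simp [ratPhi]
    field_simp
  | succ n ih =>
    have hd : -2 < b + 2 * a * (n + 1) := by
      have : 0 < b + 2 * a * (n + 1) := by positivity
      linarith
    refine (ih.linear_div (2 * a * (n + 1) - b) hd).congr fun z hz => ?_
    have h1 := ne_zero_of_two_le_re hz hd
    simp only [ratPhi]
    rw [Finset.prod_range_succ, Finset.prod_range_succ _ (n + 1), mul_div_mul_comm]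
    refine (mul_comm _ _).trans ?_
    congr 1
    push_cast at h1 ⊢
    have e : (z + b) / (2 * a) + ((n : ℂ) + 1) = (z + (b + 2 * a * (n + 1))) / (2 * a) := by
      field_simp
      ring
    rw [e]
    field_simp
    ring

lemma isLaplace_ratPsi {a b : ℝ} (ha : 0 < a) (hb : 0 < b) (n : ℕ) : IsLaplace (ratPsi a b n) := by
  have ha0 : (a : ℂ) ≠ 0 := by exact_mod_cast ha.ne'
  induction n with
  | zero =>
    refine ((isLaplace_one_div (d := a + b) (by linarith)).const_mul (2 * a)).congr fun z hz => ?_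
    have := ne_zero_of_two_le_re hz (show -2 < a + b by linarith)
    have e : z + ((a + b : ℝ) : ℂ) = z + a + b := by push_cast; ring
    rw [e] at this ⊢
    simp [ratPsi]
    field_simp
  | succ n ih =>
    have hd : -2 < a + b + 2 * a * (n + 1) := by
      have : 0 < a + b + 2 * a * (n + 1) := by positivity
      linarith
    refine (ih.linear_div (a - b + 2 * a * n) hd).congr fun z hz => ?_
    have h1 := ne_zero_of_two_le_re hz hd
    simp only [ratPsi]
    rw [Finset.prod_range_succ, Finset.prod_range_succ _ (n + 1), mul_div_mul_comm]
    refine (mul_comm _ _).trans ?_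
    congr 1
    push_cast at h1 ⊢
    have e : (z + a + b) / (2 * a) + ((n : ℂ) + 1) = (z + (a + b + 2 * a * (n + 1))) / (2 * a) := by
      field_simp
      ring
    rw [e]
    field_simp
    ring

lemma add_natCast_ne_zero {s : ℂ} (hs : 0 < s.re) (j : ℕ) : s + (j : ℂ) ≠ 0 := by
  intro h
  have := congrArg Complex.re h
  simp at this
  have hj : (0 : ℝ) ≤ j := Nat.cast_nonneg j
  linarith

lemma prod_add_natCast_ne_zero {s : ℂ} (hs : 0 < s.re) (n : ℕ) :
    ∏ j ∈ Finset.range n, (s + (j : ℂ)) ≠ 0 :=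
  Finset.prod_ne_zero_iff.2 fun j _ => add_natCast_ne_zero hs j

/-- Both sides are the product of the `n+1` consecutive factors `s, …, s+n`, with the first or the
last one split off. -/
lemma mul_prod_add_one (s : ℂ) (n : ℕ) :
    s * ∏ j ∈ Finset.range n, (s + ((j : ℂ) + 1)) = (s + n) * ∏ j ∈ Finset.range n, (s + (j : ℂ)) := by
  have h1 := Finset.prod_range_succ (fun j : ℕ => s + (j : ℂ)) n
  rw [Finset.prod_range_succ'] at h1
  push_cast at h1
  rw [add_zero] at h1
  linear_combination h1

lemma div_re_pos {z : ℂ} {c : ℝ} (hc : 0 < c) (hz : 0 < z.re) : 0 < (z / (2 * c)).re := by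
  have : (2 * c : ℂ) = ((2 * c : ℝ) : ℂ) := by push_cast; rfl
  rw [this, Complex.div_ofReal_re]
  positivity

/-- Here `m = (2n+1)a` makes the Gamma arguments differ by integers. In each relation the two
products are the same chain of factors shifted by one step, so only end factors remain. -/
lemma mellinRel_rat {a b m : ℝ} (ha : 0 < a) (hb : 0 < b) {n : ℕ} (hm : m = (2 * n + 1) * a) (z : ℂ)
    (hz : 2 ≤ z.re) : MellinRel a b m (ratPhi a b n) (ratPsi a b n) z := by
  have ha0 : (a : ℂ) ≠ 0 := by exact_mod_cast ha.ne'
  subst hm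
  constructor
  · have hs : 0 < ((z + b) / (2 * a)).re := div_re_pos ha (by simp; linarith)
    have hs1 : 0 < ((z + b) / (2 * a) + 1).re := by
      rw [Complex.add_re, Complex.one_re]
      linarith
    simp only [ratPhi, ratPsi]
    have e1 : ∀ j : ℕ, (z + a + a - b) / (2 * a) + (j : ℂ) = (z - b) / (2 * a) + ((j : ℂ) + 1) :=
      fun j => by field_simp; ring
    have e2 : ∀ j : ℕ, (z + a + a + b) / (2 * a) + (j : ℂ) = (z + b) / (2 * a) + 1 + (j : ℂ) :=
      fun j => by field_simp; ring
    simp_rw [e1, e2]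
    have h1 := prod_add_natCast_ne_zero hs (n + 1)
    have h2 := prod_add_natCast_ne_zero hs1 (n + 1)
    have h3 := mul_prod_add_one ((z + b) / (2 * a)) (n + 1)
    have e3 : ∀ j : ℕ, (z + b) / (2 * a) + ((j : ℂ) + 1) = (z + b) / (2 * a) + 1 + (j : ℂ) :=
      fun j => by ring
    simp_rw [e3] at h3
    rw [mul_div_assoc', mul_div_assoc', div_eq_div_iff h1 h2]
    have e4 : z + b = 2 * a * ((z + b) / (2 * a)) := by field_simp
    have e5 : z + a + b + (((2 * n + 1) * a : ℝ) : ℂ) =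
        2 * a * ((z + b) / (2 * a) + ((n + 1 : ℕ) : ℂ)) := by
      push_cast
      field_simp
      ring
    rw [e5]
    nth_rewrite 1 [e4]
    linear_combination (2 * a * ∏ j ∈ Finset.range n, ((z - b) / (2 * a) + ((j : ℂ) + 1))) * h3
  · have hs : 0 < ((z + a + b) / (2 * a)).re := div_re_pos ha (by simp; linarith)
    simp only [ratPhi, ratPsi]
    have h1 := prod_add_natCast_ne_zero hs (n + 1)
    have h3 := mul_prod_add_one ((z + a - b) / (2 * a)) n
    rw [mul_div_assoc', mul_div_assoc']
    congr 1
    have e4 : z + a - b = 2 * a * ((z + a - b) / (2 * a)) := by field_simp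
    have e5 : z - b + (((2 * n + 1) * a : ℝ) : ℂ) = 2 * a * ((z + a - b) / (2 * a) + (n : ℂ)) := by
      push_cast
      field_simp
      ring
    rw [e5]
    nth_rewrite 1 [e4]
    linear_combination 2 * a * h3

lemma ratPhi_ne_zero {a b x : ℝ} (ha : 0 < a) (hb : 0 < b) (hx : b < x) (n : ℕ) :
    ratPhi a b n x ≠ 0 := by
  have h1 : 0 < (((x : ℂ) + b) / (2 * a)).re := div_re_pos ha (by simp; linarith)
  have h2 : 0 < (((x : ℂ) - b) / (2 * a) + 1).re := by
    rw [Complex.add_re, Complex.one_re]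
    have := div_re_pos (z := (x : ℂ) - b) ha (by simp; linarith)
    linarith
  refine div_ne_zero ?_ (prod_add_natCast_ne_zero h1 _)
  have := prod_add_natCast_ne_zero h2 n
  simpa only [add_assoc, add_comm (1 : ℂ)] using this

/-! ### Necessity -/

/-- The disjunction of the eight conditions. -/
def AnyCond (k₁ k₂ : ℤ) (m : ℝ) (φ ψ : ℝ → ℂ) : Prop :=
  Cond1 k₁ m φ ψ ∨ Cond2 k₂ m φ ψ ∨ Cond3 k₁ k₂ m φ ψ ∨ Cond4 k₁ k₂ m φ ψ ∨
    Cond5 k₁ k₂ m φ ψ ∨ Cond6 k₁ k₂ m φ ψ ∨ Cond7 k₁ k₂ m φ ψ ∨ Cond8 k₁ k₂ m φ ψ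

section necessity

variable {k₁ k₂ : ℤ} {m : ℝ} {φ ψ : ℝ → ℂ}

/-- For `k₁ = 0` the two relations sit at the same point and their difference reads `2 k₂ A = 2 k₂
B`. So either `k₂ = 0`, or `A = B` and then `m B = 0`. -/
lemma anyCond_of_left_zero (hm : -1 ≤ m) (hφ : IntegrableOn (fun r : ℝ => (r : ℂ) * φ r) (Ioo 0 1))
    (hψ : IntegrableOn (fun r : ℝ => (r : ℂ) * ψ r) (Ioo 0 1)) (hψ0 : ¬ RadialEq ψ fun _ => 0)
    (h : ∀ z : ℂ, 2 ≤ z.re → MellinRel (0 : ℤ) k₂ m (mellinT φ) (mellinT ψ) z) :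
    AnyCond 0 k₂ m φ ψ := by
  simp only [MellinRel, Int.cast_zero, Complex.ofReal_zero, add_zero] at h
  by_cases hk : k₂ = 0
  · subst hk
    refine Or.inr (Or.inr (Or.inl ⟨rfl, rfl, (radialEq_cond3_iff hm hφ hψ).2 fun z hz => ?_⟩))
    simpa using (h z hz).1
  · have hk0 : (k₂ : ℂ) ≠ 0 := by exact_mod_cast hk
    have hAB : ∀ z : ℂ, 2 ≤ z.re → mellinT ψ z = mellinT φ z := fun z hz => by
      obtain ⟨h1, h2⟩ := h z hz
      apply mul_left_cancel₀ (mul_ne_zero two_ne_zero hk0)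
      push_cast at h1 h2
      linear_combination h2 - h1
    refine Or.inl ⟨rfl, ?_, radialEq_of_mellinT_eq hψ hφ hAB⟩
    by_contra hm0
    have hm0' : (m : ℂ) ≠ 0 := by exact_mod_cast hm0
    apply hψ0
    refine radialEq_of_mellinT_eq hψ (by simp) fun z hz => ?_
    have h1 := (h z hz).1
    have : m * mellinT ψ z = 0 := by
      rw [← hAB z hz] at h1
      linear_combination -h1
    rw [(mul_eq_zero.1 this).resolve_left hm0']
    simp [mellinT]

/-- For `k₂ = 0` the function `(z+m) B(z)` has period `2k₁`, hence is constant on a progression,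
which forces `B = c/(z+m)`. -/
lemma cond2_of_mellinRel (hk : 0 < k₁) (hm : -1 ≤ m)
    (hφ : IntegrableOn (fun r : ℝ => (r : ℂ) * φ r) (Ioo 0 1))
    (hψ : IntegrableOn (fun r : ℝ => (r : ℂ) * ψ r) (Ioo 0 1))
    (h : ∀ z : ℂ, 2 ≤ z.re → MellinRel k₁ (0 : ℤ) m (mellinT φ) (mellinT ψ) z) :
    Cond2 0 m φ ψ := by
  have ha : (0 : ℝ) < k₁ := by exact_mod_cast hk
  simp only [MellinRel, Int.cast_zero, Complex.ofReal_zero, add_zero, sub_zero] at h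
  set a : ℝ := (k₁ : ℝ)
  have hrec : ∀ z : ℂ, 2 ≤ z.re → (z + m) * mellinT ψ z = (z + 2 * a + m) * mellinT ψ (z + 2 * a) := by
    intro z hz
    have h1 := (h z hz).2
    have h2 := (h (z + a) (by simp; linarith)).1
    rw [show z + a + a = z + 2 * a by ring] at h2
    rw [← h1, h2]
  set c : ℂ := (2 + m) * mellinT ψ 2
  have hj : ∀ j : ℕ, (2 + (2 * a : ℝ) * j + m) * mellinT ψ (2 + (2 * a : ℝ) * j) = c := by
    intro j
    induction j with
    | zero => simp [c]
    | succ j ih =>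
      rw [← ih, hrec (2 + (2 * a : ℝ) * j) (by
        have : 0 ≤ 2 * a * j := by positivity
        simpa using this)]
      push_cast
      rw [show (2 : ℂ) + 2 * a * (j + 1) = 2 + 2 * a * j + 2 * a by ring]
  have hm2 : -2 < m := by linarith
  have hB := (isLaplace_mellinT hψ).eq_of_eq_arith ((isLaplace_one_div hm2).const_mul c)
    (z₀ := 2) (by simp) (show 0 < 2 * a by linarith) (fun j => by
      have hne := ne_zero_of_two_le_re (z := 2 + (2 * a : ℝ) * j) (by
        have : 0 ≤ 2 * a * j := by positivity
        simpa using this) hm2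
      rw [← hj j]
      field_simp)
  refine ⟨rfl, c, ?_, radialEq_const_mul_rpow hψ c hm hB⟩
  refine (radialEq_iff_mellinT_rpow hφ c (m := 0) (by norm_num) (by simp)).2 fun z hz => ?_
  have h1 := (h z hz).1
  have hne := ne_zero_of_two_le_re (z := z + a) (by simp; linarith) hm2
  have hz0 := ne_zero_of_two_le_re hz (show (-2 : ℝ) < 0 by norm_num)
  rw [hB _ (by simp; linarith)] at h1
  rw [Complex.ofReal_zero, add_zero] at hz0 ⊢
  field_simp at h1 ⊢
  linear_combination h1

lemma cabs_of_pos {k : ℤ} (hk : 0 < k) : cabs k = ((k : ℝ) : ℂ) := by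
  simp [cabs, abs_of_pos hk]

/-- The bound `k₂ < m + 2` is what puts the Gamma solution for `ψ` among the Laplace transforms. -/
lemma cond7_of_mellinRel (hk₁ : 0 < k₁) (hk₂ : 0 < k₂) (hlt : (k₂ : ℝ) < m + 2)
    (hφ : IsLaplace (mellinT φ)) (hψ : IsLaplace (mellinT ψ))
    (h : ∀ z : ℂ, 2 ≤ z.re → MellinRel k₁ k₂ m (mellinT φ) (mellinT ψ) z) : Cond7 k₁ k₂ m φ ψ := by
  have ha : (1 : ℝ) ≤ k₁ := by exact_mod_cast hk₁
  have hb : (1 : ℝ) ≤ k₂ := by exact_mod_cast hk₂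
  refine ⟨mul_pos hk₁ hk₂, by rwa [abs_of_pos hk₂], ?_⟩
  obtain ⟨C, hC⟩ := MellinRel.exists_eq_const_mul (by linarith) hφ hψ
    (isLaplace_gammaPhi (a := k₁) (b := k₂) (m := m) (by linarith) (by linarith) (by linarith))
    (isLaplace_gammaPsi (by linarith) (by linarith) (by linarith)) h
    (mellinRel_gamma (by linarith) (by linarith) (by linarith) (by linarith))
    (x := k₂ + 2) (by linarith) (by linarith) (by linarith)
    (gammaQuot_ne_zero (by linarith) (by linarith) (by linarith) (by linarith) (by linarith))
  refine ⟨C, fun z hz => ?_⟩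
  rw [cabs_of_pos hk₁, cabs_of_pos hk₂, ← gammaPhi_apply, ← gammaPsi_apply]
  exact hC z hz

/-- The step-`2k₁` recursion for `B` has right-hand coefficient zero at `w = k₂ - m`, a point of the
half-plane since `m + 2 ≤ k₂`. Hence `B` vanishes at all later points of the progression, and `ψ =
0`, unless the coefficient `w + k₁ - k₂` on the left vanishes somewhere, which says `m = (2j+1) k₁`.
-/
lemma exists_odd_mul_of_mellinRel (hk₁ : 0 < k₁) (hk₂ : 0 < k₂) (hle : m + 2 ≤ k₂)
    (hψ : IntegrableOn (fun r : ℝ => (r : ℂ) * ψ r) (Ioo 0 1)) (hψ0 : ¬ RadialEq ψ fun _ => 0)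
    (h : ∀ z : ℂ, 2 ≤ z.re → MellinRel k₁ k₂ m (mellinT φ) (mellinT ψ) z) :
    ∃ n : ℕ, m = (2 * (n : ℝ) + 1) * k₁ := by
  have ha : (1 : ℝ) ≤ k₁ := by exact_mod_cast hk₁
  have hb : (1 : ℝ) ≤ k₂ := by exact_mod_cast hk₂
  set a : ℝ := (k₁ : ℝ)
  set b : ℝ := (k₂ : ℝ)
  by_contra! hne
  have hrec : ∀ w : ℂ, 2 ≤ w.re → (w + a - b) * (w + 2 * a + b + m) * mellinT ψ (w + 2 * a) =
      (w + a + b) * (w - b + m) * mellinT ψ w := by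
    intro w hw
    have h1 := (h w hw).2
    have h2 := (h (w + a) (by simp; linarith)).1
    rw [show w + a + a = w + 2 * a by ring] at h2
    linear_combination (w + a + b) * h1 - (w + a - b) * h2
  -- The factor `2aj` is the coefficient `w - b + m` itself. It makes `j = 0` trivial, where nothing
  -- is known about `B`.
  have hz : ∀ j : ℕ, (2 * a * j) * mellinT ψ ((b - m + 2 * a * j : ℝ) : ℂ) = 0 := by
    intro j
    induction j with
    | zero => simp
    | succ j ih =>
      set w : ℂ := ((b - m + 2 * a * j : ℝ) : ℂ) with hw
      have hj0 : 0 ≤ 2 * a * j := by positivity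
      have hw2 : 2 ≤ w.re := by rw [hw, Complex.ofReal_re]; linarith
      have e : ((b - m + 2 * a * ((j + 1 : ℕ) : ℝ) : ℝ) : ℂ) = w + 2 * a := by
        rw [hw]; push_cast; ring
      have n1 : w + a - b ≠ 0 := by
        rw [hw]
        have : b - m + 2 * a * j + a - b ≠ 0 := by
          intro h0
          exact hne j (by linarith)
        exact_mod_cast this
      have n2 : w + 2 * a + b + m ≠ 0 := by
        rw [hw]
        have : b - m + 2 * a * j + 2 * a + b + m ≠ 0 := by linarith
        exact_mod_cast this
      have h1 := hrec w hw2
      have e2 : w - b + m = 2 * a * j := by rw [hw]; push_cast; ring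
      rw [e2, mul_assoc (w + a + b), ih, mul_zero] at h1
      rw [e, (mul_eq_zero.1 h1).resolve_left (mul_ne_zero n1 n2), mul_zero]
  refine hψ0 (radialEq_zero_of_arith hψ (x := b - m + 2 * a) (by linarith)
    (show 0 < 2 * a by linarith) fun j => ?_)
  have h1 := hz (j + 1)
  have ha0 : (a : ℂ) ≠ 0 := by exact_mod_cast (show a ≠ 0 by linarith)
  have n1 : (2 * a * ((j + 1 : ℕ) : ℂ)) ≠ 0 :=
    mul_ne_zero (mul_ne_zero two_ne_zero ha0) (by exact_mod_cast Nat.succ_ne_zero j)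
  rw [← (mul_eq_zero.1 h1).resolve_left n1]
  congr 1
  push_cast
  ring

lemma cond8_of_mellinRel (hk₁ : 0 < k₁) (hk₂ : 0 < k₂) (hle : m + 2 ≤ k₂)
    (hφ : IsLaplace (mellinT φ)) (hψ : IntegrableOn (fun r : ℝ => (r : ℂ) * ψ r) (Ioo 0 1))
    (hψ0 : ¬ RadialEq ψ fun _ => 0)
    (h : ∀ z : ℂ, 2 ≤ z.re → MellinRel k₁ k₂ m (mellinT φ) (mellinT ψ) z) : Cond8 k₁ k₂ m φ ψ := by
  have ha : (1 : ℝ) ≤ k₁ := by exact_mod_cast hk₁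
  have hb : (1 : ℝ) ≤ k₂ := by exact_mod_cast hk₂
  obtain ⟨n, hn⟩ := exists_odd_mul_of_mellinRel hk₁ hk₂ hle hψ hψ0 h
  have hm0 : 0 < m := by rw [hn]; positivity
  refine ⟨mul_pos hk₁ hk₂, by rwa [abs_of_pos hk₂], n, by rwa [abs_of_pos hk₁], ?_⟩
  obtain ⟨C, hC⟩ := MellinRel.exists_eq_const_mul (by linarith) hφ (isLaplace_mellinT hψ)
    (isLaplace_ratPhi (a := k₁) (b := k₂) (by linarith) (by linarith) n)
    (isLaplace_ratPsi (by linarith) (by linarith) n) h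
    (mellinRel_rat (by linarith) (by linarith) hn) (x := k₂ + 2) (by linarith) (by linarith)
    (by linarith) (ratPhi_ne_zero (by linarith) (by linarith) (by linarith) n)
  refine ⟨C, fun z hz => ?_⟩
  rw [cabs_of_pos hk₁, cabs_of_pos hk₂]
  exact hC z hz

/-- The relations for `(1, -1)` are solved by `A = (z+m)/((z-1)(z+1))` and `B = 1/z`. -/
lemma cond4_of_mellinRel (hm : -1 ≤ m) (hφ : IntegrableOn (fun r : ℝ => (r : ℂ) * φ r) (Ioo 0 1))
    (hψ : IntegrableOn (fun r : ℝ => (r : ℂ) * ψ r) (Ioo 0 1))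
    (h : ∀ z : ℂ, 2 ≤ z.re → MellinRel (1 : ℤ) (-1 : ℤ) m (mellinT φ) (mellinT ψ) z) :
    Cond4 1 (-1) m φ ψ := by
  have hF : IsLaplace fun z => (z + m) / (z + (-1 : ℝ)) * (1 / (z + (1 : ℝ))) :=
    (isLaplace_one_div (by norm_num)).linear_div m (by norm_num)
  have hrel : ∀ z : ℂ, 2 ≤ z.re → MellinRel (1 : ℤ) (-1 : ℤ) m
      (fun z => (z + m) / (z + (-1 : ℝ)) * (1 / (z + (1 : ℝ)))) (fun z => 1 / (z + (0 : ℝ))) z := by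
    intro z hz
    have n1 := ne_zero_of_two_le_re hz (show (-2 : ℝ) < -1 by norm_num)
    have n2 := ne_zero_of_two_le_re hz (show (-2 : ℝ) < 1 by norm_num)
    have n3 := ne_zero_of_two_le_re hz (show (-2 : ℝ) < 2 by norm_num)
    have n4 := ne_zero_of_two_le_re hz (show (-2 : ℝ) < 0 by norm_num)
    push_cast at n1 n2 n3 n4
    rw [add_zero] at n4
    constructor
    · push_cast
      rw [add_zero]
      field_simp
      ring
    · push_cast
      rw [add_zero, show z + 1 + -1 = z by ring, show z + 1 + 1 = z + 2 by ring]
      field_simp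
      ring
  obtain ⟨C, hC⟩ := MellinRel.exists_eq_const_mul (by norm_num) (isLaplace_mellinT hφ)
    (isLaplace_mellinT hψ) hF (isLaplace_one_div (by norm_num)) h hrel (x := 2) (by norm_num)
    (by norm_num) (by push_cast; linarith) (by
      have h2 : (2 : ℂ) + m ≠ 0 := by
        have : (2 : ℝ) + m ≠ 0 := by linarith
        exact_mod_cast this
      refine mul_ne_zero (div_ne_zero ?_ ?_) (one_div_ne_zero ?_)
      · exact_mod_cast h2
      · norm_num
      · norm_num)
  refine ⟨by norm_num, C, ?_, ?_⟩
  · refine radialEq_of_mellinT_eq hφ (integrableOn_cond4 C m) fun z hz => ?_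
    rw [mellinT_cond4 C m hz, (hC z hz).1]
    push_cast
    rw [← sub_eq_add_neg, div_mul_div_comm, mul_one]
  · exact (radialEq_iff_mellinT_rpow hψ C (m := 0) (by norm_num) (by simp)).2 fun z hz => (hC z hz).2

lemma cond6_of_mellinRel (hk₁ : 2 ≤ k₁) (hm : -1 ≤ m) (hφ : IsLaplace (mellinT φ))
    (hψ : IsLaplace (mellinT ψ))
    (h : ∀ z : ℂ, 2 ≤ z.re → MellinRel k₁ (-1 : ℤ) m (mellinT φ) (mellinT ψ) z) :
    Cond6 k₁ (-1) m φ ψ := by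
  have ha : (2 : ℝ) ≤ k₁ := by exact_mod_cast hk₁
  refine ⟨by linarith, by norm_num, ?_⟩
  rw [Int.cast_neg, Int.cast_one] at h
  obtain ⟨C, hC⟩ := MellinRel.exists_eq_const_mul (by linarith) hφ hψ
    (isLaplace_gammaPhi (a := k₁) (b := -1) (m := m) (by linarith) (by linarith) (by linarith))
    (isLaplace_gammaPsi (by linarith) (by linarith) (by linarith)) h
    (mellinRel_gamma (by linarith) (by linarith) (by linarith) (by linarith))
    (x := 2) (by linarith) (by linarith) (by linarith)
    (gammaQuot_ne_zero (by linarith) (by linarith) (by linarith) (by linarith) (by linarith))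
  refine ⟨C, fun z hz => ?_⟩
  have := hC z hz
  rw [gammaPhi_apply, gammaPsi_apply] at this
  push_cast at this
  simp only [← sub_eq_add_neg, sub_neg_eq_add] at this
  rw [cabs_of_pos (by linarith)]
  push_cast
  exact this

/-- At `w = -k₂ ≥ 2` the coefficient `w + k₂` of the recursion vanishes, so `A` vanishes at every
later point and `φ = 0`, unless the coefficient `w + k₁ + k₂ + m = k₁ + m` on the left is zero as
well. With `m ≥ -1` this leaves `k₁ = 1`, `m = -1`, solved by `A = 1/(z-k₂)` and `B = 1/(z-k₂-1)`.
-/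
lemma cond5_of_mellinRel (hk₁ : 0 < k₁) (hk₂ : k₂ ≤ -2) (hm : -1 ≤ m)
    (hφ : IntegrableOn (fun r : ℝ => (r : ℂ) * φ r) (Ioo 0 1))
    (hψ : IntegrableOn (fun r : ℝ => (r : ℂ) * ψ r) (Ioo 0 1)) (hφ0 : ¬ RadialEq φ fun _ => 0)
    (h : ∀ z : ℂ, 2 ≤ z.re → MellinRel k₁ k₂ m (mellinT φ) (mellinT ψ) z) : Cond5 k₁ k₂ m φ ψ := by
  have ha : (1 : ℝ) ≤ k₁ := by exact_mod_cast hk₁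
  have hb : (k₂ : ℝ) ≤ -2 := by exact_mod_cast hk₂
  have hmk : m + k₁ = 0 := by
    by_contra hne
    have hpos : 0 < m + k₁ := lt_of_le_of_ne (by linarith) (Ne.symm hne)
    set a : ℝ := (k₁ : ℝ)
    set b : ℝ := (k₂ : ℝ)
    have hz : ∀ j : ℕ, (2 * a * j) * mellinT φ ((-b + 2 * a * j : ℝ) : ℂ) = 0 := by
      intro j
      induction j with
      | zero => simp
      | succ j ih =>
        set w : ℂ := ((-b + 2 * a * j : ℝ) : ℂ) with hw
        have hj0 : 0 ≤ 2 * a * j := by positivity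
        have hw2 : 2 ≤ w.re := by rw [hw, Complex.ofReal_re]; linarith
        have e : ((-b + 2 * a * ((j + 1 : ℕ) : ℝ) : ℝ) : ℂ) = w + 2 * a := by
          rw [hw]; push_cast; ring
        have n1 : w + 2 * a - b ≠ 0 := by
          rw [hw]
          have : -b + 2 * a * j + 2 * a - b ≠ 0 := by linarith
          exact_mod_cast this
        have n2 : w + a + b + m ≠ 0 := by
          rw [hw]
          have : -b + 2 * a * j + a + b + m ≠ 0 := by linarith
          exact_mod_cast this
        have h1 := MellinRel.recursion (by linarith) h hw2
        have e2 : w + b = 2 * a * j := by rw [hw]; push_cast; ring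
        rw [e2, mul_right_comm (2 * (a : ℂ) * j), ih, zero_mul] at h1
        rw [e, (mul_eq_zero.1 h1).resolve_left (mul_ne_zero n1 n2), mul_zero]
    refine hφ0 (radialEq_zero_of_arith hφ (x := -b + 2 * a) (by linarith)
      (show 0 < 2 * a by linarith) fun j => ?_)
    have h1 := hz (j + 1)
    have ha0 : (a : ℂ) ≠ 0 := by exact_mod_cast (show a ≠ 0 by linarith)
    have n1 : (2 * a * ((j + 1 : ℕ) : ℂ)) ≠ 0 :=
      mul_ne_zero (mul_ne_zero two_ne_zero ha0) (by exact_mod_cast Nat.succ_ne_zero j)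
    rw [← (mul_eq_zero.1 h1).resolve_left n1]
    congr 1
    push_cast
    ring
  have hk1 : k₁ = 1 := by
    have : (k₁ : ℝ) ≤ 1 := by linarith
    have : k₁ ≤ 1 := by exact_mod_cast this
    omega
  subst hk1
  have hm1 : m = -1 := by push_cast at hmk; linarith
  subst hm1
  have hd1 : (-2 : ℝ) < -k₂ := by linarith
  have hd2 : (-2 : ℝ) < -k₂ - 1 := by linarith
  have hrel : ∀ z : ℂ, 2 ≤ z.re → MellinRel (1 : ℤ) k₂ (-1)
      (fun z => 1 / (z + (-k₂ : ℝ))) (fun z => 1 / (z + (-k₂ - 1 : ℝ))) z := by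
    intro z hz
    have n1 := ne_zero_of_two_le_re hz hd1
    have n2 := ne_zero_of_two_le_re hz hd2
    have n3 := ne_zero_of_two_le_re hz (show (-2 : ℝ) < 1 + -k₂ by linarith)
    push_cast at n1 n2 n3
    constructor
    · push_cast
      rw [show z + 1 + (-(k₂ : ℂ) - 1) = z + -k₂ by ring]
      field_simp
      ring
    · push_cast
      rw [show z + 1 - (k₂ : ℂ) = z + (1 + -k₂) by ring, show z + 1 + -(k₂ : ℂ) = z + (1 + -k₂) by ring,
        show z - (k₂ : ℂ) + -1 = z + (-k₂ - 1) by ring]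
      field_simp
  obtain ⟨C, hC⟩ := MellinRel.exists_eq_const_mul (by norm_num) (isLaplace_mellinT hφ)
    (isLaplace_mellinT hψ) (isLaplace_one_div hd1) (isLaplace_one_div hd2) h hrel (x := -k₂ + 2)
    (by linarith) (by linarith) (by push_cast; linarith)
    (one_div_ne_zero (ne_zero_of_two_le_re (by simp; linarith) hd1))
  have habs : |k₂| = -k₂ := abs_of_neg (by omega)
  refine ⟨by omega, by omega, by norm_num, C, ?_, ?_⟩
  · refine (radialEq_iff_mellinT_rpow hφ C (m := -k₂) (by linarith) fun r hr => ?_).2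
      fun z hz => (hC z hz).1
    rw [habs, show (-k₂ : ℝ) = ((-k₂ : ℤ) : ℝ) by push_cast; rfl, Real.rpow_intCast]
    push_cast
    rfl
  · refine (radialEq_iff_mellinT_rpow hψ C (m := -k₂ - 1) (by linarith) fun r hr => ?_).2
      fun z hz => (hC z hz).2
    rw [habs, show (-k₂ - 1 : ℝ) = ((-k₂ - 1 : ℤ) : ℝ) by push_cast; rfl, Real.rpow_intCast]
    push_cast
    rfl

lemma anyCond_of_nonneg (hk₁ : 0 ≤ k₁) (hm : -1 ≤ m)
    (hφ : IntegrableOn (fun r : ℝ => (r : ℂ) * φ r) (Ioo 0 1))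
    (hψ : IntegrableOn (fun r : ℝ => (r : ℂ) * ψ r) (Ioo 0 1)) (hφ0 : ¬ RadialEq φ fun _ => 0)
    (hψ0 : ¬ RadialEq ψ fun _ => 0) (hf : {n | scWeight k₁ k₂ m φ ψ n ≠ 0}.Finite) :
    AnyCond k₁ k₂ m φ ψ := by
  have hA := isLaplace_mellinT hφ
  have hB := isLaplace_mellinT hψ
  have h := mellinRel_of_finite hk₁ hm hA hB hf
  rcases hk₁.eq_or_lt with rfl | hk₁
  · exact anyCond_of_left_zero hm hφ hψ hψ0 h
  rcases lt_trichotomy k₂ 0 with hk₂ | rfl | hk₂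
  · rcases eq_or_lt_of_le (show k₂ ≤ -1 by omega) with rfl | hk₂'
    · rcases eq_or_lt_of_le (show 1 ≤ k₁ by omega) with rfl | hk₁'
      · exact Or.inr (Or.inr (Or.inr (Or.inl (cond4_of_mellinRel hm hφ hψ h))))
      · exact Or.inr (Or.inr (Or.inr (Or.inr (Or.inr (Or.inl
          (cond6_of_mellinRel hk₁' hm hA hB h))))))
    · exact Or.inr (Or.inr (Or.inr (Or.inr (Or.inl
        (cond5_of_mellinRel hk₁ (by omega) hm hφ hψ hφ0 h)))))
  · exact Or.inr (Or.inl (cond2_of_mellinRel hk₁ hm hφ hψ h))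
  · rcases lt_or_ge (k₂ : ℝ) (m + 2) with hlt | hle
    · exact Or.inr (Or.inr (Or.inr (Or.inr (Or.inr (Or.inr (Or.inl
        (cond7_of_mellinRel hk₁ hk₂ hlt hA hB h)))))))
    · exact Or.inr (Or.inr (Or.inr (Or.inr (Or.inr (Or.inr (Or.inr
        (cond8_of_mellinRel hk₁ hk₂ hle hA hψ hψ0 h)))))))

lemma cabs_neg (k : ℤ) : cabs (-k) = cabs k := by simp [cabs]

lemma anyCond_neg_iff : AnyCond (-k₁) (-k₂) m φ ψ ↔ AnyCond k₁ k₂ m φ ψ := by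
  simp only [AnyCond, Cond1, Cond2, Cond3, Cond4, Cond5, Cond6, Cond7, Cond8, neg_mul_neg, abs_neg,
    neg_eq_zero, cabs_neg]

lemma anyCond_of_finite (hm : -1 ≤ m)
    (hφ : IntegrableOn (fun r : ℝ => (r : ℂ) * φ r) (Ioo 0 1))
    (hψ : IntegrableOn (fun r : ℝ => (r : ℂ) * ψ r) (Ioo 0 1)) (hφ0 : ¬ RadialEq φ fun _ => 0)
    (hψ0 : ¬ RadialEq ψ fun _ => 0) (hf : {n | scWeight k₁ k₂ m φ ψ n ≠ 0}.Finite) :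
    AnyCond k₁ k₂ m φ ψ := by
  rcases le_total 0 k₁ with hk | hk
  · exact anyCond_of_nonneg hk hm hφ hψ hφ0 hψ0 hf
  · rw [← anyCond_neg_iff]
    refine anyCond_of_nonneg (by omega) hm hφ hψ hφ0 hψ0 ?_
    have : {n | scWeight (-k₁) (-k₂) m φ ψ n ≠ 0} = Neg.neg ⁻¹' {n | scWeight k₁ k₂ m φ ψ n ≠ 0} := by
      ext n
      have e := scWeight_neg k₁ k₂ m φ ψ (-n)
      rw [neg_neg] at e
      rw [mem_preimage, mem_ofPred_eq, mem_ofPred_eq, e]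
    rw [this]
    exact hf.preimage neg_injective.injOn

end necessity

/-! ### Sufficiency -/

section sufficiency

variable {k₁ k₂ : ℤ} {m : ℝ} {φ ψ : ℝ → ℂ}

/-- The upper bound says that one of `n`, `n+k₂`, `n+k₁+k₂` is negative, the lower bound that one of
them is positive. -/
lemma mem_Lambda2 {n : ℤ} : n + (k₁ + k₂) ∈ Lambda2 k₁ k₂ ↔
    -(max 0 (max k₂ (k₁ + k₂))) < n ∧ n < max 0 (max (-k₂) (-k₁ - k₂)) := by
  rw [Lambda2, Finset.mem_Icc]
  omega

lemma MellinRel.const_mul {a b : ℝ} {F G : ℂ → ℂ} {z : ℂ} (h : MellinRel a b m F G z) (C : ℂ) :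
    MellinRel a b m (fun z => C * F z) (fun z => C * G z) z :=
  ⟨by linear_combination C * h.1, by linear_combination C * h.2⟩

lemma MellinRel.congr {a b : ℝ} (ha : 0 ≤ a) {A B F G : ℂ → ℂ} {z : ℂ} (hz : 2 ≤ z.re)
    (h : MellinRel a b m F G z) (hA : ∀ z : ℂ, 2 ≤ z.re → A z = F z)
    (hB : ∀ z : ℂ, 2 ≤ z.re → B z = G z) : MellinRel a b m A B z := by
  have hza : 2 ≤ (z + a).re := by simp; linarith
  rw [MellinRel, hA z hz, hB z hz, hA _ hza, hB _ hza]
  exact h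

/-- Outside `Λ₂` the three indices are all nonnegative or all nonpositive, and the weight vanishes
by one of the relations at an integer point `≥ 2`. -/
lemma scWeight_eq_zero_of_mellinRel (hm : -1 ≤ m)
    (h : ∀ z : ℂ, 2 ≤ z.re → MellinRel k₁ k₂ m (mellinT φ) (mellinT ψ) z) {n : ℤ}
    (hn : n + (k₁ + k₂) ∉ Lambda2 k₁ k₂) : scWeight k₁ k₂ m φ ψ n = 0 := by
  rw [mem_Lambda2, not_and_or, not_lt, not_lt] at hn
  rcases hn with hn | hn
  · obtain ⟨l, rfl⟩ : ∃ l, n = -l := ⟨-n, by ring⟩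
    refine (scWeight_eq_zero_iff_of_nonpos hm φ ψ (by omega) (by omega) (by omega)).2 ?_
    have := (h (((2 * l - k₁ - k₂ + 2 : ℤ) : ℝ) : ℂ) (by
      rw [Complex.ofReal_re]
      exact_mod_cast (show (2 : ℤ) ≤ 2 * l - k₁ - k₂ + 2 by omega))).2
    push_cast at this
    exact this
  · refine (scWeight_eq_zero_iff_of_nonneg hm φ ψ (by omega) (by omega) (by omega)).2 ?_
    have := (h (((2 * n + k₂ + 2 : ℤ) : ℝ) : ℂ) (by
      rw [Complex.ofReal_re]
      exact_mod_cast (show (2 : ℤ) ≤ 2 * n + k₂ + 2 by omega))).1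
    push_cast at this
    exact this

lemma scWeight_eq_zero_of_cond1 (h : Cond1 k₁ m φ ψ) (n : ℤ) : scWeight k₁ k₂ m φ ψ n = 0 := by
  obtain ⟨rfl, rfl, h⟩ := h
  rw [scWeight_eq_zero_iff (by norm_num), mellinT_congr h, zero_add, Complex.ofReal_zero]
  ring

lemma scWeight_eq_zero_of_cond2 (hm : -1 ≤ m)
    (hφ : IntegrableOn (fun r : ℝ => (r : ℂ) * φ r) (Ioo 0 1))
    (hψ : IntegrableOn (fun r : ℝ => (r : ℂ) * ψ r) (Ioo 0 1)) (h : Cond2 k₂ m φ ψ) (n : ℤ) :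
    scWeight k₁ k₂ m φ ψ n = 0 := by
  obtain ⟨rfl, C, h1, h2⟩ := h
  have e1 := (radialEq_iff_mellinT_rpow hφ C (m := 0) (by norm_num) (by simp)).1 h1
  have e2 := (radialEq_iff_mellinT_rpow hψ C hm (fun _ _ => rfl)).1 h2
  have hre : ∀ p : ℕ, 2 ≤ ((p : ℂ) + 2).re := fun p => by simp
  rw [scWeight_eq_zero_iff hm, e1 _ (hre _), e2 _ (hre _)]
  have n1 := ne_zero_of_two_le_re (hre (n.natAbs + (n + 0).natAbs)) (show (-2 : ℝ) < 0 by norm_num)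
  have n2 := ne_zero_of_two_le_re (hre (n.natAbs + (n + (k₁ + 0)).natAbs)) (show -2 < m by linarith)
  rw [add_zero] at n1 n2 ⊢
  rw [Complex.ofReal_zero, add_zero] at n1 ⊢
  push_cast [-Int.natCast_natAbs] at n1 n2 ⊢
  rw [add_zero k₁, show (2 : ℂ) * ((n.natAbs : ℂ) + 1) = n.natAbs + n.natAbs + 2 by ring, mul_left_comm,
    mul_one_div_cancel n1, mul_left_comm, mul_one_div_cancel n2]

lemma scWeight_eq_zero_of_cond3 (hm : -1 ≤ m)
    (hφ : IntegrableOn (fun r : ℝ => (r : ℂ) * φ r) (Ioo 0 1))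
    (hψ : IntegrableOn (fun r : ℝ => (r : ℂ) * ψ r) (Ioo 0 1)) (h : Cond3 k₁ k₂ m φ ψ) (n : ℤ) :
    scWeight k₁ k₂ m φ ψ n = 0 := by
  obtain ⟨rfl, rfl, h⟩ := h
  have e := (radialEq_cond3_iff hm hφ hψ).1 h ((n.natAbs + n.natAbs : ℕ) + 2) (by simp)
  rw [scWeight_eq_zero_iff hm, zero_add, add_zero]
  push_cast [-Int.natCast_natAbs] at e ⊢
  linear_combination e

lemma scWeight_eq_zero_of_cond4 (hm : -1 ≤ m)
    (hψ : IntegrableOn (fun r : ℝ => (r : ℂ) * ψ r) (Ioo 0 1)) (h : Cond4 k₁ k₂ m φ ψ) (n : ℤ) :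
    scWeight k₁ k₂ m φ ψ n = 0 := by
  obtain ⟨hk, C, h1, h2⟩ := h
  have hrel : ∀ z : ℂ, 2 ≤ z.re → MellinRel (1 : ℤ) (-1 : ℤ) m (mellinT φ) (mellinT ψ) z := by
    intro z hz
    refine MellinRel.congr (by norm_num) hz (MellinRel.const_mul ?_ C)
      (fun z hz => by rw [mellinT_congr h1, mellinT_cond4 C m hz])
      ((radialEq_iff_mellinT_rpow hψ C (m := 0) (by norm_num) (by simp)).1 h2)
    have n1 := ne_zero_of_two_le_re hz (show (-2 : ℝ) < -1 by norm_num)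
    have n2 := ne_zero_of_two_le_re hz (show (-2 : ℝ) < 1 by norm_num)
    have n3 := ne_zero_of_two_le_re hz (show (-2 : ℝ) < 2 by norm_num)
    have n4 := ne_zero_of_two_le_re hz (show (-2 : ℝ) < 0 by norm_num)
    push_cast at n1 n2 n3 n4
    rw [add_zero] at n4
    rw [← sub_eq_add_neg] at n1
    constructor
    · push_cast
      rw [← sub_eq_add_neg, add_zero]
      field_simp
      ring
    · push_cast
      rw [add_zero, add_sub_cancel_right, add_assoc z 1 1, one_add_one_eq_two]
      field_simp
      ring
  -- For `(1, -1)` the set `Λ₂` is empty, so the relations kill every weight.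
  have hzero : ∀ n, scWeight 1 (-1) m φ ψ n = 0 := fun n =>
    scWeight_eq_zero_of_mellinRel hm hrel (by rw [mem_Lambda2]; omega)
  rcases Int.eq_one_or_neg_one_of_mul_eq_neg_one hk with rfl | rfl
  · obtain rfl : k₂ = -1 := by omega
    exact hzero n
  · obtain rfl : k₂ = 1 := by omega
    have := scWeight_neg 1 (-1) m φ ψ (-n)
    simp only [neg_neg] at this
    exact this.trans (hzero _)

/-- For `1 ≤ l ≤ k₂` the two transforms are evaluated at points that do not depend on `l`, namely
`k₂+2` and `k₁+k₂+2`. Eliminating `B` with the first relation turns the vanishing of the weight into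
`l (m+k₁) A(k₂+2) = 0`. -/
lemma scWeight_ne_zero_of_le (hm : -1 ≤ m) (hk₁ : 0 < k₁)
    (hmk : m + k₁ ≠ 0) (hA : mellinT φ (k₂ + 2) ≠ 0)
    (h : MellinRel k₁ k₂ m (mellinT φ) (mellinT ψ) (k₂ + 2)) {l : ℤ} (hl : 1 ≤ l)
    (hlk : l ≤ k₂) : scWeight k₁ k₂ m φ ψ (-l) ≠ 0 := by
  rw [Ne, scWeight_eq_zero_iff hm]
  intro h0
  push_cast [-Int.natCast_natAbs] at h0
  rw [natAbs_cast_of_nonpos (show -l ≤ 0 by omega),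
    natAbs_cast_of_nonneg (show 0 ≤ -l + k₂ by omega),
    natAbs_cast_of_nonneg (show 0 ≤ -l + (k₁ + k₂) by omega)] at h0
  push_cast at h0
  have h1 := h.1
  push_cast at h1
  rw [show -(-l : ℂ) + (-l + k₂) + 2 = k₂ + 2 by ring,
    show -(-l : ℂ) + (-l + (k₁ + k₂)) + 2 = k₂ + 2 + k₁ by ring] at h0
  have hl0 : (l : ℂ) ≠ 0 := by exact_mod_cast (show l ≠ 0 by omega)
  have hmk' : (m : ℂ) + k₁ ≠ 0 := by exact_mod_cast hmk
  refine mul_ne_zero (mul_ne_zero hl0 hmk') hA ?_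
  linear_combination (1 / 2 : ℂ) * (-(k₂ + 2 + k₁ + k₂ + m : ℂ) * h0 + (-2 * l + 2 * k₂ + k₁ + 2 + m) * h1)

/-- Here `B` is evaluated at `k₁+k₂+2` for every `p`. By the second relation, vanishing of the
weight means that `x A(k₂+x)` agrees at `x = 2p+2` and `x = 2k₁+2`. -/
lemma scWeight_ne_zero_of_gt (hm : -1 ≤ m) {p : ℤ} (hp : 1 ≤ p) (hpk : p < k₁) (hl : 0 ≤ k₂ + p)
    (hA : (2 * p + 2 : ℂ) * mellinT φ (k₂ + (2 * p + 2)) ≠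
      (2 * k₁ + 2 : ℂ) * mellinT φ (k₂ + (2 * k₁ + 2)))
    (h : MellinRel k₁ k₂ m (mellinT φ) (mellinT ψ) (k₂ + k₁ + 2)) :
    scWeight k₁ k₂ m φ ψ (-(k₂ + p)) ≠ 0 := by
  rw [Ne, scWeight_eq_zero_iff hm]
  intro h0
  push_cast [-Int.natCast_natAbs] at h0
  rw [natAbs_cast_of_nonpos (show -(k₂ + p) ≤ 0 by omega),
    natAbs_cast_of_nonpos (show -(k₂ + p) + k₂ ≤ 0 by omega),
    natAbs_cast_of_nonneg (show 0 ≤ -(k₂ + p) + (k₁ + k₂) by omega)] at h0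
  push_cast at h0
  have h1 := h.2
  push_cast at h1
  rw [show -(-(k₂ + p) : ℂ) + -(-(k₂ + p) + k₂) + 2 = k₂ + (2 * p + 2) by ring,
    show -(-(k₂ + p) : ℂ) + (-(k₂ + p) + (k₁ + k₂)) + 2 = k₂ + k₁ + 2 by ring] at h0
  rw [show (k₂ + k₁ + 2 : ℂ) + k₁ = k₂ + (2 * k₁ + 2) by ring] at h1
  exact hA (by linear_combination h0 - h1)

/-! ### Monotonicity of the explicit solutions -/

/-- The factor `x` is absorbed by `Γ(s+1) = sΓ(s)` with `s = x/(2a)`. What remains is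
`2a/gammaRatio` for `b > 0` and `2a * gammaRatio` for `b = -1`, so strict monotonicity applies. -/
lemma mul_gammaPhi_add {a b x : ℝ} (ha : 0 < a) (hx : 0 < x) :
    (x : ℂ) * gammaPhi a b m ((b : ℂ) + x) = ((2 * a * (Real.Gamma ((x + 2 * b) / (2 * a)) *
      Real.Gamma ((x + a + m) / (2 * a)) / (Real.Gamma (x / (2 * a)) *
        Real.Gamma ((x + 2 * b + (a + m)) / (2 * a)))) : ℝ) : ℂ) := by
  have hs : 0 < x / (2 * a) := by positivity
  have e1 : (b + x + (2 * a - b)) / (2 * a) = x / (2 * a) + 1 := by field_simp; ring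
  have hG := Real.Gamma_pos_of_pos hs
  rw [gammaPhi, ← Complex.ofReal_add, gammaQuot_ofReal, e1, Real.Gamma_add_one hs.ne',
    show b + x + b = x + 2 * b by ring, show b + x + (m + a - b) = x + a + m by ring,
    show b + x + (m + a + b) = x + 2 * b + (a + m) by ring, ← Complex.ofReal_mul]
  congr 1
  field_simp

lemma mul_gammaPhi_ne_of_pos {a b x y : ℝ} (ha : 0 < a) (hb : 0 < b) (hm : 0 < a + m) (hx : 0 < x)
    (hxy : x < y) :
    (x : ℂ) * gammaPhi a b m ((b : ℂ) + x) ≠ (y : ℂ) * gammaPhi a b m ((b : ℂ) + y) := by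
  have h2a : 0 < 2 * a := by positivity
  have key : ∀ t : ℝ, 0 < t → (t : ℂ) * gammaPhi a b m ((b : ℂ) + t) =
      ((2 * a / gammaRatio (2 * b / (2 * a)) ((a + m) / (2 * a)) (t / (2 * a)) : ℝ) : ℂ) := by
    intro t ht
    rw [mul_gammaPhi_add ha ht, gammaRatio, ← add_div, ← add_div, ← add_div, ← add_assoc t a m,
      div_div_eq_mul_div, mul_div_assoc (2 * a)]
  rw [key x hx, key y (hx.trans hxy)]
  have hδ : 0 < 2 * b / (2 * a) := by positivity
  have hc : 0 < (a + m) / (2 * a) := by positivity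
  have hsx : 0 < x / (2 * a) := by positivity
  have hst : x / (2 * a) < y / (2 * a) := by gcongr
  have h := gammaRatio_strictAnti hsx hst hδ hc
  have hp := gammaRatio_pos (hsx.trans hst) hδ hc
  exact fun h0 => (div_lt_div_of_pos_left h2a hp h).ne (Complex.ofReal_injective h0)

lemma mul_gammaPhi_ne_of_neg_one {a x y : ℝ} (ha : 0 < a) (hm : 0 < a + m) (hx : 2 < x)
    (hxy : x < y) :
    (x : ℂ) * gammaPhi a (-1) m ((-1 : ℝ) + x) ≠ (y : ℂ) * gammaPhi a (-1) m ((-1 : ℝ) + y) := by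
  have h2a : 0 < 2 * a := by positivity
  have key : ∀ t : ℝ, 0 < t → (t : ℂ) * gammaPhi a (-1) m ((-1 : ℝ) + t) =
      ((2 * a * gammaRatio (2 / (2 * a)) ((a + m) / (2 * a)) ((t - 2) / (2 * a)) : ℝ) : ℂ) := by
    intro t ht
    rw [mul_gammaPhi_add ha ht, gammaRatio, ← add_div, ← add_div, ← add_div,
      show t + 2 * -1 = t - 2 by ring, sub_add_cancel, ← add_assoc t a m]
  rw [key x (by linarith), key y (by linarith)]
  have hδ : 0 < 2 / (2 * a) := by positivity
  have hc : 0 < (a + m) / (2 * a) := by positivity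
  have hsx : 0 < (x - 2) / (2 * a) := div_pos (by linarith) h2a
  have hst : (x - 2) / (2 * a) < (y - 2) / (2 * a) := by gcongr
  have h := gammaRatio_strictAnti hsx hst hδ hc
  exact fun h0 => (mul_lt_mul_of_pos_left h h2a).ne' (Complex.ofReal_injective h0)

/-- The factor `x` supplies the missing `j = 0` factor of the numerator, and the result is a product
of strictly increasing factors `(s+j)/(s+d+j)`. -/
lemma mul_ratPhi_ne {a b x y : ℝ} (ha : 0 < a) (hb : 0 < b) (n : ℕ) (hx : 0 < x) (hxy : x < y) :
    (x : ℂ) * ratPhi a b n ((b : ℂ) + x) ≠ (y : ℂ) * ratPhi a b n ((b : ℂ) + y) := by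
  have h2a : 0 < 2 * a := by positivity
  have ha0 : (a : ℂ) ≠ 0 := by exact_mod_cast ha.ne'
  have key : ∀ t : ℝ, 0 < t → (t : ℂ) * ratPhi a b n ((b : ℂ) + t) =
      ((2 * a * ∏ j ∈ Finset.range (n + 1), (t / (2 * a) + j) / ((t + 2 * b) / (2 * a) + j) : ℝ) :
        ℂ) := by
    intro t ht
    rw [ratPhi, Finset.prod_div_distrib, Finset.prod_range_succ' (fun j : ℕ => t / (2 * a) + (j : ℝ))]
    push_cast
    rw [add_sub_cancel_left, show (b : ℂ) + t + b = t + 2 * b by ring, add_zero, mul_div_assoc',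
      mul_div_assoc']
    congr 1
    field_simp
  rw [key x hx, key y (hx.trans hxy)]
  refine fun h0 => (mul_lt_mul_of_pos_left ?_ h2a).ne (Complex.ofReal_injective h0)
  refine Finset.prod_lt_prod_of_nonempty (fun j _ => by positivity) (fun j _ => ?_) (by simp)
  have hst : x / (2 * a) < y / (2 * a) := by gcongr
  have hs : 0 < x / (2 * a) := by positivity
  have hδ : 0 < 2 * b / (2 * a) := by positivity
  rw [add_div x (2 * b), add_div y (2 * b)]
  generalize x / (2 * a) = s at *
  generalize y / (2 * a) = t at *
  generalize 2 * b / (2 * a) = d at *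
  have hj : (0 : ℝ) ≤ j := Nat.cast_nonneg j
  rw [div_lt_div_iff₀ (by positivity) (by linarith)]
  nlinarith

lemma const_ne_zero_of_mellinT (hφ : IntegrableOn (fun r : ℝ => (r : ℂ) * φ r) (Ioo 0 1))
    (hφ0 : ¬ RadialEq φ fun _ => 0) {C : ℂ} {F : ℂ → ℂ}
    (h : ∀ z : ℂ, 2 ≤ z.re → mellinT φ z = C * F z) : C ≠ 0 := by
  rintro rfl
  refine hφ0 (radialEq_of_mellinT_eq hφ (by simp) fun z hz => ?_)
  rw [h z hz]
  simp [mellinT]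

/-- Common to conditions 7 and 8. With `n = -l`, the exceptional indices are `0 < l < k₁+k₂`, and
they split at `l = k₂` into the two nonvanishing lemmas above. -/
lemma scWeight_ne_zero_iff_of_pos (hm : -1 ≤ m) (hk₁ : 0 < k₁) (hk₂ : 0 < k₂) (hmk : m + k₁ ≠ 0)
    {C : ℂ} (hC : C ≠ 0) {F G : ℂ → ℂ}
    (hF : ∀ z : ℂ, 2 ≤ z.re → MellinRel k₁ k₂ m F G z) (hF0 : F ((k₂ + 2 : ℝ) : ℂ) ≠ 0)
    (hFm : ∀ x y : ℝ, 0 < x → x < y →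
      (x : ℂ) * F (((k₂ : ℝ) : ℂ) + x) ≠ (y : ℂ) * F (((k₂ : ℝ) : ℂ) + y))
    (hφC : ∀ z : ℂ, 2 ≤ z.re → mellinT φ z = C * F z)
    (hψC : ∀ z : ℂ, 2 ≤ z.re → mellinT ψ z = C * G z) (n : ℤ) :
    scWeight k₁ k₂ m φ ψ n ≠ 0 ↔ n + (k₁ + k₂) ∈ Lambda2 k₁ k₂ := by
  have ha : (1 : ℝ) ≤ k₁ := by exact_mod_cast hk₁
  have hb : (1 : ℝ) ≤ k₂ := by exact_mod_cast hk₂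
  have hrel : ∀ z : ℂ, 2 ≤ z.re → MellinRel k₁ k₂ m (mellinT φ) (mellinT ψ) z := fun z hz =>
    MellinRel.congr (by linarith) hz ((hF z hz).const_mul C) hφC hψC
  refine ⟨fun h => by_contra fun hn => h (scWeight_eq_zero_of_mellinRel hm hrel hn), fun hn => ?_⟩
  rw [mem_Lambda2] at hn
  obtain ⟨l, rfl⟩ : ∃ l, n = -l := ⟨-n, by ring⟩
  rcases le_or_gt l k₂ with hl | hl
  · refine scWeight_ne_zero_of_le hm hk₁ hmk ?_ (hrel _ (by simp; linarith)) (by omega) hl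
    rw [hφC _ (by simp; linarith)]
    push_cast at hF0
    exact mul_ne_zero hC hF0
  · obtain ⟨p, rfl⟩ : ∃ p, l = k₂ + p := ⟨l - k₂, by ring⟩
    have hp : (1 : ℝ) ≤ p := by exact_mod_cast (show 1 ≤ p by omega)
    have hpk : (p : ℝ) < k₁ := by exact_mod_cast (show p < k₁ by omega)
    refine scWeight_ne_zero_of_gt hm (by omega) (by omega) (by omega) ?_
      (hrel _ (by simp; linarith))
    rw [hφC _ (by simp; linarith), hφC _ (by simp; linarith), mul_left_comm, mul_left_comm _ C]
    have := hFm (2 * p + 2) (2 * k₁ + 2) (by linarith) (by linarith)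
    push_cast at this
    exact fun h => this (mul_left_cancel₀ hC h)

lemma scWeight_ne_zero_iff_of_cond7 (hm : -1 ≤ m) (hk₁ : 0 < k₁)
    (hφ : IntegrableOn (fun r : ℝ => (r : ℂ) * φ r) (Ioo 0 1)) (hφ0 : ¬ RadialEq φ fun _ => 0)
    (h : Cond7 k₁ k₂ m φ ψ) (n : ℤ) :
    scWeight k₁ k₂ m φ ψ n ≠ 0 ↔ n + (k₁ + k₂) ∈ Lambda2 k₁ k₂ := by
  obtain ⟨hk, hlt, C, h⟩ := h
  have hk₂ : 0 < k₂ := (pos_iff_pos_of_mul_pos hk).1 hk₁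
  rw [abs_of_pos hk₂] at hlt
  have ha : (1 : ℝ) ≤ k₁ := by exact_mod_cast hk₁
  have hb : (1 : ℝ) ≤ k₂ := by exact_mod_cast hk₂
  simp only [cabs_of_pos hk₁, cabs_of_pos hk₂, ← gammaPhi_apply, ← gammaPsi_apply] at h
  exact scWeight_ne_zero_iff_of_pos hm hk₁ hk₂ (by linarith)
    (const_ne_zero_of_mellinT hφ hφ0 fun z hz => (h z hz).1)
    (mellinRel_gamma (by linarith) (by linarith) (by linarith) (by linarith))
    (gammaQuot_ne_zero (by linarith) (by linarith) (by linarith) (by linarith) (by linarith))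
    (fun x y hx hxy => mul_gammaPhi_ne_of_pos (by linarith) (by linarith) (by linarith) hx hxy)
    (fun z hz => (h z hz).1) (fun z hz => (h z hz).2) n

lemma scWeight_ne_zero_iff_of_cond8 (hm : -1 ≤ m) (hk₁ : 0 < k₁)
    (hφ : IntegrableOn (fun r : ℝ => (r : ℂ) * φ r) (Ioo 0 1)) (hφ0 : ¬ RadialEq φ fun _ => 0)
    (h : Cond8 k₁ k₂ m φ ψ) (n : ℤ) :
    scWeight k₁ k₂ m φ ψ n ≠ 0 ↔ n + (k₁ + k₂) ∈ Lambda2 k₁ k₂ := by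
  obtain ⟨hk, -, N, hN, C, h⟩ := h
  have hk₂ : 0 < k₂ := (pos_iff_pos_of_mul_pos hk).1 hk₁
  rw [abs_of_pos hk₁] at hN
  have ha : (1 : ℝ) ≤ k₁ := by exact_mod_cast hk₁
  have hb : (1 : ℝ) ≤ k₂ := by exact_mod_cast hk₂
  have hm0 : 0 < m := by rw [hN]; positivity
  simp only [cabs_of_pos hk₁, cabs_of_pos hk₂] at h
  exact scWeight_ne_zero_iff_of_pos (F := ratPhi k₁ k₂ N) (G := ratPsi k₁ k₂ N) hm hk₁ hk₂
    (by linarith)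
    (const_ne_zero_of_mellinT hφ hφ0 fun z hz => (h z hz).1)
    (mellinRel_rat (by linarith) (by linarith) hN)
    (ratPhi_ne_zero (by linarith) (by linarith) (by linarith) N)
    (fun x y hx hxy => mul_ratPhi_ne (by linarith) (by linarith) N hx hxy)
    (fun z hz => (h z hz).1) (fun z hz => (h z hz).2) n

lemma scWeight_ne_zero_iff_of_cond6 (hm : -1 ≤ m) (hk₁ : 0 < k₁)
    (hφ : IntegrableOn (fun r : ℝ => (r : ℂ) * φ r) (Ioo 0 1)) (hφ0 : ¬ RadialEq φ fun _ => 0)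
    (h : Cond6 k₁ k₂ m φ ψ) (n : ℤ) :
    scWeight k₁ k₂ m φ ψ n ≠ 0 ↔ n + (k₁ + k₂) ∈ Lambda2 k₁ k₂ := by
  obtain ⟨hk, h1, C, h⟩ := h
  obtain rfl : k₂ = -1 := by
    rcases (abs_eq one_pos.le).1 h1 with rfl | rfl
    · omega
    · rfl
  have ha : (2 : ℝ) ≤ k₁ := by exact_mod_cast (show 2 ≤ k₁ by omega)
  have hφC : ∀ z : ℂ, 2 ≤ z.re → mellinT φ z = C * gammaPhi k₁ (-1) m z := fun z hz => by
    rw [(h z hz).1, gammaPhi_apply, cabs_of_pos hk₁]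
    push_cast
    simp only [← sub_eq_add_neg, sub_neg_eq_add]
  have hψC : ∀ z : ℂ, 2 ≤ z.re → mellinT ψ z = C * gammaPsi k₁ (-1) m z := fun z hz => by
    rw [(h z hz).2, gammaPsi_apply, cabs_of_pos hk₁]
    push_cast
    simp only [← sub_eq_add_neg, sub_neg_eq_add]
  have hC := const_ne_zero_of_mellinT hφ hφ0 hφC
  have hrel : ∀ z : ℂ, 2 ≤ z.re → MellinRel k₁ (-1 : ℤ) m (mellinT φ) (mellinT ψ) z := fun z hz => by
    push_cast
    exact MellinRel.congr (by linarith) hz ((mellinRel_gamma (by linarith) (by linarith)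
      (by linarith) (by linarith) z hz).const_mul C) hφC hψC
  refine ⟨fun h => by_contra fun hn => h (scWeight_eq_zero_of_mellinRel hm hrel hn), fun hn => ?_⟩
  rw [mem_Lambda2] at hn
  -- For `k₂ = -1` the exceptional indices are `-k₁+1 < n ≤ 0`, that is `1 ≤ p < k₁`, so only the
  -- monotonicity argument is needed.
  obtain ⟨p, rfl⟩ : ∃ p, n = -(-1 + p) := ⟨1 - n, by ring⟩
  have hp : (1 : ℝ) ≤ p := by exact_mod_cast (show 1 ≤ p by omega)
  have hpk : (p : ℝ) < k₁ := by exact_mod_cast (show p < k₁ by omega)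
  refine scWeight_ne_zero_of_gt hm (by omega) (by omega) (by omega) ?_
    (hrel _ (by simp; linarith))
  rw [hφC _ (by simp; linarith), hφC _ (by simp; linarith), mul_left_comm, mul_left_comm _ C]
  have := mul_gammaPhi_ne_of_neg_one (a := k₁) (m := m) (x := 2 * p + 2) (y := 2 * k₁ + 2)
    (by linarith) (by linarith) (by linarith) (by linarith)
  push_cast at this ⊢
  exact fun h => this (mul_left_cancel₀ hC h)

lemma scWeight_ne_zero_iff_of_cond5 (hk₁ : 0 < k₁) (hm : -1 ≤ m)
    (hφ : IntegrableOn (fun r : ℝ => (r : ℂ) * φ r) (Ioo 0 1))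
    (hψ : IntegrableOn (fun r : ℝ => (r : ℂ) * ψ r) (Ioo 0 1)) (hφ0 : ¬ RadialEq φ fun _ => 0)
    (h : Cond5 k₁ k₂ m φ ψ) (n : ℤ) :
    scWeight k₁ k₂ m φ ψ n ≠ 0 ↔ n + (k₁ + k₂) ∈ Lambda2 k₁ k₂ := by
  obtain ⟨hk, h1, hmk, C, hφC, hψC⟩ := h
  rw [abs_of_pos hk₁] at hmk
  have hk₂ : k₂ < 0 := neg_of_mul_neg_right (by omega) hk₁.le
  rw [abs_of_neg hk₂] at h1 hφC hψC
  obtain rfl : k₁ = 1 := by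
    have : (k₁ : ℝ) ≤ 1 := by linarith
    have : k₁ ≤ 1 := by exact_mod_cast this
    omega
  obtain rfl : m = -1 := by push_cast at hmk; linarith
  obtain ⟨b, rfl⟩ : ∃ b, k₂ = -b := ⟨-k₂, by ring⟩
  rw [neg_neg] at h1 hφC hψC
  have hb : (2 : ℝ) ≤ b := by exact_mod_cast h1
  replace hφC := (radialEq_iff_mellinT_rpow hφ C (m := b) (by linarith) fun r _ => by
    rw [Real.rpow_intCast]; push_cast; rfl).1 hφC
  replace hψC := (radialEq_iff_mellinT_rpow hψ C (m := b - 1) (by linarith) fun r _ => by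
    rw [show (b : ℝ) - 1 = ((b - 1 : ℤ) : ℝ) by push_cast; rfl, Real.rpow_intCast]
    push_cast
    rfl).1 hψC
  have hC := const_ne_zero_of_mellinT hφ hφ0 hφC
  have hrel : ∀ z : ℂ, 2 ≤ z.re → MellinRel (1 : ℤ) (-b : ℤ) (-1) (mellinT φ) (mellinT ψ) z := by
    intro z hz
    refine MellinRel.congr (by norm_num) hz (MellinRel.const_mul ?_ C) hφC hψC
    have n1 := ne_zero_of_two_le_re hz (show (-2 : ℝ) < b by linarith)
    have n2 := ne_zero_of_two_le_re hz (show (-2 : ℝ) < b - 1 by linarith)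
    have n3 := ne_zero_of_two_le_re hz (show (-2 : ℝ) < 1 + b by linarith)
    push_cast at n1 n2 n3
    constructor
    · push_cast
      rw [show z + 1 + ((b : ℂ) - 1) = z + b by ring]
      field_simp
      ring
    · push_cast
      rw [show z + 1 - (-b : ℂ) = z + (1 + b) by ring, show z + 1 + (b : ℂ) = z + (1 + b) by ring,
        show z - (-b : ℂ) + -1 = z + (b - 1) by ring]
      field_simp
  refine ⟨fun h => by_contra fun hn => h (scWeight_eq_zero_of_mellinRel hm hrel hn), fun hn => ?_⟩
  rw [mem_Lambda2] at hn
  have hre : ∀ p : ℕ, 2 ≤ ((p : ℂ) + 2).re := fun p => by simp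
  rw [Ne, scWeight_eq_zero_iff hm, hφC _ (hre _), hψC _ (hre _)]
  intro h0
  push_cast [-Int.natCast_natAbs] at h0
  rw [natAbs_cast_of_nonneg (show 0 ≤ n by omega),
    natAbs_cast_of_nonpos (show n + -b ≤ 0 by omega),
    natAbs_cast_of_nonpos (show n + (1 + -b) ≤ 0 by omega)] at h0
  push_cast at h0
  have hnb : (n : ℝ) + 1 ≤ b := by exact_mod_cast (show n + 1 ≤ b by omega)
  have hn0 : (n : ℂ) ≠ 0 := by exact_mod_cast (show n ≠ 0 by omega)
  have hb0 : (b : ℂ) ≠ 0 := by exact_mod_cast (show b ≠ 0 by omega)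
  have hb1 : (b : ℂ) + 1 ≠ 0 := by exact_mod_cast (show b + 1 ≠ 0 by omega)
  -- The equation becomes `(b-n+1)/(b+1) = (b-n)/b`, whose only solution is `n = 0`; the exceptional
  -- indices are `0 < n < b`.
  rw [show (n : ℂ) + -(n + -b) + 2 + b = 2 * (b + 1) by ring,
    show (n : ℂ) + -(n + (1 + -b)) + 2 + (b - 1) = 2 * b by ring] at h0
  field_simp at h0
  exact hn0 (by linear_combination h0 / 2)

/-- The disjunction of the conditions for a nonzero semicommutator. -/
def ShiftCond (k₁ k₂ : ℤ) (m : ℝ) (φ ψ : ℝ → ℂ) : Prop :=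
  Cond5 k₁ k₂ m φ ψ ∨ Cond6 k₁ k₂ m φ ψ ∨ Cond7 k₁ k₂ m φ ψ ∨ Cond8 k₁ k₂ m φ ψ

lemma shiftCond_neg_iff : ShiftCond (-k₁) (-k₂) m φ ψ ↔ ShiftCond k₁ k₂ m φ ψ := by
  simp only [ShiftCond, Cond5, Cond6, Cond7, Cond8, neg_mul_neg, abs_neg, cabs_neg]

lemma ShiftCond.mul_ne_zero (h : ShiftCond k₁ k₂ m φ ψ) : k₁ * k₂ ≠ 0 := by
  rcases h with h | h | h | h
  · have := h.1; omega
  · have := h.1; omega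
  · exact h.1.ne'
  · exact h.1.ne'

lemma scWeight_ne_zero_iff (hm : -1 ≤ m)
    (hφ : IntegrableOn (fun r : ℝ => (r : ℂ) * φ r) (Ioo 0 1))
    (hψ : IntegrableOn (fun r : ℝ => (r : ℂ) * ψ r) (Ioo 0 1)) (hφ0 : ¬ RadialEq φ fun _ => 0)
    (h : ShiftCond k₁ k₂ m φ ψ) (n : ℤ) :
    scWeight k₁ k₂ m φ ψ n ≠ 0 ↔ n + (k₁ + k₂) ∈ Lambda2 k₁ k₂ := by
  have key : ∀ {k₁ k₂ : ℤ}, 0 < k₁ → ShiftCond k₁ k₂ m φ ψ → ∀ n,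
      (scWeight k₁ k₂ m φ ψ n ≠ 0 ↔ n + (k₁ + k₂) ∈ Lambda2 k₁ k₂) := by
    intro k₁ k₂ hk h
    rcases h with h | h | h | h
    · exact scWeight_ne_zero_iff_of_cond5 hk hm hφ hψ hφ0 h
    · exact scWeight_ne_zero_iff_of_cond6 hm hk hφ hφ0 h
    · exact scWeight_ne_zero_iff_of_cond7 hm hk hφ hφ0 h
    · exact scWeight_ne_zero_iff_of_cond8 hm hk hφ hφ0 h
  rcases lt_trichotomy k₁ 0 with hk | rfl | hk
  · rw [← scWeight_neg, key (by omega) (shiftCond_neg_iff.2 h), mem_Lambda2, mem_Lambda2]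
    omega
  · exact absurd (zero_mul k₂) h.mul_ne_zero
  · exact key hk h n

lemma scWeight_eq_zero_of_cond (hm : -1 ≤ m)
    (hφ : IntegrableOn (fun r : ℝ => (r : ℂ) * φ r) (Ioo 0 1))
    (hψ : IntegrableOn (fun r : ℝ => (r : ℂ) * ψ r) (Ioo 0 1))
    (h : Cond1 k₁ m φ ψ ∨ Cond2 k₂ m φ ψ ∨ Cond3 k₁ k₂ m φ ψ ∨ Cond4 k₁ k₂ m φ ψ) (n : ℤ) :
    scWeight k₁ k₂ m φ ψ n = 0 := by
  rcases h with h | h | h | h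
  · exact scWeight_eq_zero_of_cond1 h n
  · exact scWeight_eq_zero_of_cond2 hm hφ hψ h n
  · exact scWeight_eq_zero_of_cond3 hm hφ hψ h n
  · exact scWeight_eq_zero_of_cond4 hm hψ h n

lemma finite_scWeight_ne_zero_of_anyCond (hm : -1 ≤ m)
    (hφ : IntegrableOn (fun r : ℝ => (r : ℂ) * φ r) (Ioo 0 1))
    (hψ : IntegrableOn (fun r : ℝ => (r : ℂ) * ψ r) (Ioo 0 1)) (hφ0 : ¬ RadialEq φ fun _ => 0)
    (h : AnyCond k₁ k₂ m φ ψ) : {n | scWeight k₁ k₂ m φ ψ n ≠ 0}.Finite := by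
  have h' : (Cond1 k₁ m φ ψ ∨ Cond2 k₂ m φ ψ ∨ Cond3 k₁ k₂ m φ ψ ∨ Cond4 k₁ k₂ m φ ψ) ∨
      ShiftCond k₁ k₂ m φ ψ := by
    simpa only [AnyCond, ShiftCond, or_assoc] using h
  rcases h' with h | h
  · simp [scWeight_eq_zero_of_cond hm hφ hψ h]
  · simp only [scWeight_ne_zero_iff hm hφ hψ hφ0 h]
    exact (Lambda2 k₁ k₂).finite_toSet.preimage (add_left_injective _).injOn

/-- The cardinality is `N₂ + N₃ - 1`, and `N₂ + N₃` is the spread of the three numbers `0`, `k₂`,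
`k₁+k₂`, the largest of their pairwise distances `|k₂|`, `|k₁|`, `|k₁+k₂|`. -/
lemma card_Lambda2 (h : k₁ * k₂ ≠ 0) :
    ((Lambda2 k₁ k₂).card : ℤ) = max (|k₁| - 1) (max (|k₂| - 1) (|k₁ + k₂| - 1)) := by
  have h1 := left_ne_zero_of_mul h
  have h2 := right_ne_zero_of_mul h
  rw [Lambda2, Int.card_Icc]
  simp only [Int.abs_eq_natAbs]
  omega

end sufficiency

end HarmonicToeplitz

open HarmonicToeplitz in
theorem mainTheorem6 (k₁ k₂ : ℤ) (m : ℝ) (hm : -1 ≤ m) (φ ψ : ℝ → ℂ)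
    (hφ : IsTFunction (fun z => φ ‖z‖)) (hψ : IsTFunction (fun z => ψ ‖z‖))
    (hφ0 : ¬ RadialEq φ (fun _ => 0)) (hψ0 : ¬ RadialEq ψ (fun _ => 0)) :
    -- the three symbols are T-functions, so that the operators are defined
    (IsTFunction (quasi k₁ fun r => ((r ^ m : ℝ) : ℂ)) ∧ IsTFunction (quasi k₂ φ) ∧
      IsTFunction (quasi (k₁ + k₂) ψ)) ∧
    (HasFiniteRank (semicomm k₁ k₂ m φ ψ) ↔
      (Cond1 k₁ m φ ψ ∨ Cond2 k₂ m φ ψ ∨ Cond3 k₁ k₂ m φ ψ ∨ Cond4 k₁ k₂ m φ ψ ∨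
        Cond5 k₁ k₂ m φ ψ ∨ Cond6 k₁ k₂ m φ ψ ∨ Cond7 k₁ k₂ m φ ψ ∨ Cond8 k₁ k₂ m φ ψ)) ∧
    ((Cond1 k₁ m φ ψ ∨ Cond2 k₂ m φ ψ ∨ Cond3 k₁ k₂ m φ ψ ∨ Cond4 k₁ k₂ m φ ψ) →
      opRank (semicomm k₁ k₂ m φ ψ) = 0) ∧
    ((Cond5 k₁ k₂ m φ ψ ∨ Cond6 k₁ k₂ m φ ψ ∨ Cond7 k₁ k₂ m φ ψ ∨ Cond8 k₁ k₂ m φ ψ) →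
      LinearMap.range (semicomm k₁ k₂ m φ ψ).toLinearMap =
          Submodule.span ℂ (harmMono '' {k : ℤ | k ∈ Lambda2 k₁ k₂}) ∧
        (∃ C : ℤ → ℂ, (∀ k ∈ Lambda2 k₁ k₂, C k ≠ 0) ∧
          semicomm k₁ k₂ m φ ψ =
            ∑ k ∈ Lambda2 k₁ k₂, C k • tensor (harmMono k) (harmMono (k - k₁ - k₂))) ∧
        ∃ N : ℕ, (N : ℤ) = max (|k₁| - 1) (max (|k₂| - 1) (|k₁ + k₂| - 1)) ∧
          opRank (semicomm k₁ k₂ m φ ψ) = N) := by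
  have hφi := (integrable_norm_comp_iff φ).1 hφ.1
  have hψi := (integrable_norm_comp_iff ψ).1 hψ.1
  have hS := semicomm_apply_harmMono (k₁ := k₁) (k₂ := k₂) hm hφ hψ
  refine ⟨⟨isTFunction_quasi_rpow hm k₁, isTFunction_quasi hφ k₂, isTFunction_quasi hψ _⟩,
    ⟨fun h => anyCond_of_finite hm hφi hψi hφ0 hψ0 ((hasFiniteRank_iff hS).1 h),
      fun h => (hasFiniteRank_iff hS).2 (finite_scWeight_ne_zero_of_anyCond hm hφi hψi hφ0 h)⟩,
    fun h => ?_, fun h => ?_⟩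
  -- All weights vanish, so the empty index set describes the range.
  · rw [opRank_eq_card hS ∅ fun n => by simp [scWeight_eq_zero_of_cond hm hφi hψi h n]]
    simp
  · have hw := scWeight_ne_zero_iff hm hφi hψi hφ0 h
    refine ⟨range_eq_span hS _ hw,
      ⟨fun k => scWeight k₁ k₂ m φ ψ (k - (k₁ + k₂)) * (((k - (k₁ + k₂)).natAbs : ℂ) + 1),
        fun k hk => mul_ne_zero ((hw _).2 (by rwa [sub_add_cancel]))
          (by exact_mod_cast Nat.succ_ne_zero (k - (k₁ + k₂)).natAbs), ?_⟩,
      (Lambda2 k₁ k₂).card, card_Lambda2 (ShiftCond.mul_ne_zero h), opRank_eq_card hS _ hw⟩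
    simp only [sub_sub]
    exact eq_sum_tensor hS _ fun n hn => by_contra fun h0 => hn ((hw n).1 h0)
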